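/- All graphs are finite and simple. The order and the size of a graph are its numbers of vertices and edges. The detour order $\tau(G)$ is the number of vertices of a longest path in $G$, and $G$ is detour-saturated if $\tau(G+e)>\tau(G)$ for every edge $e$ of the complement $\overline{G}$. Let $\Omega$ be the class of triangle-free detour-saturated graphs that contain a cycle (that is, have finite girth). Let $Pr$ be the graph obtained from the Petersen graph by splitting one vertex $x$ (whichever vertex is chosen): $x$, with neighbours $y_1,y_2,y_3$, is replaced by three independent vertices $x_1,x_2,x_3$, and $x_i$ is joined to $y_i$ only, $i=1,2,3$. Let $Q$ be the graph obtained from the Petersen graph by choosing two adjacent vertices and attaching one new leaf to each of them. Theorem. $Pr$ is the smallest graph in $\Omega$: it belongs to $\Omega$, it has minimum order among the graphs in $\Omega$, and it has minimum size among the graphs in $\Omega$ of that order, being up to isomorphism the only graph in $\Omega$ of that order and size. Up to isomorphism there are exactly two graphs in $\Omega$ of order at most $12$, namely the non-isomorphic graphs $Pr$ and $Q$. Both have girth $5$ and order $12$; the size of $Pr$ is $15$ and the size of $Q$ is $17$. -/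

import Mathlib

universe u

namespace DetourSat

/-- The detour order of a (finite) graph: the largest number of vertices of a path. -/
noncomputable def detourOrder {V : Type u} (G : SimpleGraph V) : ℕ :=
  sSup {n : ℕ | ∃ (a b : V) (p : G.Walk a b), p.IsPath ∧ p.support.length = n}

/-- Adding any edge of the complement strictly increases the detour order. -/
def DetourSaturated {V : Type u} (G : SimpleGraph V) : Prop :=
  ∀ a b : V, Gᶜ.Adj a b → detourOrder G < detourOrder (G ⊔ SimpleGraph.edge a b)

/-- Triangle-free detour-saturated graphs of finite girth, i.e. containing a cycle. (There are
many trees and forests, such as the star with three leaves, that are detour-saturated.) -/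
structure TriangleFreeDetourSaturated {V : Type u} (G : SimpleGraph V) : Prop where
  triangleFree : G.CliqueFree 3
  finiteGirth : ¬ G.IsAcyclic
  saturated : DetourSaturated G

/-- The graph obtained from `G` by splitting the vertex `x`: it is replaced by independent
vertices, one for each neighbour `y` of `x`, the new vertex for `y` being joined to `y` only. -/
def splitVertex {V : Type u} (G : SimpleGraph V) (x : V) :
    SimpleGraph ({v : V // v ≠ x} ⊕ G.neighborSet x) where
  Adj s t :=
    match s, t with
    | .inl v, .inl w => G.Adj v.1 w.1
    | .inl v, .inr y => v.1 = y.1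
    | .inr y, .inl v => v.1 = y.1
    | .inr _, .inr _ => False
  symm := ⟨by
    rintro (v | y) (w | z) h
    · exact SimpleGraph.Adj.symm h
    · exact h
    · exact h
    · exact h⟩
  loopless := ⟨by
    rintro (v | y) h
    · exact G.loopless.irrefl _ h
    · exact h⟩

/-- The graph on `{0, …, n - 1}` with the listed edges. -/
def graphOfEdges (n : ℕ) (l : List (ℕ × ℕ)) : SimpleGraph (Fin n) :=
  SimpleGraph.fromRel fun a b => (a.val, b.val) ∈ l

/-- Outer pentagon, spokes and inner pentagram of the Petersen graph. -/
def petersenEdges : List (ℕ × ℕ) :=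
  [(0, 1), (1, 2), (2, 3), (3, 4), (4, 0),
   (0, 5), (1, 6), (2, 7), (3, 8), (4, 9),
   (5, 7), (7, 9), (9, 6), (6, 8), (8, 5)]

/-- The Petersen graph. -/
def petersen : SimpleGraph (Fin 10) := graphOfEdges 10 petersenEdges

/-- The Petersen graph with one of its vertices split into three leaves. -/
def Pr (x : Fin 10) : SimpleGraph ({v : Fin 10 // v ≠ x} ⊕ petersen.neighborSet x) :=
  splitVertex petersen x

/-- The Petersen graph with one leaf attached to each of the two adjacent vertices `0`, `1`. -/
def petersenTwoLeaves : SimpleGraph (Fin 12) :=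
  graphOfEdges 12 (petersenEdges ++ [(0, 10), (1, 11)])

end DetourSat

/-! Let t be the detour order of G, and call two vertices linked if disjoint paths ending in them
have t + 1 vertices in total. If G is detour-saturated and a, b are not adjacent, a longest path of
G + ab runs through ab; cut there and trimmed, it links a and b (`DetourSaturated.linked`). Adjacent
vertices are never linked, since the edge would join the two paths to a path with t + 1 vertices
(`Linked.exists_path`). So distinct vertices are adjacent exactly when they are not linked, and this
rigidity makes an exhaustive search feasible.

In the triangle-free case no vertex has degree two (`exists_third_neighbor`). Hence a cycle forces t
≥ 6, and t is less than the order n, as otherwise G would be complete. For n ≤ 12 this leaves a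
short list of pairs (n, t). Symmetry is reduced by a normal form (`exists_labelled`): a longest path
gets the labels 0, …, t - 1, and the other vertices are sorted by their neighbours on it. Among all
longest paths with a leaf hanging off them, one is taken whose leaf is attached as near to an end as
possible, say at position l, and that leaf gets the label n - 1. If there is no such leaf, then l =
0, and every vertex with a neighbour on the path has a second neighbour.

For each (n, t, l) a binary tree of decisions on edges is replayed, with known edges Y and possible
edges P, Y ⊆ G ⊆ P. Vertex sets of paths in Y show that certain pairs are linked, so that they
cannot be edges. Vertex sets of paths in P over-approximate those in G: a pair that is no longer
possible and is not linked even there refutes the branch. Degrees, the sorting and the choice of l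
refute further branches. The trees are stored as numerals; only the soundness of the replay is
proved (`search_sound`), and the kernel evaluates it. A branch that is not refuted must end in a
graph of order 12 isomorphic to Q if t = 11, and to Pr otherwise.

Conversely, the same families of vertex sets, computed for a fixed graph, verify that Pr (t = 10)
and Q (t = 11) are saturated (`detourSaturated_of_isSaturated`). Since 15 < 17, the sizes separate
the two graphs. -/

namespace DetourSat

/-! ### A certificate checker for the search over partially known graphs

Graphs on `{0, …, 11}` are coded by numbers: bit `16 * u + v` says that `u` and `v` are adjacent.
A family of vertex sets for each vertex is also coded by one number, see `Fam` below. All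
definitions are written with the primitives that the kernel evaluates natively. -/

/-- `f x`, evaluated with a numeral in place of `x`. -/
noncomputable def withValue {α : Type} (x : ℕ) (f : ℕ → α) : α :=
  Nat.rec (motive := fun _ => α) (f 0) (fun k _ => f (Nat.succ k)) x

/-- Written with the recursor, so that the kernel reduces the first argument and then only the
branch that is needed. The same holds for the next two definitions. -/
noncomputable def andThen (b c : Bool) : Bool := Bool.rec (motive := fun _ => Bool) false c b

noncomputable def orElse (b c : Bool) : Bool := Bool.rec (motive := fun _ => Bool) c true b

noncomputable def select {α : Type} (b : Bool) (x y : α) : α :=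
  Bool.rec (motive := fun _ => α) y x b

noncomputable def allBelow (p : ℕ → Bool) (k : ℕ) : Bool :=
  Nat.rec (motive := fun _ => Bool) true (fun i ih => andThen (p i) ih) k

/-- Iterates `f i` for `i = 0, …, k - 1`, starting from `x`. -/
noncomputable def loop (f : ℕ → ℕ → ℕ) (x k : ℕ) : ℕ :=
  Nat.rec (motive := fun _ => ℕ) x f k

/-- Bit `i` of `m`, as a number. -/
def bitAt (m i : ℕ) : ℕ := Nat.land (Nat.shiftRight m i) 1

/-- Moves bit `i` of `m` to position `w * i`, for `i < 12`. -/
noncomputable def spread (w m : ℕ) : ℕ :=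
  loop (fun i x => Nat.add x (Nat.mul (bitAt m i) (Nat.pow 2 (Nat.mul w i)))) 0 12

/-- The families occupy blocks of 4096 bits, one bit for each subset of twelve vertices. The block
of vertex v starts at 4096 * (v + 1); the lowest block is free for a hash. -/
noncomputable def wide (m : ℕ) : ℕ := Nat.mul (spread 4096 m) (Nat.pow 2 4096)

/-- The numbers `i < N` without the bit `v`. -/
def lowMask (N v : ℕ) : ℕ :=
  Nat.div (Nat.sub (Nat.pow 2 N) 1) (Nat.add (Nat.pow 2 (Nat.pow 2 v)) 1)

/-- The numbers `i < N` with the bit `v`. -/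
def highMask (N v : ℕ) : ℕ := Nat.shiftLeft (lowMask N v) (Nat.pow 2 v)

/-- Row `u` of a graph. -/
def row (Y u : ℕ) : ℕ := Nat.land (Nat.shiftRight Y (Nat.mul 16 u)) 4095

def pairMask (a b : ℕ) : ℕ :=
  Nat.lor (Nat.pow 2 (Nat.add (Nat.mul 16 a) b)) (Nat.pow 2 (Nat.add (Nat.mul 16 b) a))

def addPair (a b Y : ℕ) : ℕ := Nat.lor Y (pairMask a b)

def remove (P m : ℕ) : ℕ := Nat.xor P (Nat.land P m)

/-- The members of the family of `u`. -/
def members (u X : ℕ) : ℕ :=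
  Nat.land (Nat.shiftRight X (Nat.sub (Nat.mul 4096 (Nat.succ u)) (Nat.pow 2 u)))
    (highMask 4096 u)

/-- The members of the dual family of `u`. -/
def comembers (u Z : ℕ) : ℕ :=
  Nat.land (Nat.shiftRight Z (Nat.add (Nat.mul 4096 (Nat.succ u)) (Nat.pow 2 u)))
    (lowMask 4096 u)

/-- Extends the paths ending in `u` to the vertices in `m`. -/
noncomputable def push (u m X : ℕ) : ℕ :=
  withValue m fun m => Nat.lor X (Nat.mul (members u X) (wide m))

/-- One upward and one downward pass over the vertices, so that a single sweep extends paths along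
any increasing or decreasing run of labels. -/
noncomputable def sweep (Y X : ℕ) : ℕ :=
  loop (fun i X => withValue (Nat.sub 11 i) fun i => push i (row Y i) X)
    (loop (fun i X => push i (row Y i) X) X 12) 12

/-- Replaces the unused bits below `2 ^ 4096` by a hash of the others, which keeps the lookups of
the kernel fast. -/
def withHash (h : ℕ) : ℕ := Nat.lor h (Nat.mod h 18446744073709551557)

def hashed (X : ℕ) : ℕ := withHash (Nat.mul (Nat.shiftRight X 4096) (Nat.pow 2 4096))

/-- Exchanges the bits of s and of s with k toggled, in all blocks at once. The constant is 53248 =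
13 * 4096: twelve families and the spare block. -/
def flip (k X : ℕ) : ℕ :=
  Nat.lor (Nat.land (Nat.shiftRight X (Nat.pow 2 k)) (lowMask 53248 k))
    (Nat.shiftLeft (Nat.land X (lowMask 53248 k)) (Nat.pow 2 k))

def dropAt (k X : ℕ) : ℕ := Nat.land (Nat.shiftRight X (Nat.pow 2 k)) (lowMask 53248 k)

noncomputable def complements (X : ℕ) : ℕ := loop flip X 12

noncomputable def drop (X : ℕ) : ℕ := loop (fun k Z => Nat.lor Z (dropAt k X)) 0 12

/-- The sets obtained from the complements of the members by deleting `j` elements. -/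
noncomputable def dual (j X : ℕ) : ℕ := loop (fun _ Z => drop Z) (complements X) j

/-- The pairs `a`, `b` such that some member of `a` is disjoint to some member of `b`, where
the two miss `j` of the twelve vertices. -/
noncomputable def meet (a b Z X : ℕ) : ℕ := Nat.land (comembers a Z) (members b X)

/-- With truncated subtraction, 1 - (1 - m) is the sign of m. Only b < a is tested, as `pairMask`
sets both orders. -/
noncomputable def linked (Z X : ℕ) : ℕ :=
  loop (fun a F => loop (fun b F => Nat.lor F
    (Nat.mul (Nat.sub 1 (Nat.sub 1 (meet a b Z X))) (pairMask a b))) F a) 0 12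

/-- The pairs with a common neighbour. -/
noncomputable def square (Y : ℕ) : ℕ :=
  loop (fun i T => Nat.lor T (Nat.mul (row Y i) (spread 16 (row Y i)))) 0 12

/-- The numbers `m` without the highest bit. -/
def clearTop (m : ℕ) : ℕ := Nat.mod m (Nat.pow 2 (Nat.log2 m))

def pathMask (t : ℕ) : ℕ := Nat.sub (Nat.pow 2 t) 1

/-- No vertex of row `y ⊆ p` can have two neighbours and fewer than three. -/
noncomputable def badDegree (m y p : ℕ) : Bool :=
  andThen (Nat.beq (clearTop (clearTop p)) 0)
    (Nat.ble 1 (Nat.lor (clearTop y) (Nat.land y m)))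

/-- The vertices off the path are sorted by their neighbours on the path. -/
noncomputable def badOrder (n t l v y p : ℕ) : Bool :=
  andThen (Nat.ble t v) (andThen (Nat.ble (Nat.add v (select (Nat.beq l 0) 2 3)) n)
    (Nat.ble (Nat.succ (Nat.land p (pathMask t))) (Nat.land y (pathMask t))))

/-- No leaf is nearer to the ends of the path than `l`. -/
noncomputable def badLeaf (n t l v y p : ℕ) : Bool :=
  andThen (Nat.ble t v) (andThen (Nat.ble (Nat.add v 2) n) (andThen (Nat.ble 1 l)
    (andThen (Nat.beq (clearTop p) 0)
      (Nat.ble 1 (Nat.land y (Nat.lor (pathMask l)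
        (Nat.xor (pathMask t) (pathMask (Nat.sub t l)))))))))

/-- The contradictions that are visible at a single vertex. The last alternative is a known edge
that is no longer possible. -/
noncomputable def closed (n t l Y P v : ℕ) : Bool :=
  orElse (badDegree (select (Nat.beq l 0) (pathMask t) 0) (row Y v) (row P v))
    (orElse (badOrder n t l v (row Y v) (row P (Nat.succ v)))
      (orElse (badLeaf n t l v (row Y v) (row P v))
        (Nat.ble 1 (remove (row Y v) (row P v)))))

/-- Closes the families under extension of paths in `P`. -/
noncomputable def saturate (P : ℕ) (k : ℕ → Bool) (fuel : ℕ) : ℕ → Bool :=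
  Nat.rec (motive := fun _ => ℕ → Bool) (fun _ => false)
    (fun _ ih X => withValue (hashed (sweep P X)) fun X' =>
      select (Nat.beq X X') (k X) (ih X')) fuel

/-- A pair that is no longer a possible edge has to be linked; this test detects that it is not,
even when all possible edges are used. Running out of fuel only makes the test fail. -/
noncomputable def unlinked (n t P X a b : ℕ) : Bool :=
  andThen (Nat.ble (Nat.succ b) n) (andThen (Nat.beq (bitAt (row P a) b) 0)
    (saturate P (fun X => Nat.beq (meet a b (dual (Nat.sub 11 t) X) X) 0) 16 X))

/-- The graph with the given adjacency. -/
noncomputable def tabulate (f : ℕ → ℕ → Bool) : ℕ :=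
  loop (fun u Y => loop (fun v Y => select (f u v) (Nat.lor Y (Nat.pow 2 (Nat.add (Nat.mul 16 u) v))) Y) Y 12) 0 12

noncomputable def memPairs (l : List (ℕ × ℕ)) (a b : ℕ) : Bool :=
  List.rec (motive := fun _ => Bool) false
    (fun p _ ih => orElse (orElse (andThen (Nat.beq p.1 a) (Nat.beq p.2 b))
      (andThen (Nat.beq p.1 b) (Nat.beq p.2 a))) ih) l

/-- The Petersen graph with the vertex `0` split into `0`, `10` and `11`. -/
def splitPetersenEdges : List (ℕ × ℕ) :=
  [(0, 1), (1, 2), (2, 3), (3, 4), (4, 10),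
   (11, 5), (1, 6), (2, 7), (3, 8), (4, 9),
   (5, 7), (7, 9), (9, 6), (6, 8), (8, 5)]

noncomputable def targetEdges (t : ℕ) : List (ℕ × ℕ) :=
  select (Nat.beq t 11) (petersenEdges ++ [(0, 10), (1, 11)]) splitPetersenEdges

noncomputable def target (t : ℕ) : ℕ := tabulate (memPairs (targetEdges t))

def entry (c i : ℕ) : ℕ := Nat.land (Nat.shiftRight c (Nat.mul 8 i)) 15

/-- The bytes of `c` are an isomorphism from the target to `Y`. -/
noncomputable def matchesTarget (t Y c : ℕ) : Bool :=
  andThen (allBelow (fun i => Nat.ble (entry c i) 11) 12)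
    (andThen (Nat.beq (loop (fun i m => Nat.lor m (Nat.pow 2 (entry c i))) 0 12) 4095)
      (allBelow (fun i => allBelow (fun j =>
        Nat.beq (bitAt (row Y (entry c i)) (entry c j)) (bitAt (row (target t) i) j)) 12) 12))

/-- Runs through a search tree that is read from the bytes of `c`. The known edges are `Y`, the
possible edges `P`, and `X` consists of vertex sets of paths in `Y`. -/
noncomputable def search (n t l fuel : ℕ) : ℕ → ℕ → ℕ → ℕ → (ℕ → Bool) → Bool :=
  Nat.rec (motive := fun _ => ℕ → ℕ → ℕ → ℕ → (ℕ → Bool) → Bool) (fun _ _ _ _ _ => false)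
    (fun _ ih Y P X c k => withValue (Nat.land c 255) fun w => withValue (Nat.shiftRight c 8) fun c =>
      -- The bytes below 144 = 12 * 12 code a pair (a, b); 144 asks for propagation, and 145
      -- announces a finished graph, followed by the twelve bytes of an isomorphism.
      select (Nat.beq w 144)
        (withValue (hashed (sweep Y X)) fun X =>
          withValue (remove P (Nat.lor (square Y) (linked (dual (Nat.sub 11 t) X) X))) fun P =>
            ih Y P X c k)
        (select (Nat.beq w 145)
          (andThen (Nat.beq Y P) (andThen (Nat.beq n 12)
            (andThen (matchesTarget t Y c) (k (Nat.shiftRight c 96)))))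
          (withValue (Nat.div w 12) fun a => withValue (Nat.mod w 12) fun b =>
            select (Nat.beq a b) (andThen (closed n t l Y P a) (k c))
              (select (Nat.ble a b) (andThen (unlinked n t P X a b) (k c))
                -- Here a > b, and the search branches on this pair. The branch without the edge is
                -- the continuation of the branch with it, and reads the bytes that the latter
                -- leaves over.
                (andThen (Nat.ble a 11) (withValue (addPair a b Y) fun Y' => ih Y' P X c fun c =>
                  withValue (remove P (pairMask a b)) fun P' => ih Y P' X c k)))))) fuel

/-- The path `0, …, t - 1`, with the leaf `n - 1` at `l` if `0 < l`. -/
noncomputable def startEdges (n t l : ℕ) : ℕ :=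
  tabulate fun u v => orElse (andThen (Nat.beq (Nat.succ u) v) (Nat.ble (Nat.succ v) t))
    (orElse (andThen (Nat.beq (Nat.succ v) u) (Nat.ble (Nat.succ u) t))
      (andThen (Nat.ble 1 l) (orElse (andThen (Nat.beq u l) (Nat.beq (Nat.succ v) n))
        (andThen (Nat.beq v l) (Nat.beq (Nat.succ u) n)))))

/-- The pairs of vertices below `n`, where `n - 1` occurs with `l` only if `0 < l`. -/
noncomputable def startPairs (n l : ℕ) : ℕ :=
  tabulate fun u v => andThen (Nat.ble (Nat.succ u) n) (andThen (Nat.ble (Nat.succ v) n)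
    (select (Nat.beq u v) false (orElse (Nat.beq l 0)
      (andThen (orElse (Nat.beq v l) (Nat.ble (Nat.add u 2) n))
        (orElse (Nat.beq u l) (Nat.ble (Nat.add v 2) n))))))

/-- The start value of the families says that every vertex alone is a path. The fuel bounds the
depth of the recursion; if it is too small, the check fails. -/
noncomputable def check (n t l c : ℕ) : Bool :=
  withValue (startEdges n t l) fun Y => withValue (startPairs n l) fun P =>
    withValue (hashed (wide 4095)) fun X => search n t l 10000 Y P X c fun _ => true

end DetourSat

namespace DetourSat

open Finset

/-! ### Bits of the coded graphs -/

section Primitives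

theorem withValue_eq {α : Type} (x : ℕ) (f : ℕ → α) : withValue x f = f x := by
  cases x <;> rfl

theorem andThen_eq (b c : Bool) : andThen b c = (b && c) := by cases b <;> rfl

theorem orElse_eq (b c : Bool) : orElse b c = (b || c) := by cases b <;> rfl

theorem select_eq {α : Type} (b : Bool) (x y : α) : select b x y = if b then x else y := by
  cases b <;> rfl

theorem allBelow_eq_true {p : ℕ → Bool} {k : ℕ} : allBelow p k = true ↔ ∀ i < k, p i = true := by
  induction k with
  | zero => simp [allBelow]
  | succ k ih =>
    have h : allBelow p (k + 1) = andThen (p k) (allBelow p k) := rfl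
    rw [h, andThen_eq, Bool.and_eq_true, ih, Nat.forall_lt_succ_right, and_comm]

theorem loop_zero (f : ℕ → ℕ → ℕ) (x : ℕ) : loop f x 0 = x := rfl

theorem loop_succ (f : ℕ → ℕ → ℕ) (x k : ℕ) : loop f x (k + 1) = f k (loop f x k) := rfl

theorem testBit_loop_or (f : ℕ → ℕ) (g : ℕ → ℕ → ℕ) (hg : ∀ i x, g i x = x ||| f i) (x k j : ℕ) :
    (loop g x k).testBit j = true ↔ x.testBit j = true ∨ ∃ i < k, (f i).testBit j = true := by
  induction k with
  | zero => simp [loop_zero]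
  | succ k ih =>
    rw [loop_succ, hg, Nat.testBit_or, Bool.or_eq_true, ih]
    constructor
    · rintro ((h | ⟨i, hi, h⟩) | h)
      · exact Or.inl h
      · exact Or.inr ⟨i, by omega, h⟩
      · exact Or.inr ⟨k, by omega, h⟩
    · rintro (h | ⟨i, hi, h⟩)
      · exact Or.inl (Or.inl h)
      · rcases Nat.lt_succ_iff_lt_or_eq.1 hi with hi | rfl
        · exact Or.inl (Or.inr ⟨i, hi, h⟩)
        · exact Or.inr h

theorem bitAt_eq (m i : ℕ) : bitAt m i = (m.testBit i).toNat := by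
  have : bitAt m i = m >>> i &&& 1 := rfl
  rw [this, Nat.toNat_testBit, Nat.shiftRight_eq_div_pow, Nat.and_one_is_mod]

theorem testBit_row (Y u v : ℕ) (hv : v < 12) :
    (row Y u).testBit v = Y.testBit (16 * u + v) := by
  have : row Y u = (Y >>> (16 * u)) &&& (2 ^ 12 - 1) := rfl
  rw [this, Nat.testBit_and, Nat.testBit_shiftRight, Nat.testBit_two_pow_sub_one]
  simp [hv]

theorem row_lt (Y u : ℕ) : row Y u < 2 ^ 12 := by
  have : row Y u = (Y >>> (16 * u)) &&& (2 ^ 12 - 1) := rfl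
  rw [this, Nat.and_two_pow_sub_one_eq_mod]
  exact Nat.mod_lt _ (by norm_num)

theorem lt_of_testBit_row {Y u v : ℕ} (h : (row Y u).testBit v = true) : v < 12 := by
  by_contra hv
  have := Nat.testBit_lt_two_pow (lt_of_lt_of_le (row_lt Y u)
    (Nat.pow_le_pow_right (by norm_num) (not_lt.1 hv)))
  simp [this] at h

theorem testBit_remove (P m i : ℕ) :
    (remove P m).testBit i = (P.testBit i && !m.testBit i) := by
  have : remove P m = P ^^^ (P &&& m) := rfl
  rw [this, Nat.testBit_xor, Nat.testBit_and]
  cases P.testBit i <;> cases m.testBit i <;> rfl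

theorem pair_index_inj {a b u v : ℕ} (hb : b < 12) (hv : v < 12) :
    16 * a + b = 16 * u + v ↔ a = u ∧ b = v := by omega

theorem testBit_pairMask {a b u v : ℕ} (ha : a < 12) (hb : b < 12) (hv : v < 12) :
    (pairMask a b).testBit (16 * u + v) = true ↔ (u = a ∧ v = b) ∨ (u = b ∧ v = a) := by
  have : pairMask a b = 2 ^ (16 * a + b) ||| 2 ^ (16 * b + a) := rfl
  rw [this, Nat.testBit_or, Bool.or_eq_true, Nat.testBit_two_pow, Nat.testBit_two_pow,
    decide_eq_true_iff, decide_eq_true_iff, pair_index_inj hb hv, pair_index_inj ha hv]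
  grind

theorem testBit_addPair {a b Y u v : ℕ} (ha : a < 12) (hb : b < 12) (hv : v < 12) :
    (addPair a b Y).testBit (16 * u + v) = true ↔
      Y.testBit (16 * u + v) = true ∨ (u = a ∧ v = b) ∨ (u = b ∧ v = a) := by
  have : addPair a b Y = Y ||| pairMask a b := rfl
  rw [this, Nat.testBit_or, Bool.or_eq_true, testBit_pairMask ha hb hv]

theorem testBit_tabulate (f : ℕ → ℕ → Bool) {u v : ℕ} (hu : u < 12) (hv : v < 12) :
    (tabulate f).testBit (16 * u + v) = f u v := by
  have h : ∀ u' Y j, (loop (fun v Y => select (f u' v)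
      (Nat.lor Y (Nat.pow 2 (Nat.add (Nat.mul 16 u') v))) Y) Y 12).testBit j = true ↔
      Y.testBit j = true ∨ ∃ i < 12, (if f u' i then 2 ^ (16 * u' + i) else 0).testBit j = true := by
    intro u' Y j
    refine testBit_loop_or _ _ (fun i x => ?_) _ _ _
    rw [select_eq]
    split_ifs
    · rfl
    · exact (Nat.or_zero x).symm
  have h' : ∀ k j, (loop (fun u Y => loop (fun v Y => select (f u v)
      (Nat.lor Y (Nat.pow 2 (Nat.add (Nat.mul 16 u) v))) Y) Y 12) 0 k).testBit j = true ↔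
      ∃ u' < k, ∃ i < 12, (if f u' i then 2 ^ (16 * u' + i) else 0).testBit j = true := by
    intro k j
    induction k with
    | zero => simp [loop_zero]
    | succ k ih =>
      rw [loop_succ, h, ih]
      constructor
      · rintro (⟨u', hu', hh⟩ | hh)
        · exact ⟨u', by omega, hh⟩
        · exact ⟨k, by omega, hh⟩
      · rintro ⟨u', hu', hh⟩
        rcases Nat.lt_succ_iff_lt_or_eq.1 hu' with hu' | rfl
        · exact Or.inl ⟨u', hu', hh⟩
        · exact Or.inr hh
  rw [Bool.eq_iff_iff]
  refine (h' 12 _).trans ⟨?_, fun hf => ⟨u, hu, v, hv, by simp [hf]⟩⟩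
  rintro ⟨u', hu', i, hi, hh⟩
  split_ifs at hh with hf
  · rw [Nat.testBit_two_pow, decide_eq_true_iff, pair_index_inj hi hv] at hh
    rw [← hh.1, ← hh.2, hf]
  · simp at hh

/-- If nothing is left after the highest bit is cleared, every bit of m is the highest one. -/
theorem eq_of_clearTop_eq_zero {m i j : ℕ} (h : clearTop m = 0) (hi : m.testBit i = true)
    (hj : m.testBit j = true) : i = j := by
  have key : ∀ r, m.testBit r = true → r = m.log2 := by
    intro r hr
    have h1 : (m % 2 ^ m.log2).testBit r = false := by
      have : clearTop m = m % 2 ^ m.log2 := rfl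
      rw [← this, h, Nat.zero_testBit]
    rw [Nat.testBit_mod_two_pow, hr, Bool.and_true, decide_eq_false_iff_not, not_lt] at h1
    have h2 : 2 ^ r ≤ m := Nat.ge_two_pow_of_testBit hr
    exact le_antisymm ((Nat.le_log2 (by rintro rfl; simp at hr)).2 h2) h1
  rw [key i hi, key j hj]

theorem testBit_clearTop {m i : ℕ} :
    (clearTop m).testBit i = true ↔ i < m.log2 ∧ m.testBit i = true := by
  have : clearTop m = m % 2 ^ m.log2 := rfl
  rw [this, Nat.testBit_mod_two_pow, Bool.and_eq_true, decide_eq_true_iff]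

theorem exists_testBit_of_ne_zero {m : ℕ} (h : m ≠ 0) : ∃ i, m.testBit i = true := by
  by_contra hc
  push Not at hc
  exact h (Nat.zero_of_testBit_eq_false fun i => by simpa using hc i)

theorem exists_pair_of_clearTop_ne_zero {m : ℕ} (h : clearTop m ≠ 0) :
    ∃ i j, i ≠ j ∧ m.testBit i = true ∧ m.testBit j = true := by
  obtain ⟨i, hi⟩ := exists_testBit_of_ne_zero h
  rw [testBit_clearTop] at hi
  refine ⟨i, m.log2, hi.1.ne, hi.2, Nat.testBit_log2 ?_⟩
  rintro rfl
  simp at hi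

theorem eq_or_eq_of_clearTop_clearTop_eq_zero {m i j k : ℕ} (h : clearTop (clearTop m) = 0)
    (hi : m.testBit i = true) (hj : m.testBit j = true) (hk : m.testBit k = true) :
    i = j ∨ i = k ∨ j = k := by
  have key : ∀ r, m.testBit r = true → r = m.log2 ∨ (clearTop m).testBit r = true := by
    intro r hr
    have h2 : 2 ^ r ≤ m := Nat.ge_two_pow_of_testBit hr
    have h3 := (Nat.le_log2 (by rintro rfl; simp at hr)).2 h2
    rcases h3.lt_or_eq with h3 | h3
    · exact Or.inr (testBit_clearTop.2 ⟨h3, hr⟩)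
    · exact Or.inl h3
  rcases key i hi with hi | hi <;> rcases key j hj with hj | hj <;> rcases key k hk with hk | hk
  all_goals first
    | (have := eq_of_clearTop_eq_zero h hi hj; tauto)
    | (have := eq_of_clearTop_eq_zero h hi hk; tauto)
    | (have := eq_of_clearTop_eq_zero h hj hk; tauto)
    | grind

end Primitives

end DetourSat

namespace DetourSat

open Finset

/-! ### Families of vertex sets coded as numbers -/

section Families

set_option exponentiation.threshold 5000

/-- The number with the bits in `s`. -/
def code (s : Finset ℕ) : ℕ := ∑ i ∈ s, 2 ^ i

theorem testBit_code {s : Finset ℕ} {i : ℕ} : (code s).testBit i = true ↔ i ∈ s := by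
  rw [← Nat.mem_bitIndices, ← List.mem_toFinset, code, Finset.toFinset_bitIndices_sum_two_pow]

theorem exists_code {n : ℕ} (hn : n < 4096) : ∃ s ⊆ range 12, code s = n := by
  refine ⟨n.bitIndices.toFinset, fun i hi => ?_, Finset.sum_toFinset_bitIndices_two_pow n⟩
  rw [List.mem_toFinset, Nat.mem_bitIndices] at hi
  rw [mem_range]
  by_contra h
  have h1 := Nat.ge_two_pow_of_testBit hi
  have h2 : 2 ^ 12 ≤ 2 ^ i := Nat.pow_le_pow_right (by norm_num) (not_lt.1 h)
  omega

theorem code_range : code (range 12) = 4095 := by decide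

theorem code_lt {s : Finset ℕ} (hs : s ⊆ range 12) : code s < 4096 := by
  have : code s ≤ code (range 12) := Finset.sum_le_sum_of_subset hs
  rw [code_range] at this
  omega

theorem code_insert {s : Finset ℕ} {k : ℕ} (hk : k ∉ s) : code (insert k s) = code s + 2 ^ k := by
  rw [code, Finset.sum_insert hk, add_comm, code]

theorem code_erase {s : Finset ℕ} {k : ℕ} (hk : k ∈ s) : code (s.erase k) + 2 ^ k = code s := by
  rw [code, Finset.sum_erase_add _ _ hk, code]

/-- The product consists of copies of B at the positions w * j with b j. As B has at most w bits,
the copies do not overlap and no carries occur. -/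
theorem testBit_mul_sum (w B : ℕ) (hB : B < 2 ^ w) (b : ℕ → Bool) (K i : ℕ) :
    B * (∑ j ∈ range K, (b j).toNat * 2 ^ (w * j)) < 2 ^ (w * K) ∧
    ((B * ∑ j ∈ range K, (b j).toNat * 2 ^ (w * j)).testBit i = true ↔
      i / w < K ∧ b (i / w) = true ∧ B.testBit (i % w) = true) := by
  rcases Nat.eq_zero_or_pos w with rfl | hw
  · obtain rfl : B = 0 := by simpa using hB
    simp
  induction K with
  | zero => simp
  | succ K ih =>
    rw [sum_range_succ, mul_add, add_comm, mul_left_comm, mul_comm B, mul_comm, mul_assoc]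
    have hlt : B * (b K).toNat < 2 ^ w := by cases b K <;> simp [hB]
    constructor
    · rw [Nat.mul_succ, pow_add]
      have h1 : 2 ^ (w * K) * (B * (b K).toNat + 1) ≤ 2 ^ (w * K) * 2 ^ w :=
        Nat.mul_le_mul_left _ hlt
      have := ih.1
      rw [mul_add, mul_one] at h1
      omega
    · rw [Nat.testBit_two_pow_mul_add _ ih.1]
      split_ifs with hi
      · rw [ih.2]
        have : i / w < K := by rw [Nat.div_lt_iff_lt_mul hw, mul_comm]; exact hi
        constructor
        · exact fun h => ⟨by omega, h.2⟩
        · exact fun h => ⟨this, h.2⟩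
      · rw [not_lt] at hi
        rcases Nat.lt_or_ge (i - w * K) w with h2 | h2
        · have h3 : i / w = K := by
            rw [Nat.div_eq_iff hw]
            constructor
            · rw [mul_comm]; exact hi
            · rw [mul_comm]; omega
          have h4 : i % w = i - w * K := by
            have := Nat.div_add_mod i w
            rw [h3] at this
            omega
          rw [h3, h4]
          cases b K <;> simp
        · have h3 : K + 1 ≤ i / w := by
            rw [Nat.le_div_iff_mul_le hw, Nat.add_mul, mul_comm K]
            omega
          rw [Nat.testBit_lt_two_pow (hlt.trans_le (Nat.pow_le_pow_right (by norm_num) h2))]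
          simp only [Bool.false_eq_true, false_iff, not_and]
          omega

theorem spread_eq (w m : ℕ) :
    spread w m = ∑ j ∈ range 12, (m.testBit j).toNat * 2 ^ (w * j) := by
  have : ∀ k, loop (fun i x => Nat.add x (Nat.mul (bitAt m i) (Nat.pow 2 (Nat.mul w i)))) 0 k =
      ∑ j ∈ range k, (m.testBit j).toNat * 2 ^ (w * j) := by
    intro k
    induction k with
    | zero => rfl
    | succ k ih => rw [loop_succ, ih, sum_range_succ, bitAt_eq]; rfl
  exact this 12

theorem testBit_mul_spread {w B m v s : ℕ} (hB : B < 2 ^ w) (hs : s < w) (hv : v < 12) :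
    (B * spread w m).testBit (w * v + s) = (m.testBit v && B.testBit s) := by
  have hw : 0 < w := by omega
  rw [Bool.eq_iff_iff, spread_eq, (testBit_mul_sum w B hB _ 12 _).2, Bool.and_eq_true,
    Nat.mul_add_div hw, Nat.div_eq_of_lt hs, Nat.mul_add_mod, Nat.mod_eq_of_lt hs]
  simp [hv]

/-- With p = 2 ^ v, the number 2 ^ N - 1 is (2 ^ p - 1) * (2 ^ p + 1) times the sum of the powers 2
^ (2 * p * j), j < K. Division by 2 ^ p + 1 leaves p ones at the bottom of each block of length 2 *
p, and these are the positions whose bit v is clear. -/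
theorem testBit_lowMask {N v K : ℕ} (hN : N = 2 * 2 ^ v * K) (i : ℕ) :
    (lowMask N v).testBit i = true ↔ i < N ∧ i.testBit v = false := by
  set p := 2 ^ v with hp
  have hp0 : 0 < p := by positivity
  have h1 : lowMask N v = (2 ^ p - 1) * ∑ j ∈ range K, true.toNat * 2 ^ (2 * p * j) := by
    have hlow : lowMask N v = (2 ^ N - 1) / (2 ^ p + 1) := rfl
    rw [hlow]
    refine Nat.div_eq_of_eq_mul_left (by positivity) ?_
    have hg := Nat.geomSum_eq (m := 2 ^ (2 * p)) (Nat.one_lt_two_pow (by omega)) K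
    have hdvd : 2 ^ (2 * p) - 1 ∣ (2 ^ (2 * p)) ^ K - 1 := by
      simpa using Nat.sub_dvd_pow_sub_pow (2 ^ (2 * p)) 1 K
    have h2 : (∑ k ∈ range K, (2 ^ (2 * p)) ^ k) * (2 ^ (2 * p) - 1) = (2 ^ (2 * p)) ^ K - 1 := by
      rw [hg, Nat.div_mul_cancel hdvd]
    have h3 : (2 ^ p - 1) * (2 ^ p + 1) = 2 ^ (2 * p) - 1 := by
      rw [mul_comm, ← Nat.sq_sub_sq (2 ^ p) 1, ← pow_mul, mul_comm p 2, one_pow]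
    simp only [Bool.toNat_true, one_mul]
    rw [hN, pow_mul, ← h2, ← h3]
    simp only [← pow_mul]
    ring
  rw [h1, (testBit_mul_sum (2 * p) (2 ^ p - 1) ?_ (fun _ => true) K i).2]
  · have hdiv : i / (2 * p) < K ↔ i < N := by
      rw [Nat.div_lt_iff_lt_mul (by omega), hN, mul_comm]
    rw [hdiv, Nat.testBit_two_pow_sub_one, Nat.testBit_eq_decide_div_mod_eq, ← hp,
      mul_comm 2 p, Nat.mod_mul]
    simp only [true_and, decide_eq_true_eq, decide_eq_false_iff_not]
    have h4 := Nat.mod_lt i hp0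
    have h5 := Nat.mod_two_eq_zero_or_one (i / p)
    rcases h5 with h5 | h5 <;> simp [h5, h4]
  · have : 2 ^ p ≤ 2 ^ (2 * p) := Nat.pow_le_pow_right (by norm_num) (by omega)
    have : 0 < 2 ^ p := by positivity
    omega

theorem pow_dvd_of_lt {v : ℕ} (hv : v < 12) : 4096 = 2 * 2 ^ v * 2 ^ (11 - v) := by
  rw [mul_assoc, ← pow_add, ← pow_succ']
  have : v + (11 - v) + 1 = 12 := by omega
  rw [this]; norm_num

theorem testBit_lowMask_field {v : ℕ} (hv : v < 12) (i : ℕ) :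
    (lowMask 4096 v).testBit i = true ↔ i < 4096 ∧ i.testBit v = false :=
  testBit_lowMask (pow_dvd_of_lt hv) i

theorem testBit_lowMask_all {v : ℕ} (hv : v < 12) (i : ℕ) :
    (lowMask 53248 v).testBit i = true ↔ i < 53248 ∧ i.testBit v = false := by
  refine testBit_lowMask (K := 13 * 2 ^ (11 - v)) ?_ i
  have := pow_dvd_of_lt hv
  rw [mul_left_comm, ← this]
  norm_num

/-- `s` is a member of the family of `v` coded by `X`. -/
def Fam (X v : ℕ) (s : Finset ℕ) : Prop := X.testBit (4096 * (v + 1) + code s) = true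

theorem testBit_index {v k : ℕ} (hk : k < 12) {s : Finset ℕ} (hs : s ⊆ range 12) :
    (4096 * v + code s).testBit k = true ↔ k ∈ s := by
  have := Nat.testBit_two_pow_mul_add v (i := 12) (b := code s) (code_lt hs) k
  rw [if_pos hk] at this
  rw [← testBit_code, ← this]

theorem testBit_index_false {v k : ℕ} (hk : k < 12) {s : Finset ℕ} (hs : s ⊆ range 12) :
    (4096 * v + code s).testBit k = false ↔ k ∉ s := by
  rw [← testBit_index (v := v) hk hs, Bool.not_eq_true]

theorem two_pow_le {u : ℕ} (hu : u < 12) : 2 ^ u ≤ 2048 := by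
  calc 2 ^ u ≤ 2 ^ 11 := Nat.pow_le_pow_right (by norm_num) (by omega)
    _ = 2048 := by norm_num

/-- The families store the vertices of a path without its end u. Inserting u adds 2 ^ u to the code,
so one shift inserts u in all sets, and the mask discards the stored sets that contain u already. -/
theorem testBit_members {u X : ℕ} (hu : u < 12) {s : Finset ℕ} (hs : s ⊆ range 12) :
    (members u X).testBit (code s) = true ↔ u ∈ s ∧ Fam X u (s.erase u) := by
  have h1 : members u X = (X >>> (4096 * (u + 1) - 2 ^ u)) &&& (lowMask 4096 u <<< 2 ^ u) := rfl
  have hp := two_pow_le hu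
  rw [h1, Nat.testBit_and, Nat.testBit_shiftRight, Nat.testBit_shiftLeft, Bool.and_eq_true,
    Bool.and_eq_true, decide_eq_true_iff, testBit_lowMask_field hu]
  have hlt := code_lt hs
  constructor
  · rintro ⟨h2, h3, h4, h5⟩
    have hmem : u ∈ s := by
      rw [← testBit_code]
      have := Nat.testBit_two_pow_add_eq (code s - 2 ^ u) u
      rw [h5] at this
      rw [Nat.add_sub_cancel' h3] at this
      simpa using this
    refine ⟨hmem, ?_⟩
    have := code_erase hmem
    rw [Fam]
    convert h2 using 2
    omega
  · rintro ⟨hmem, h2⟩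
    have := code_erase hmem
    have h3 : code s - 2 ^ u = code (s.erase u) := by omega
    refine ⟨?_, by omega, h3 ▸ code_lt ((erase_subset _ _).trans hs), ?_⟩
    · rw [Fam] at h2
      convert h2 using 2
      omega
    · rw [h3, ← Bool.not_eq_true, testBit_code]
      simp

/-- A position below 4096 with bit u clear stays below 4096 when 2 ^ u is added. So the shifted
family stays within one block, as the multiplication in `push` requires. -/
theorem members_lt {u X : ℕ} (hu : u < 12) : members u X < 2 ^ 4096 := by
  refine Nat.lt_pow_two_of_testBit _ fun i hi => ?_
  have h1 : members u X = (X >>> (4096 * (u + 1) - 2 ^ u)) &&& (lowMask 4096 u <<< 2 ^ u) := rfl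
  rw [h1, Nat.testBit_and, Nat.testBit_shiftLeft, ← Bool.not_eq_true, Bool.and_eq_true,
    Bool.and_eq_true, decide_eq_true_iff, testBit_lowMask_field hu]
  rintro ⟨-, h3, h4, h5⟩
  have h6 := Nat.testBit_two_pow_add_eq (i - 2 ^ u) u
  rw [Nat.add_sub_cancel' h3, h5] at h6
  have h7 : i = 4096 + (i - 4096) := by omega
  have h8 : i - 4096 < 2 ^ u := by omega
  have h9 := Nat.testBit_two_pow_mul_add (2 ^ (12 - u)) h8 u
  rw [← pow_add, Nat.add_sub_cancel' hu.le] at h9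
  norm_num at h9
  rw [← h7, h6] at h9
  simp at h9
  omega

theorem wide_eq (m : ℕ) : wide m = spread 4096 m * 2 ^ 4096 := rfl

/-- A single multiplication copies the paths ending in u to the blocks of all v in m. Sets that
contain v itself may be stored too; they do not code paths, but `Sound` says nothing about them, and
`members` and `comembers` never read them. -/
theorem fam_push {u v m X : ℕ} (hu : u < 12) (hv : v < 12) {s : Finset ℕ} (hs : s ⊆ range 12) :
    Fam (push u m X) v s ↔ Fam X v s ∨ (m.testBit v = true ∧ u ∈ s ∧ Fam X u (s.erase u)) := by
  have h1 : push u m X = X ||| members u X * (spread 4096 m * 2 ^ 4096) := by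
    rw [push, withValue_eq]; rfl
  have h2 : 4096 ≤ 4096 * (v + 1) + code s := by omega
  have h3 : 4096 * (v + 1) + code s - 4096 = 4096 * v + code s := by omega
  rw [Fam, h1, Nat.testBit_or, Bool.or_eq_true, ← mul_assoc, Nat.testBit_mul_two_pow, h3,
    testBit_mul_spread (members_lt hu) (code_lt hs) hv, Bool.and_eq_true, Bool.and_eq_true,
    decide_eq_true_iff, testBit_members hu hs]
  simp only [Fam, h2, true_and]

theorem fam_start {v : ℕ} (hv : v < 12) {s : Finset ℕ} (hs : s ⊆ range 12) :
    Fam (wide 4095) v s ↔ s = ∅ := by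
  have hB : 1 < 2 ^ 4096 := Nat.one_lt_two_pow (by norm_num)
  have h3 : 4096 * (v + 1) + code s - 4096 = 4096 * v + code s := by omega
  have h4 : (4095 : ℕ).testBit v = true := by
    rw [show 4095 = 2 ^ 12 - 1 by norm_num, Nat.testBit_two_pow_sub_one]
    simpa using hv
  rw [Fam, wide_eq, Nat.testBit_mul_two_pow, h3, ← one_mul (spread _ _),
    testBit_mul_spread hB (code_lt hs) hv, h4]
  have h5 : (decide (4096 ≤ 4096 * (v + 1) + code s)) = true := by
    rw [decide_eq_true_iff]; omega
  rw [h5, Bool.true_and, Bool.true_and, Nat.testBit_one_eq_true_iff_self_eq_zero]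
  constructor
  · intro h
    refine Finset.eq_empty_of_forall_notMem fun i hi => ?_
    rw [← testBit_code, h] at hi
    simp at hi
  · rintro rfl; rfl

theorem fam_hashed {X v : ℕ} {s : Finset ℕ} : Fam (hashed X) v s ↔ Fam X v s := by
  have h1 : hashed X = X >>> 4096 * 2 ^ 4096 |||
    (X >>> 4096 * 2 ^ 4096) % 18446744073709551557 := rfl
  have h2 : (X >>> 4096 * 2 ^ 4096) % 18446744073709551557 < 2 ^ (4096 * (v + 1) + code s) := by
    calc _ < 18446744073709551557 := Nat.mod_lt _ (by norm_num)
      _ ≤ 2 ^ 64 := by norm_num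
      _ ≤ _ := Nat.pow_le_pow_right (by norm_num) (by omega)
  have h3 : 4096 + (4096 * (v + 1) + code s - 4096) = 4096 * (v + 1) + code s := by omega
  rw [Fam, h1, Nat.testBit_or, Nat.testBit_lt_two_pow h2, Bool.or_false, Nat.testBit_mul_two_pow,
    Nat.testBit_shiftRight, h3]
  have h5 : (decide (4096 ≤ 4096 * (v + 1) + code s)) = true := by
    rw [decide_eq_true_iff]; omega
  rw [h5, Bool.true_and, Fam]

theorem index_lt {v : ℕ} (hv : v < 12) {s : Finset ℕ} (hs : s ⊆ range 12) :
    4096 * (v + 1) + code s < 53248 := by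
  have := code_lt hs
  omega

theorem fam_dropAt {k v X : ℕ} (hk : k < 12) (hv : v < 12) {s : Finset ℕ} (hs : s ⊆ range 12) :
    Fam (dropAt k X) v s ↔ k ∉ s ∧ Fam X v (insert k s) := by
  have h1 : dropAt k X = X >>> 2 ^ k &&& lowMask 53248 k := rfl
  rw [Fam, h1, Nat.testBit_and, Bool.and_eq_true, testBit_lowMask_all hk,
    testBit_index_false hk hs, Nat.testBit_shiftRight]
  constructor
  · rintro ⟨h2, h3, h4⟩
    refine ⟨h4, ?_⟩
    rw [Fam, code_insert h4]
    convert h2 using 2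
    ring
  · rintro ⟨h4, h2⟩
    rw [Fam, code_insert h4] at h2
    refine ⟨?_, index_lt hv hs, h4⟩
    convert h2 using 2
    ring

theorem fam_flip {k v X : ℕ} (hk : k < 12) (hv : v < 12) {s : Finset ℕ} (hs : s ⊆ range 12) :
    Fam (flip k X) v s ↔ Fam X v (symmDiff s {k}) := by
  have h1 : flip k X = dropAt k X ||| (X &&& lowMask 53248 k) <<< 2 ^ k := rfl
  have hp := two_pow_le hk
  rw [Fam, h1, Nat.testBit_or, Bool.or_eq_true]
  rw [show (dropAt k X).testBit (4096 * (v + 1) + code s) = true ↔ _ from fam_dropAt hk hv hs]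
  rw [Nat.testBit_shiftLeft, Nat.testBit_and, Bool.and_eq_true, Bool.and_eq_true,
    testBit_lowMask_all hk, decide_eq_true_iff]
  by_cases hks : k ∈ s
  · have h2 : symmDiff s {k} = s.erase k := by
      ext x; simp only [Finset.mem_symmDiff, mem_singleton, mem_erase]; grind
    have h3 := code_erase hks
    have h4 : 4096 * (v + 1) + code s - 2 ^ k = 4096 * (v + 1) + code (s.erase k) := by omega
    have hs' : s.erase k ⊆ range 12 := (erase_subset k s).trans hs
    rw [h2, h4, testBit_index_false hk hs', Fam]
    have := index_lt hv hs'
    simp only [hks, not_true_eq_false, false_and, false_or, notMem_erase, not_false_eq_true,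
      and_true, this]
    exact ⟨fun h => h.2, fun h => ⟨by omega, h⟩⟩
  · have h2 : symmDiff s {k} = insert k s := by
      ext x; simp only [Finset.mem_symmDiff, mem_singleton, mem_insert]; grind
    rw [h2]
    simp only [hks, not_false_eq_true, true_and]
    refine or_iff_left ?_
    rintro ⟨h3, -, -, h5⟩
    have := Nat.testBit_two_pow_add_eq (4096 * (v + 1) + code s - 2 ^ k) k
    rw [Nat.add_sub_cancel' h3, h5, (testBit_index_false hk hs).2 hks] at this
    simp at this

theorem fam_complements {v X : ℕ} (hv : v < 12) {s : Finset ℕ} (hs : s ⊆ range 12) :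
    Fam (complements X) v s ↔ Fam X v (range 12 \ s) := by
  have key : ∀ r ≤ 12, ∀ s ⊆ range 12, (Fam (loop flip X r) v s ↔
      Fam X v (symmDiff s (range r))) := by
    intro r
    induction r with
    | zero => intro _ s _; rw [loop_zero, range_zero, ← bot_eq_empty, symmDiff_bot]
    | succ r ih =>
      intro hr s hs
      have hsr : symmDiff s {r} ⊆ range 12 := by
        intro x hx
        rw [Finset.mem_symmDiff, mem_singleton] at hx
        rcases hx with hx | hx
        · exact hs hx.1
        · rw [hx.1, mem_range]; omega
      rw [loop_succ, fam_flip (by omega) hv hs, ih (by omega) _ hsr]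
      have : symmDiff (symmDiff s {r}) (range r) = symmDiff s (range (r + 1)) := by
        ext x
        simp only [Finset.mem_symmDiff, mem_singleton, mem_range]
        grind
      rw [this]
  rw [complements, key 12 le_rfl s hs]
  have : symmDiff s (range 12) = range 12 \ s := by
    ext x
    have := @hs x
    simp only [Finset.mem_symmDiff, mem_sdiff]
    grind
  rw [this]

theorem fam_drop {v X : ℕ} (hv : v < 12) {s : Finset ℕ} (hs : s ⊆ range 12) :
    Fam (drop X) v s ↔ ∃ k < 12, k ∉ s ∧ Fam X v (insert k s) := by
  refine (testBit_loop_or (fun k => dropAt k X) _ (fun _ _ => rfl) 0 12 _).trans ?_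
  simp only [Nat.zero_testBit, Bool.false_eq_true, false_or]
  refine exists_congr fun k => and_congr_right fun hk => ?_
  exact fam_dropAt hk hv hs

theorem fam_dual {v X : ℕ} (hv : v < 12) (j : ℕ) {s : Finset ℕ} (hs : s ⊆ range 12) :
    Fam (dual j X) v s ↔ ∃ r ⊆ range 12, Disjoint r s ∧ r.card = j ∧
      Fam X v (range 12 \ (s ∪ r)) := by
  induction j generalizing s with
  | zero =>
    have : dual 0 X = complements X := rfl
    rw [this, fam_complements hv hs]
    constructor
    · intro h
      exact ⟨∅, empty_subset _, disjoint_empty_left _, rfl, by simpa using h⟩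
    · rintro ⟨r, -, -, hr, h⟩
      rw [card_eq_zero] at hr
      simpa [hr] using h
  | succ j ih =>
    have : dual (j + 1) X = drop (dual j X) := rfl
    rw [this, fam_drop hv hs]
    constructor
    · rintro ⟨k, hk, hks, h⟩
      rw [ih (insert_subset (mem_range.2 hk) hs)] at h
      obtain ⟨r, hr, hd, hc, h⟩ := h
      rw [disjoint_insert_right] at hd
      refine ⟨insert k r, insert_subset (mem_range.2 hk) hr, ?_, ?_, ?_⟩
      · rw [disjoint_insert_left]; exact ⟨hks, hd.2⟩
      · rw [card_insert_of_notMem hd.1, hc]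
      · rwa [union_insert, ← insert_union]
    · rintro ⟨r, hr, hd, hc, h⟩
      obtain ⟨k, hk⟩ : r.Nonempty := by rw [← card_pos]; omega
      refine ⟨k, mem_range.1 (hr hk), disjoint_left.1 hd hk, ?_⟩
      rw [ih (insert_subset (hr hk) hs)]
      refine ⟨r.erase k, (erase_subset _ _).trans hr, ?_, ?_, ?_⟩
      · rw [disjoint_insert_right]
        exact ⟨notMem_erase k r, disjoint_of_subset_left (erase_subset _ _) hd⟩
      · rw [card_erase_of_mem hk, hc]; rfl
      · rwa [insert_union, ← union_insert, insert_erase hk]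

theorem testBit_comembers {a Z : ℕ} (ha : a < 12) {s : Finset ℕ} (hs : s ⊆ range 12) :
    (comembers a Z).testBit (code s) = true ↔ a ∉ s ∧ Fam Z a (insert a s) := by
  have h1 : comembers a Z = (Z >>> (4096 * (a + 1) + 2 ^ a)) &&& lowMask 4096 a := rfl
  have h2 : (code s).testBit a = false ↔ a ∉ s := by rw [← testBit_code, Bool.not_eq_true]
  rw [h1, Nat.testBit_and, Nat.testBit_shiftRight, Bool.and_eq_true, testBit_lowMask_field ha, h2]
  constructor
  · rintro ⟨h3, -, h4⟩
    refine ⟨h4, ?_⟩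
    rw [Fam, code_insert h4]
    convert h3 using 2
    ring
  · rintro ⟨h4, h3⟩
    rw [Fam, code_insert h4] at h3
    refine ⟨?_, code_lt hs, h4⟩
    convert h3 using 2
    ring

/-- The sets disjoint to a member of a and missing j further vertices are exactly the members of the
dual family. Hence a bitwise conjunction replaces the search through all pairs of members. -/
theorem meet_ne_zero {a b j X : ℕ} (ha : a < 12) (hb : b < 12) :
    meet a b (dual j X) X ≠ 0 ↔ ∃ s ⊆ range 12, ∃ r ⊆ range 12, Disjoint s r ∧ a ∈ s ∧ b ∈ r ∧
      s.card + r.card + j = 12 ∧ Fam X a (s.erase a) ∧ Fam X b (r.erase b) := by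
  have h1 : meet a b (dual j X) X = comembers a (dual j X) &&& members b X := rfl
  have h12 : (range 12).card = 12 := card_range 12
  constructor
  · intro h
    obtain ⟨i, hi⟩ := exists_testBit_of_ne_zero h
    rw [h1, Nat.testBit_and, Bool.and_eq_true] at hi
    have hi' : i < 4096 := by
      by_contra hc
      have := Nat.testBit_lt_two_pow ((members_lt (X := X) hb).trans_le
        (Nat.pow_le_pow_right (by norm_num) (not_lt.1 hc)))
      simp [this] at hi
    obtain ⟨r, hr, rfl⟩ := exists_code hi'
    rw [testBit_comembers ha hr, testBit_members hb hr,
      fam_dual ha j (insert_subset (mem_range.2 ha) hr)] at hi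
    obtain ⟨⟨har, q, hq, hd, hc, h2⟩, hbr, h3⟩ := hi
    rw [disjoint_insert_right] at hd
    have hsub : r ∪ q ⊆ range 12 := union_subset hr hq
    refine ⟨range 12 \ (r ∪ q), sdiff_subset, r, hr, ?_, ?_, hbr, ?_, ?_, h3⟩
    · exact disjoint_of_subset_right subset_union_left sdiff_disjoint
    · rw [mem_sdiff, mem_union]
      exact ⟨mem_range.2 ha, by tauto⟩
    · rw [card_sdiff_of_subset hsub, card_union_of_disjoint hd.2.symm, h12, hc]
      have := card_le_card hsub
      rw [card_union_of_disjoint hd.2.symm, h12] at this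
      omega
    · convert h2 using 1
      ext x
      simp only [mem_erase, mem_sdiff, mem_union, mem_insert]
      tauto
  · rintro ⟨s, hs, r, hr, hd, has, hbr, hc, h2, h3⟩ h0
    have har : a ∉ r := disjoint_left.1 hd has
    have h4 : (meet a b (dual j X) X).testBit (code r) = true := by
      rw [h1, Nat.testBit_and, Bool.and_eq_true, testBit_comembers ha hr, testBit_members hb hr,
        fam_dual ha j (insert_subset (mem_range.2 ha) hr)]
      have hsub : s ∪ r ⊆ range 12 := union_subset hs hr
      refine ⟨⟨har, range 12 \ (s ∪ r), sdiff_subset, ?_, ?_, ?_⟩, hbr, h3⟩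
      · rw [disjoint_insert_right, mem_sdiff, mem_union]
        exact ⟨by tauto, disjoint_of_subset_right subset_union_right sdiff_disjoint⟩
      · rw [card_sdiff_of_subset hsub, card_union_of_disjoint hd, h12]
        omega
      · convert h2 using 1
        ext x
        have h5 := @hs x
        have h6 : x ∈ s → x ∉ r := fun h => disjoint_left.1 hd h
        simp only [mem_erase, mem_sdiff, mem_union, mem_insert]
        grind
    rw [h0] at h4
    simp at h4

end Families

end DetourSat

namespace DetourSat

open Finset

/-! ### Families of vertex sets and paths of a graph -/

section Soundness

/-- There are disjoint paths ending in `a` and `b` with `m` vertices in total. -/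
def Linked {V : Type u} (A : SimpleGraph V) (m : ℕ) (a b : V) : Prop :=
  ∃ L M : List V, (a :: L).IsChain A.Adj ∧ (b :: M).IsChain A.Adj ∧
    ((a :: L) ++ (b :: M)).Nodup ∧ (a :: L).length + (b :: M).length = m

/-- A triangle-free detour-saturated graph of order `n` and detour order `t` on `{0, …, n - 1}`
with the longest path `0, …, t - 1`. The other vertices are sorted by their neighbours on the path.
If `l = 0`, there are no leaves at the path. Otherwise `n - 1` is a leaf at `l`, and no
other leaf off the path is nearer to the ends of the path. -/
structure Labelled (n t l : ℕ) (A : SimpleGraph ℕ) : Prop where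
  lt_of_adj : ∀ u v, A.Adj u v → u < n
  triangle : ∀ u v w, A.Adj u v → A.Adj v w → ¬ A.Adj u w
  degree : ∀ v a b, a ≠ b → A.Adj v a → A.Adj v b → ∃ c, c ≠ a ∧ c ≠ b ∧ A.Adj v c
  short : ∀ L : List ℕ, L.Nodup → L.IsChain A.Adj → L.length ≤ t
  linked : ∀ a b, a < n → b < n → a ≠ b → ¬ A.Adj a b → Linked A (t + 1) a b
  path : ∀ i, i + 1 < t → A.Adj i (i + 1)
  sorted : ∃ μ : ℕ → ℕ, (∀ w i, (μ w).testBit i = true ↔ i < t ∧ A.Adj w i) ∧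
    -- If l > 0, the label n - 1 is reserved for the leaf, so the sorted labels end with n - 2.
    ∀ w, t ≤ w → w + (if l = 0 then 2 else 3) ≤ n → μ w ≤ μ (w + 1)
  thick : l = 0 → ∀ v i, i < t → A.Adj v i → ∃ j, j ≠ i ∧ A.Adj v j
  leaf : 0 < l → ∀ u, A.Adj (n - 1) u ↔ u = l
  far : 0 < l → ∀ w q, t ≤ w → w + 2 ≤ n → q < t → A.Adj w q → (∀ u, A.Adj w u → u = q) →
    l ≤ q ∧ q + l < t

/-- The members of `X` belong to paths of `A`. -/
def Sound (A : SimpleGraph ℕ) (X : ℕ) : Prop :=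
  ∀ v < 12, ∀ s ⊆ range 12, v ∉ s → Fam X v s →
    ∃ L : List ℕ, (v :: L).IsChain A.Adj ∧ (v :: L).Nodup ∧ L.toFinset = s

def Below (X X' : ℕ) : Prop := ∀ v < 12, ∀ s ⊆ range 12, Fam X v s → Fam X' v s

theorem Below.trans {X X' X'' : ℕ} (h : Below X X') (h' : Below X' X'') : Below X X'' :=
  fun v hv s hs hX => h' v hv s hs (h v hv s hs hX)

theorem below_push {u m X : ℕ} (hu : u < 12) : Below X (push u m X) :=
  fun _ hv _ hs h => (fam_push hu hv hs).2 (Or.inl h)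

theorem push_mono {u m X X' : ℕ} (hu : u < 12) (h : Below X X') :
    Below (push u m X) (push u m X') := by
  intro v hv s hs hX
  rw [fam_push hu hv hs] at hX ⊢
  refine hX.imp (h v hv s hs) fun hX => ⟨hX.1, hX.2.1, ?_⟩
  exact h u hu _ ((erase_subset _ _).trans hs) hX.2.2

theorem loop_induction {I : ℕ → Prop} {f : ℕ → ℕ → ℕ} {x : ℕ} (k : ℕ)
    (hf : ∀ i < k, ∀ x, I x → I (f i x)) (hx : I x) : I (loop f x k) := by
  induction k with
  | zero => exact hx
  | succ k ih => exact hf k (by omega) _ (ih fun i hi => hf i (by omega))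

theorem sweep_induction {I : ℕ → Prop} {Y X : ℕ}
    (h : ∀ u < 12, ∀ X, I X → I (push u (row Y u) X)) (hX : I X) : I (sweep Y X) := by
  refine loop_induction 12 (fun i _ x hx => ?_) (loop_induction 12 (fun i hi x hx => h i hi x hx) hX)
  rw [withValue_eq]
  exact h _ (by change 11 - i < 12; omega) x hx

theorem below_sweep (Y X : ℕ) : Below X (sweep Y X) :=
  sweep_induction (I := Below X) (fun _ hu _ h => h.trans (below_push hu)) fun _ _ _ _ h => h

theorem Sound.hashed {A : SimpleGraph ℕ} {X : ℕ} (h : Sound A X) : Sound A (hashed X) :=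
  fun v hv s hs hvs hX => h v hv s hs hvs (fam_hashed.1 hX)

theorem Sound.sweep {A : SimpleGraph ℕ} {X Y : ℕ} (h : Sound A X)
    (hY : ∀ u < 12, ∀ v < 12, Y.testBit (16 * u + v) = true → A.Adj u v) :
    Sound A (sweep Y X) := by
  refine sweep_induction (fun u hu X hX => ?_) h
  intro v hv s hs hvs hp
  rw [fam_push hu hv hs] at hp
  rcases hp with hp | ⟨hm, hus, hp⟩
  · exact hX v hv s hs hvs hp
  · obtain ⟨L, hL, hn, hLs⟩ := hX u hu _ ((erase_subset _ _).trans hs) (notMem_erase u s) hp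
    have hs' : (u :: L).toFinset = s := by rw [List.toFinset_cons, hLs, insert_erase hus]
    rw [testBit_row _ _ _ hv] at hm
    refine ⟨u :: L, ?_, ?_, hs'⟩
    · rw [List.isChain_cons_cons]
      exact ⟨(hY u hu v hv hm).symm, hL⟩
    · rw [List.nodup_cons, ← List.mem_toFinset, hs']
      exact ⟨hvs, hn⟩

theorem sound_start (A : SimpleGraph ℕ) : Sound A (wide 4095) := by
  intro v hv s hs _ h
  rw [fam_start hv hs] at h
  exact ⟨[], by simp, by simp, by simp [h]⟩

/-- The counterpart of `Sound`: a closed family contains the vertex sets of all paths with edges in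
P, hence of all paths of any graph below P (`Closed.complete`). -/
def Closed (P X : ℕ) : Prop :=
  (∀ v < 12, Fam X v ∅) ∧ ∀ u < 12, Below (push u (row P u) X) X

theorem Closed.complete {A : SimpleGraph ℕ} {P X : ℕ} (h : Closed P X)
    (hP : ∀ u v, A.Adj u v → u < 12 ∧ v < 12 ∧ P.testBit (16 * u + v) = true) :
    ∀ (L : List ℕ) (v : ℕ), v < 12 → (v :: L).IsChain A.Adj → (v :: L).Nodup →
      L.toFinset ⊆ range 12 ∧ Fam X v L.toFinset := by
  intro L
  induction L with
  | nil => intro v hv _ _; simpa using h.1 v hv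
  | cons u L ih =>
    intro v hv hc hn
    rw [List.isChain_cons_cons] at hc
    obtain ⟨h1, -, h3⟩ := hP _ _ hc.1.symm
    rw [List.nodup_cons] at hn
    obtain ⟨h4, h5⟩ := ih u h1 hc.2 hn.2
    have hsub : (u :: L).toFinset ⊆ range 12 := by
      rw [List.toFinset_cons]
      exact insert_subset (mem_range.2 h1) h4
    refine ⟨hsub, h.2 u h1 v hv _ hsub ?_⟩
    rw [fam_push h1 hv hsub]
    refine Or.inr ⟨?_, by simp, ?_⟩
    · rwa [testBit_row _ _ _ hv]
    · rwa [List.toFinset_cons, erase_insert]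
      rw [List.mem_toFinset]
      exact (List.nodup_cons.1 hn.2).1

/-- Pushes only add members and are monotone. The push at u is therefore dominated by the whole
sweep, which is X again. -/
theorem closed_of_sweep {P X : ℕ} (h0 : ∀ v < 12, Fam X v ∅)
    (h : hashed (sweep P X) = X) : Closed P X := by
  refine ⟨h0, fun u hu => ?_⟩
  have hback : Below (sweep P X) X := fun v _ s _ hX => by
    rw [← h]; exact fam_hashed.2 hX
  have hmono : ∀ k ≤ 12, Below X (loop (fun i X => push i (row P i) X) X k) := fun k hk =>
    loop_induction (I := Below X) k (fun i hi x hx => hx.trans (below_push (by omega)))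
      fun _ _ _ _ h => h
  have hup : ∀ k r, k + r ≤ 12 → Below (loop (fun i X => push i (row P i) X) X k)
      (loop (fun i X => push i (row P i) X) X (k + r)) := by
    intro k r
    induction r with
    | zero => exact fun _ _ _ _ _ h => h
    | succ r ih => exact fun hr => (ih (by omega)).trans (below_push (by change k + r < 12; omega))
  have h1 : Below (push u (row P u) X) (loop (fun i X => push i (row P i) X) X (u + 1)) :=
    push_mono hu (hmono u hu.le)
  have h2 := hup (u + 1) (12 - (u + 1)) (by omega)
  rw [Nat.add_sub_cancel' (by omega)] at h2
  refine h1.trans (h2.trans (Below.trans ?_ hback))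
  refine loop_induction (I := Below _) 12 (fun i hi x hx => hx.trans ?_) fun _ _ _ _ h => h
  rw [withValue_eq]
  exact below_push (by change 11 - i < 12; omega)

/-- The last clause carries any invariant of the sweeps over to the limit. With soundness as the
invariant, the limit consists of exactly the paths when P is the graph itself. -/
theorem exists_closed_of_saturate {P : ℕ} {k : ℕ → Bool} {fuel : ℕ} :
    ∀ {X : ℕ}, (∀ v < 12, Fam X v ∅) → saturate P k fuel X = true →
      ∃ X', Closed P X' ∧ k X' = true ∧ ∀ I : ℕ → Prop, (∀ X, I X → I (hashed (sweep P X))) →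
        I X → I X' := by
  induction fuel with
  | zero => intro X _ h; simp [saturate] at h
  | succ fuel ih =>
    intro X h0 h
    have h1 : saturate P k (fuel + 1) X = withValue (hashed (sweep P X)) fun X' =>
      select (Nat.beq X X') (k X) (saturate P k fuel X') := rfl
    rw [h1, withValue_eq, select_eq] at h
    split_ifs at h with h2
    · exact ⟨X, closed_of_sweep h0 (Nat.eq_of_beq_eq_true h2).symm, h, fun I _ hI => hI⟩
    · obtain ⟨X', h3, h4, h5⟩ := ih (fun v hv => fam_hashed.2 (below_sweep P X v hv ∅
        (empty_subset _) (h0 v hv))) h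
      exact ⟨X', h3, h4, fun I hI hX => h5 I hI (hI X hX)⟩

theorem Sound.linked {A : SimpleGraph ℕ} {X a b t : ℕ} (h : Sound A X) (ha : a < 12) (hb : b < 12)
    (ht : t ≤ 11) (hm : meet a b (dual (11 - t) X) X ≠ 0) : Linked A (t + 1) a b := by
  rw [meet_ne_zero ha hb] at hm
  obtain ⟨s, hs, r, hr, hd, has, hbr, hc, h1, h2⟩ := hm
  obtain ⟨L, hL, hLn, hLs⟩ := h a ha _ ((erase_subset _ _).trans hs) (notMem_erase _ _) h1
  obtain ⟨M, hM, hMn, hMs⟩ := h b hb _ ((erase_subset _ _).trans hr) (notMem_erase _ _) h2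
  have hL' : (a :: L).toFinset = s := by rw [List.toFinset_cons, hLs, insert_erase has]
  have hM' : (b :: M).toFinset = r := by rw [List.toFinset_cons, hMs, insert_erase hbr]
  refine ⟨L, M, hL, hM, ?_, ?_⟩
  · rw [List.nodup_append']
    refine ⟨hLn, hMn, ?_⟩
    rwa [← List.disjoint_toFinset_iff_disjoint, hL', hM']
  · rw [← List.toFinset_card_of_nodup hLn, ← List.toFinset_card_of_nodup hMn, hL', hM']
    omega

theorem Closed.meet_ne_zero {A : SimpleGraph ℕ} {P X a b t : ℕ} (h : Closed P X)
    (hP : ∀ u v, A.Adj u v → u < 12 ∧ v < 12 ∧ P.testBit (16 * u + v) = true)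
    (ha : a < 12) (hb : b < 12) (ht : t ≤ 11) (hl : Linked A (t + 1) a b) :
    meet a b (dual (11 - t) X) X ≠ 0 := by
  rw [DetourSat.meet_ne_zero ha hb]
  obtain ⟨L, M, hL, hM, hn, hc⟩ := hl
  rw [List.nodup_append'] at hn
  obtain ⟨hL1, hL2⟩ := h.complete hP L a ha hL hn.1
  obtain ⟨hM1, hM2⟩ := h.complete hP M b hb hM hn.2.1
  have hea : ((a :: L).toFinset).erase a = L.toFinset := by
    rw [List.toFinset_cons, erase_insert]
    rw [List.mem_toFinset]
    exact (List.nodup_cons.1 hn.1).1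
  have heb : ((b :: M).toFinset).erase b = M.toFinset := by
    rw [List.toFinset_cons, erase_insert]
    rw [List.mem_toFinset]
    exact (List.nodup_cons.1 hn.2.1).1
  refine ⟨(a :: L).toFinset, ?_, (b :: M).toFinset, ?_, ?_, by simp, by simp, ?_, ?_, ?_⟩
  · rw [List.toFinset_cons]
    exact insert_subset (mem_range.2 ha) hL1
  · rw [List.toFinset_cons]
    exact insert_subset (mem_range.2 hb) hM1
  · rw [List.disjoint_toFinset_iff_disjoint]
    exact hn.2.2
  · rw [List.toFinset_card_of_nodup hn.1, List.toFinset_card_of_nodup hn.2.1]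
    omega
  · rwa [hea]
  · rwa [heb]

/-- The first path is reversed, and the edge joins it to the second. -/
theorem Linked.exists_path {V : Type u} {A : SimpleGraph V} {m : ℕ} {a b : V} (h : Linked A m a b)
    (hab : A.Adj a b) : ∃ L : List V, L.Nodup ∧ L.IsChain A.Adj ∧ L.length = m := by
  obtain ⟨L, M, hL, hM, hn, hc⟩ := h
  refine ⟨(a :: L).reverse ++ (b :: M), ?_, ?_, by simp at hc ⊢; omega⟩
  · refine ((List.reverse_perm (a :: L)).append_right (b :: M)).nodup_iff.2 hn
  · rw [List.isChain_append]
    refine ⟨?_, hM, ?_⟩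
    · rw [List.isChain_reverse]
      exact hL.imp fun _ _ h => h.symm
    · intro x hx y hy
      simp at hx hy
      subst hx; subst hy
      exact hab

end Soundness

end DetourSat

namespace DetourSat

open Finset

/-! ### Soundness of the search -/

section Search

theorem testBit_loop {g : ℕ → ℕ → ℕ} {p : ℕ → Prop} {j k : ℕ}
    (hg : ∀ i < k, ∀ x, (g i x).testBit j = true ↔ x.testBit j = true ∨ p i) (x : ℕ) :
    (loop g x k).testBit j = true ↔ x.testBit j = true ∨ ∃ i < k, p i := by
  induction k with
  | zero => simp [loop_zero]
  | succ k ih =>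
    rw [loop_succ, hg k (by omega), ih fun i hi => hg i (by omega), or_assoc]
    refine or_congr_right ⟨?_, ?_⟩
    · rintro (⟨i, hi, h⟩ | h)
      · exact ⟨i, by omega, h⟩
      · exact ⟨k, by omega, h⟩
    · rintro ⟨i, hi, h⟩
      rcases Nat.lt_succ_iff_lt_or_eq.1 hi with h' | rfl
      · exact Or.inl ⟨i, h', h⟩
      · exact Or.inr h

theorem testBit_square {Y a b : ℕ} (ha : a < 12) (hb : b < 12) :
    (square Y).testBit (16 * a + b) = true ↔
      ∃ i < 12, Y.testBit (16 * i + a) = true ∧ Y.testBit (16 * i + b) = true := by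
  have h := testBit_loop (j := 16 * a + b) (k := 12)
    (g := fun i T => Nat.lor T (Nat.mul (row Y i) (spread 16 (row Y i))))
    (p := fun i => Y.testBit (16 * i + a) = true ∧ Y.testBit (16 * i + b) = true)
    (fun i _ x => ?_) 0
  · exact h.trans (by simp)
  · change (x ||| row Y i * spread 16 (row Y i)).testBit _ = true ↔ _
    rw [Nat.testBit_or, Bool.or_eq_true,
      testBit_mul_spread ((row_lt Y i).trans (by norm_num)) (by omega) ha, testBit_row _ _ _ ha,
      testBit_row _ _ _ hb, Bool.and_eq_true]

theorem testBit_linked {Z X u v : ℕ} (hv : v < 12) :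
    (linked Z X).testBit (16 * u + v) = true ↔
      ∃ a < 12, ∃ b < a, meet a b Z X ≠ 0 ∧ ((u = a ∧ v = b) ∨ (u = b ∧ v = a)) := by
  have h := testBit_loop (j := 16 * u + v) (k := 12)
    (g := fun a F => loop (fun b F => Nat.lor F
      (Nat.mul (Nat.sub 1 (Nat.sub 1 (meet a b Z X))) (pairMask a b))) F a)
    (p := fun a => ∃ b < a, meet a b Z X ≠ 0 ∧ ((u = a ∧ v = b) ∨ (u = b ∧ v = a)))
    (fun a ha x => testBit_loop (fun b hb x => ?_) x) 0
  · exact h.trans (by simp)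
  · change (x ||| (1 - (1 - meet a b Z X)) * pairMask a b).testBit _ = true ↔ _
    rw [Nat.testBit_or, Bool.or_eq_true]
    refine or_congr_right ?_
    by_cases h0 : meet a b Z X = 0
    · simp [h0]
    · rw [show 1 - (1 - meet a b Z X) = 1 by omega, one_mul,
        testBit_pairMask ha (by omega) hv]
      simp [h0]

/-- `Y` consists of edges of `A`, and all edges of `A` belong to `P`. -/
structure Between (A : SimpleGraph ℕ) (Y P : ℕ) : Prop where
  lower : ∀ u < 12, ∀ v < 12, Y.testBit (16 * u + v) = true → A.Adj u v
  upper : ∀ u v, A.Adj u v → u < 12 ∧ v < 12 ∧ P.testBit (16 * u + v) = true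

theorem Linked.symm {V : Type u} {A : SimpleGraph V} {m : ℕ} {a b : V} (h : Linked A m a b) :
    Linked A m b a := by
  obtain ⟨L, M, hL, hM, hn, hc⟩ := h
  exact ⟨M, L, hM, hL, List.perm_append_comm.nodup_iff.1 hn, by omega⟩

theorem Labelled.not_linked {n t l : ℕ} {A : SimpleGraph ℕ} (hA : Labelled n t l A) {a b : ℕ}
    (h : A.Adj a b) : ¬ Linked A (t + 1) a b := fun hl => by
  obtain ⟨L, h1, h2, h3⟩ := hl.exists_path h
  have := hA.short L h1 h2
  omega

theorem Sound.linked_of_testBit {A : SimpleGraph ℕ} {X t u v : ℕ} (h : Sound A X)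
    (hv : v < 12) (ht : t ≤ 11)
    (hm : (DetourSat.linked (dual (Nat.sub 11 t) X) X).testBit (16 * u + v) = true) :
    Linked A (t + 1) u v := by
  rw [testBit_linked hv] at hm
  obtain ⟨a, ha, b, hb, hm, ⟨rfl, rfl⟩ | ⟨rfl, rfl⟩⟩ := hm
  · exact h.linked ha (by omega) ht hm
  · exact (h.linked ha (by omega) ht hm).symm

/-- A pair with a common known neighbour would close a triangle, and a pair linked by known edges
would be the middle of a path with t + 1 vertices. -/
theorem Between.prune {n t l : ℕ} {A : SimpleGraph ℕ} {Y P X : ℕ} (h : Between A Y P)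
    (hA : Labelled n t l A) (hX : Sound A X) (ht : t ≤ 11) :
    Between A Y (remove P (Nat.lor (square Y) (linked (dual (Nat.sub 11 t) X) X))) := by
  refine ⟨h.lower, fun u v huv => ?_⟩
  obtain ⟨hu, hv, hP⟩ := h.upper u v huv
  refine ⟨hu, hv, ?_⟩
  change (remove P (square Y ||| linked (dual (Nat.sub 11 t) X) X)).testBit _ = true
  rw [testBit_remove, hP, Nat.testBit_or, Bool.true_and, Bool.not_eq_true', Bool.or_eq_false_iff]
  constructor <;> rw [← Bool.not_eq_true] <;> intro hb
  · rw [testBit_square hu hv] at hb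
    obtain ⟨i, hi, h1, h2⟩ := hb
    exact hA.triangle u i v (h.lower i hi u hu h1).symm (h.lower i hi v hv h2) huv
  · exact hA.not_linked huv (hX.linked_of_testBit hv ht hb)

theorem Between.add {A : SimpleGraph ℕ} {Y P a b : ℕ} (h : Between A Y P) (ha : a < 12)
    (hb : b < 12) (hab : A.Adj a b) : Between A (addPair a b Y) P := by
  refine ⟨fun u hu v hv huv => ?_, h.upper⟩
  rw [testBit_addPair ha hb hv] at huv
  rcases huv with huv | ⟨rfl, rfl⟩ | ⟨rfl, rfl⟩
  · exact h.lower u hu v hv huv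
  · exact hab
  · exact hab.symm

theorem Between.remove {A : SimpleGraph ℕ} {Y P a b : ℕ} (h : Between A Y P) (ha : a < 12)
    (hb : b < 12) (hab : ¬ A.Adj a b) : Between A Y (remove P (pairMask a b)) := by
  refine ⟨h.lower, fun u v huv => ?_⟩
  obtain ⟨hu, hv, hP⟩ := h.upper u v huv
  refine ⟨hu, hv, ?_⟩
  rw [testBit_remove, hP, Bool.true_and, Bool.not_eq_true', ← Bool.not_eq_true,
    testBit_pairMask ha hb hv]
  rintro (⟨rfl, rfl⟩ | ⟨rfl, rfl⟩)
  · exact hab huv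
  · exact hab huv.symm

theorem testBit_pathMask {t i : ℕ} : (pathMask t).testBit i = true ↔ i < t := by
  have : pathMask t = 2 ^ t - 1 := rfl
  rw [this, Nat.testBit_two_pow_sub_one, decide_eq_true_iff]

theorem le_of_testBit {m k : ℕ} (h : ∀ i, m.testBit i = true → k.testBit i = true) : m ≤ k := by
  have : m &&& k = m := Nat.eq_of_testBit_eq fun i => by
    rw [Nat.testBit_and]
    have := h i
    cases hm : m.testBit i <;> simp_all
  rw [← this]
  exact Nat.and_le_right

/-- In each test the known edges bound the neighbourhood of a vertex from below and the possible
edges bound it from above; the bounds contradict one of the fields of `Labelled`. -/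
theorem closed_sound {n t l : ℕ} {A : SimpleGraph ℕ} {Y P v : ℕ} (h : Between A Y P)
    (hA : Labelled n t l A) (hlt : l < t) (hv : v < 12) (hc : closed n t l Y P v = true) : False := by
  have hY : ∀ u, (row Y v).testBit u = true → A.Adj v u := fun u hu => by
    have h1 := lt_of_testBit_row hu
    rw [testBit_row _ _ _ h1] at hu
    exact h.lower v hv u h1 hu
  have hP : ∀ w u, A.Adj w u → (row P w).testBit u = true := fun w u hu => by
    obtain ⟨_, h2, h3⟩ := h.upper w u hu
    rwa [testBit_row _ _ _ h2]
  have hand : ∀ m k i, (Nat.land m k).testBit i = true ↔ m.testBit i = true ∧ k.testBit i = true :=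
    fun m k i => by
      change (m &&& k).testBit i = true ↔ _
      rw [Nat.testBit_and, Bool.and_eq_true]
  have hor : ∀ m k i, (Nat.lor m k).testBit i = true ↔ m.testBit i = true ∨ k.testBit i = true :=
    fun m k i => by
      change (m ||| k).testBit i = true ↔ _
      rw [Nat.testBit_or, Bool.or_eq_true]
  have hpos : ∀ m, Nat.ble 1 m = true → ∃ i, m.testBit i = true := fun m hm => by
    have := Nat.le_of_ble_eq_true hm
    exact exists_testBit_of_ne_zero (by omega)
  rw [closed, orElse_eq, orElse_eq, orElse_eq, Bool.or_eq_true, Bool.or_eq_true,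
    Bool.or_eq_true] at hc
  rcases hc with hc | hc | hc | hc
  · rw [badDegree, andThen_eq, Bool.and_eq_true] at hc
    obtain ⟨hc, hy⟩ := hc
    have hc := Nat.eq_of_beq_eq_true hc
    have two : ∃ i j, i ≠ j ∧ A.Adj v i ∧ A.Adj v j := by
      obtain ⟨i, hi⟩ := hpos _ hy
      rw [hor, hand] at hi
      rcases hi with hi | ⟨hi, hm⟩
      · obtain ⟨i, j, hij, h1, h2⟩ := exists_pair_of_clearTop_ne_zero (m := row Y v)
          (by intro h0; rw [h0] at hi; simp at hi)
        exact ⟨i, j, hij, hY i h1, hY j h2⟩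
      · rw [select_eq] at hm
        split_ifs at hm with hl
        · rw [testBit_pathMask] at hm
          -- If l = 0, a single known neighbour on the path suffices: it forces a second one, and
          -- the degree condition then a third.
          obtain ⟨j, hj, hvj⟩ := hA.thick (Nat.eq_of_beq_eq_true hl) v i hm (hY i hi)
          exact ⟨i, j, hj.symm, hY i hi, hvj⟩
        · simp at hm
    obtain ⟨i, j, hij, h1, h2⟩ := two
    obtain ⟨k, hki, hkj, h3⟩ := hA.degree v i j hij h1 h2
    rcases eq_or_eq_of_clearTop_clearTop_eq_zero hc (hP v i h1) (hP v j h2) (hP v k h3) with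
      h4 | h4 | h4
    · exact hij h4
    · exact hki h4.symm
    · exact hkj h4.symm
  · rw [badOrder, andThen_eq, andThen_eq, Bool.and_eq_true, Bool.and_eq_true] at hc
    obtain ⟨h1, h2, h3⟩ := hc
    have h1 := Nat.le_of_ble_eq_true h1
    have h2 := Nat.le_of_ble_eq_true h2
    have h3 := Nat.le_of_ble_eq_true h3
    obtain ⟨μ, hμ, hs⟩ := hA.sorted
    have h4 := hs v h1 (by
      rw [select_eq] at h2
      change v + _ ≤ n at h2
      rcases Nat.eq_zero_or_pos l with rfl | hl
      · simpa using h2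
      · have : Nat.beq l 0 = false := by
          rw [← Bool.not_eq_true]
          intro hb
          have := Nat.eq_of_beq_eq_true hb
          omega
        rw [this] at h2
        simp only [Bool.false_eq_true, if_false] at h2
        rwa [if_neg hl.ne'])
    have h5 : Nat.land (row Y v) (pathMask t) ≤ μ v := le_of_testBit fun i hi => by
      rw [hand, testBit_pathMask] at hi
      exact (hμ v i).2 ⟨hi.2, hY i hi.1⟩
    have h6 : μ (v + 1) ≤ Nat.land (row P (v + 1)) (pathMask t) := le_of_testBit fun i hi => by
      rw [hμ] at hi
      rw [hand, testBit_pathMask]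
      exact ⟨hP _ _ hi.2, hi.1⟩
    have h7 : Nat.land (row P (v + 1)) (pathMask t) < Nat.land (row Y v) (pathMask t) := h3
    omega
  · rw [badLeaf, andThen_eq, andThen_eq, andThen_eq, andThen_eq, Bool.and_eq_true,
      Bool.and_eq_true, Bool.and_eq_true, Bool.and_eq_true] at hc
    obtain ⟨h1, h2, h3, h4, h5⟩ := hc
    have h1 := Nat.le_of_ble_eq_true h1
    have h2 : v + 2 ≤ n := Nat.le_of_ble_eq_true h2
    have h3 := Nat.le_of_ble_eq_true h3
    have h4 := Nat.eq_of_beq_eq_true h4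
    obtain ⟨i, hi⟩ := hpos _ h5
    rw [hand, hor, testBit_pathMask] at hi
    obtain ⟨hi, him⟩ := hi
    have huniq : ∀ u, A.Adj v u → u = i := fun u hu =>
      eq_of_clearTop_eq_zero h4 (hP v u hu) (hP v i (hY i hi))
    have hxor : ∀ m k : ℕ, (Nat.xor m k).testBit i = (m.testBit i ^^ k.testBit i) := fun m k => by
      change (m ^^^ k).testBit i = _
      rw [Nat.testBit_xor]
    rw [hxor] at him
    by_cases hit : i < t
    · have := hA.far h3 v i h1 h2 hit (hY i hi) huniq
      rcases him with him | him
      · omega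
      · have h6 := testBit_pathMask.2 hit
        have h7 : (pathMask (Nat.sub t l)).testBit i = true :=
          testBit_pathMask.2 (by change i < t - l; omega)
        rw [h6, h7] at him
        simp at him
    · rcases him with him | him
      · omega
      · have h6 : (pathMask t).testBit i = false := by
          rw [← Bool.not_eq_true, testBit_pathMask]; exact hit
        have h7 : (pathMask (Nat.sub t l)).testBit i = false := by
          rw [← Bool.not_eq_true, testBit_pathMask]; change ¬ i < t - l; omega
        rw [h6, h7] at him
        simp at him
  · obtain ⟨i, hi⟩ := hpos _ hc
    rw [testBit_remove, Bool.and_eq_true] at hi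
    have := hP v i (hY i hi.1)
    simp [this] at hi

/-- The pair is not an edge, as it is not possible, so saturation links it in A. Since the closed
family contains all paths of A, it shows this link, against the test. -/
theorem unlinked_sound {n t l : ℕ} {A : SimpleGraph ℕ} {Y P X a b : ℕ} (h : Between A Y P)
    (hA : Labelled n t l A) (ht : t ≤ 11) (hn : n ≤ 12) (hX : ∀ v < 12, Fam X v ∅) (hab : a < b)
    (hc : unlinked n t P X a b = true) : False := by
  rw [unlinked, andThen_eq, andThen_eq, Bool.and_eq_true, Bool.and_eq_true] at hc
  obtain ⟨h1, h2, h3⟩ := hc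
  have h1 : b < n := Nat.le_of_ble_eq_true h1
  have h2 := Nat.eq_of_beq_eq_true h2
  have hb : b < 12 := by omega
  rw [bitAt_eq, testBit_row _ _ _ hb] at h2
  have hadj : ¬ A.Adj a b := fun hadj => by
    rw [(h.upper a b hadj).2.2] at h2
    simp at h2
  obtain ⟨X', hX', h4, -⟩ := exists_closed_of_saturate hX h3
  exact hX'.meet_ne_zero h.upper (by omega) hb ht
    (hA.linked a b (by omega) h1 hab.ne hadj) (Nat.eq_of_beq_eq_true h4)

/-- `A` is, up to the labels, the graph with the edges `targetEdges t`. -/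
def IsTarget (t : ℕ) (A : SimpleGraph ℕ) : Prop :=
  ∃ π : ℕ → ℕ, (∀ i < 12, π i < 12) ∧ (∀ j < 12, ∃ i < 12, π i = j) ∧
    ∀ i < 12, ∀ j < 12, A.Adj (π i) (π j) ↔ memPairs (targetEdges t) i j = true

theorem isTarget_of_matchesTarget {t Y c : ℕ} {A : SimpleGraph ℕ} (h : Between A Y Y)
    (hm : matchesTarget t Y c = true) : IsTarget t A := by
  rw [matchesTarget, andThen_eq, andThen_eq, Bool.and_eq_true, Bool.and_eq_true,
    allBelow_eq_true, allBelow_eq_true] at hm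
  obtain ⟨h1, h2, h3⟩ := hm
  have h1 : ∀ i < 12, entry c i < 12 := fun i hi =>
    Nat.lt_succ_of_le (Nat.le_of_ble_eq_true (h1 i hi))
  refine ⟨entry c, h1, fun j hj => ?_, fun i hi j hj => ?_⟩
  · have h4 := testBit_loop_or (fun i => 2 ^ entry c i)
      (fun i m => Nat.lor m (Nat.pow 2 (entry c i))) (fun _ _ => rfl) 0 12 j
    rw [Nat.eq_of_beq_eq_true h2, show (4095 : ℕ) = 2 ^ 12 - 1 from rfl,
      Nat.testBit_two_pow_sub_one] at h4
    obtain h5 | ⟨i, hi, h5⟩ := h4.1 (by simpa using hj)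
    · simp at h5
    · rw [Nat.testBit_two_pow, decide_eq_true_iff] at h5
      exact ⟨i, hi, h5⟩
  · have h4 := Nat.eq_of_beq_eq_true (allBelow_eq_true.1 (h3 i hi) j hj)
    rw [bitAt_eq, bitAt_eq, testBit_row _ _ _ (h1 j hj), testBit_row _ _ _ hj, target,
      testBit_tabulate _ hi hj] at h4
    have h5 : A.Adj (entry c i) (entry c j) ↔ Y.testBit (16 * entry c i + entry c j) = true :=
      ⟨fun h6 => (h.upper _ _ h6).2.2, h.lower _ (h1 i hi) _ (h1 j hj)⟩
    rw [h5]
    revert h4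
    cases Y.testBit (16 * entry c i + entry c j) <;> cases memPairs (targetEdges t) i j <;> simp

/-- The first half of the conclusion, that the continuation succeeds on some remainder of the
certificate, is what makes the induction work: applied to the branch with an edge, it yields the
success of the branch without it. A leaf of the tree is either a contradiction or a match, and a
match demands n = 12. -/
theorem search_sound {n t l : ℕ} (hn : n ≤ 12) (ht : t ≤ 11) (hl : l < t) (fuel : ℕ) :
    ∀ (Y P X c : ℕ) (k : ℕ → Bool), search n t l fuel Y P X c k = true →
      (∃ c', k c' = true) ∧ ∀ A, Labelled n t l A → Between A Y P → Sound A X →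
        (∀ v < 12, Fam X v ∅) → n = 12 ∧ IsTarget t A := by
  induction fuel with
  | zero => intro Y P X c k h; simp [search] at h
  | succ fuel ih =>
    intro Y P X c k h
    have h0 : search n t l (fuel + 1) Y P X c k =
      withValue (Nat.land c 255) fun w => withValue (Nat.shiftRight c 8) fun c =>
      select (Nat.beq w 144)
        (withValue (hashed (sweep Y X)) fun X =>
          withValue (remove P (Nat.lor (square Y) (linked (dual (Nat.sub 11 t) X) X))) fun P =>
            search n t l fuel Y P X c k)
        (select (Nat.beq w 145)
          (andThen (Nat.beq Y P) (andThen (Nat.beq n 12)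
            (andThen (matchesTarget t Y c) (k (Nat.shiftRight c 96)))))
          (withValue (Nat.div w 12) fun a => withValue (Nat.mod w 12) fun b =>
            select (Nat.beq a b) (andThen (closed n t l Y P a) (k c))
              (select (Nat.ble a b) (andThen (unlinked n t P X a b) (k c))
                (andThen (Nat.ble a 11) (withValue (addPair a b Y) fun Y' =>
                  search n t l fuel Y' P X c fun c => withValue (remove P (pairMask a b)) fun P' =>
                    search n t l fuel Y P' X c k))))) :=
      rfl
    rw [h0] at h
    simp only [withValue_eq, select_eq, andThen_eq] at h
    generalize Nat.shiftRight c 8 = c' at h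
    generalize Nat.land c 255 = w at h
    split_ifs at h with h1 h2 h3 h4
    · obtain ⟨hk, hA⟩ := ih _ _ _ _ _ h
      refine ⟨hk, fun A hL hB hS hX => ?_⟩
      have hS' := (hS.sweep hB.lower).hashed
      exact hA A hL (hB.prune hL hS' ht) hS' fun v hv =>
        fam_hashed.2 (below_sweep Y X v hv ∅ (empty_subset _) (hX v hv))
    · rw [Bool.and_eq_true, Bool.and_eq_true, Bool.and_eq_true] at h
      obtain ⟨h5, h6, h7, h8⟩ := h
      refine ⟨⟨_, h8⟩, fun A _ hB _ _ => ⟨Nat.eq_of_beq_eq_true h6, ?_⟩⟩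
      have h5 := Nat.eq_of_beq_eq_true h5
      subst h5
      exact isTarget_of_matchesTarget hB h7
    all_goals have hb : Nat.mod w 12 < 12 := Nat.mod_lt _ (by norm_num)
    · rw [Bool.and_eq_true] at h
      have h3 := Nat.eq_of_beq_eq_true h3
      exact ⟨⟨_, h.2⟩, fun A hA hB _ _ => (closed_sound hB hA hl (h3 ▸ hb) h.1).elim⟩
    · rw [Bool.and_eq_true] at h
      refine ⟨⟨_, h.2⟩, fun A hA hB _ hX => (unlinked_sound hB hA ht hn hX ?_ h.1).elim⟩
      refine lt_of_le_of_ne (Nat.le_of_ble_eq_true h4) fun h5 => h3 ?_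
      rw [h5]
      exact Nat.beq_refl _
    · rw [Bool.and_eq_true] at h
      have ha : Nat.div w 12 < 12 := Nat.lt_succ_of_le (Nat.le_of_ble_eq_true h.1)
      -- The success of the continuation is the success of the other branch, read from the remaining
      -- certificate c''.
      obtain ⟨⟨c'', h5⟩, hA⟩ := ih _ _ _ _ _ h.2
      obtain ⟨hk, hA'⟩ := ih _ _ _ _ _ h5
      refine ⟨hk, fun A hL hB hS hX => ?_⟩
      by_cases hab : A.Adj (Nat.div w 12) (Nat.mod w 12)
      · exact hA A hL (hB.add ha hb hab) hS hX
      · exact hA' A hL (hB.remove ha hb hab) hS hX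

theorem check_sound {n t l c : ℕ} (hn : n ≤ 12) (ht : t < n) (hl : l < t)
    (h : check n t l c = true) {A : SimpleGraph ℕ} (hA : Labelled n t l A) :
    n = 12 ∧ IsTarget t A := by
  rw [check] at h
  simp only [withValue_eq] at h
  have hlt : ∀ u v, A.Adj u v → u < n ∧ v < n :=
    fun u v h => ⟨hA.lt_of_adj u v h, hA.lt_of_adj v u h.symm⟩
  refine (search_sound hn (by omega) hl _ _ _ _ _ _ h).2 A hA ⟨?_, ?_⟩
    (sound_start A).hashed fun v hv => fam_hashed.2 ((fam_start hv (empty_subset _)).2 rfl)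
  · intro u hu v hv huv
    rw [startEdges, testBit_tabulate _ hu hv] at huv
    simp only [orElse_eq, andThen_eq, Bool.or_eq_true, Bool.and_eq_true, Nat.beq_eq,
      Nat.ble_eq] at huv
    rcases huv with ⟨h1, h2⟩ | ⟨h1, h2⟩ | ⟨h1, ⟨h2, h3⟩ | ⟨h2, h3⟩⟩
    · rw [← h1]; exact hA.path u (by omega)
    · rw [← h1]; exact (hA.path v (by omega)).symm
    · rw [h2, show v = n - 1 by omega]
      exact ((hA.leaf h1 l).2 rfl).symm
    · rw [h2, show u = n - 1 by omega]
      exact (hA.leaf h1 l).2 rfl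
  · intro u v huv
    obtain ⟨hu, hv⟩ := hlt u v huv
    refine ⟨by omega, by omega, ?_⟩
    rw [startPairs, testBit_tabulate _ (by omega) (by omega)]
    simp only [orElse_eq, andThen_eq, select_eq, Bool.or_eq_true, Bool.and_eq_true,
      Nat.beq_eq, Nat.ble_eq, huv.ne, if_false]
    refine ⟨hu, hv, ?_⟩
    rcases Nat.eq_zero_or_pos l with h0 | h0
    · exact Or.inl h0
    · refine Or.inr ⟨?_, ?_⟩
      · by_cases h1 : u = n - 1
        · rw [h1] at huv
          exact Or.inl ((hA.leaf h0 v).1 huv)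
        · exact Or.inr (by change u + 2 ≤ n; omega)
      · by_cases h1 : v = n - 1
        · rw [h1] at huv
          exact Or.inl ((hA.leaf h0 u).1 huv.symm)
        · exact Or.inr (by change v + 2 ≤ n; omega)

end Search

end DetourSat

namespace DetourSat

/-! ### The search trees -/

section Certificates

set_option maxRecDepth 100000

theorem exists_check_7_6 (l : ℕ) (hl : l < 3) : ∃ c, check 7 6 l c = true := by
  interval_cases l
  · exact ⟨1038031537996128666369269969040, by decide +kernel⟩
  · exact ⟨47148591264218659437946000, by decide +kernel⟩
  -- The shortest tree: 10128 = 144 + 256 * 39 with 39 = 12 * 3 + 3, that is, propagate and then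
  -- find a contradiction at vertex 3. Besides 2 and 4 no third neighbour is possible there: 1 and 5
  -- would give triangles, 6 is a leaf at 2, and the edge 03 would give the path 6, 2, 1, 0, 3, 4,
  -- 5.
  · exact ⟨10128, by decide +kernel⟩

theorem exists_check_8_6 (l : ℕ) (hl : l < 3) : ∃ c, check 8 6 l c = true := by
  interval_cases l
  · exact ⟨1038031537996128666369269969040, by decide +kernel⟩
  · exact ⟨123981544267858196843152, by decide +kernel⟩
  · exact ⟨12085704915217087075216011408, by decide +kernel⟩

theorem exists_check_8_7 (l : ℕ) (hl : l < 4) : ∃ c, check 8 7 l c = true := by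
  interval_cases l
  · exact ⟨104085311401902763523569869670281398416, by decide +kernel⟩
  · exact ⟨3751375554760159376, by decide +kernel⟩
  · exact ⟨168385596304, by decide +kernel⟩
  · exact ⟨3754330351566074256, by decide +kernel⟩

theorem exists_check_9_6 (l : ℕ) (hl : l < 3) : ∃ c, check 9 6 l c = true := by
  interval_cases l
  · exact ⟨1038031537996128666369269969040, by decide +kernel⟩
  · exact ⟨298268652395182692969560645908580011927406230197872769743673619081156562980197901456, by decide +kernel⟩
  · exact ⟨76356389659369431335124040607208199015818142448066496133541639823032441109695430668432, by decide +kernel⟩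

theorem exists_check_9_7 (l : ℕ) (hl : l < 4) : ∃ c, check 9 7 l c = true := by
  interval_cases l
  · exact ⟨1746261751148839110455174279571900582484527248, by decide +kernel⟩
  · exact ⟨1160958897420864645452580549755094767970037904, by decide +kernel⟩
  · exact ⟨3415265633732035783925426872237721371301776, by decide +kernel⟩
  · exact ⟨16112035329251105690933549200, by decide +kernel⟩

theorem exists_check_9_8 (l : ℕ) (hl : l < 4) : ∃ c, check 9 8 l c = true := by
  interval_cases l
  · exact ⟨331969283359510605163559785339247527442006976081089109857967242189572912350772402248370340069468385609033487531924046903676266101680877236038928936617472359620743662146397106399552482650512344186568559490298870260368, by decide +kernel⟩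
  · exact ⟨6028135112337300532240801301067567585624328047848767495070052257369764660261008, by decide +kernel⟩
  · exact ⟨2825041570083916688, by decide +kernel⟩
  · exact ⟨17715370189569260682284758919496858622096, by decide +kernel⟩

theorem exists_check_10_6 (l : ℕ) (hl : l < 3) : ∃ c, check 10 6 l c = true := by
  interval_cases l
  · exact ⟨1038031537996128666369269969040, by decide +kernel⟩
  · exact ⟨15593883940418652702494131747931945310375258587898479309986815215402064460585456945393347980590989220128384337443798257270296841208235264906709561819082688104850048848147436313429008511520183382189200, by decide +kernel⟩
  · exact ⟨122482548586324351370123655604268469576516297148484828465179786874441647132047536648505548181281963162604679312, by decide +kernel⟩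

theorem exists_check_10_7 (l : ℕ) (hl : l < 4) : ∃ c, check 10 7 l c = true := by
  interval_cases l
  · exact ⟨5167110805895447103871783114395398795751294099580308623820652041673759431041654204717497131411449322686608, by decide +kernel⟩
  · exact ⟨10669735600119302371606712276209538532825599013657676345630576971899233989078396772562211399355150541636874518888132405980839814214101218860923062595728, by decide +kernel⟩
  · exact ⟨111739256182638852529836227466479068436287490338893264557554588608126037017039793831140843995978004632428772288190380405622918149320848, by decide +kernel⟩
  · exact ⟨3308553617225839267090988492632110221241321386404750837800085162428157333419615400367618980389168755541839233339571417420405812850421187144886505196110704882879274524428394570896, by decide +kernel⟩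

theorem exists_check_10_8 (l : ℕ) (hl : l < 4) : ∃ c, check 10 8 l c = true := by
  interval_cases l
  · exact ⟨97045144517764893071452371563080550645839515786926236529563609231903476125819254198426418286919054039474903390626243589097109071961962131212792969340923154871468310760068930610297590928, by decide +kernel⟩
  · exact ⟨9671201626830824340784870711801679582754925043979368592094612356029113411790471143595900641437902131873445387553071731048402418472346282025406119974218111444990504468355241616, by decide +kernel⟩
  · exact ⟨358796477419893326983620849122714666116111382170688496632058699133756998421208983333400398518433573634063504, by decide +kernel⟩
  · exact ⟨8810162906454110272647774367453288632206409508640229692524555163026385174009163582329892727698219454175792170935479082280834704, by decide +kernel⟩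

theorem exists_check_10_9 (l : ℕ) (hl : l < 5) : ∃ c, check 10 9 l c = true := by
  interval_cases l
  · exact ⟨38566602784890551321310109454960099325145078197301779674573101960822547687958889091844717867093288679219011507221846759571969014209194726920478666017772769711477712796961509749513388191198151956926305575834872977832924111098774709067635706011552457277097675299899781233124050431870084932726416, by decide +kernel⟩
  · exact ⟨2099940119191669248072977626004209500294813896165116649161107127791084945621050363868158796294035356816, by decide +kernel⟩
  · exact ⟨2565502863894621994978646231326403030376534569148415371870305096121848409617782876119610825762434732298978114583674000, by decide +kernel⟩
  · exact ⟨85642179015063677983301958856738790943279299728, by decide +kernel⟩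
  · exact ⟨10021588749357467949454267267617787012806159112023238787815812162748832813478781070744410398542704939860278002082704, by decide +kernel⟩

theorem exists_check_11_6 (l : ℕ) (hl : l < 3) : ∃ c, check 11 6 l c = true := by
  interval_cases l
  · exact ⟨1038031537996128666369269969040, by decide +kernel⟩
  · exact ⟨2636816599506925568545945262236384177185862607843540936768853848192780391292208352738609848277138559437744398804510072967387216346250644903949493444314125272758891189831598564822056437997749887364898391427680672003209373700547079293479333373997929070047616334723642290852162576918972520644357519805565902604327783814792709142807004582256543866684745427685762192, by decide +kernel⟩
  · exact ⟨216411919675743175304148482543110569220595213813554276676523766462023935029435220557417426539947124930012979021147744537761511502063471152660762672604067581651796787635345762897899664, by decide +kernel⟩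

theorem exists_check_11_7 (l : ℕ) (hl : l < 4) : ∃ c, check 11 7 l c = true := by
  interval_cases l
  · exact ⟨4509284143014467742759464189689621853687323042782974909978826587373434355733454184002673623301474408601636161110243980227085657770048656040921509335408404342351349904, by decide +kernel⟩
  · exact ⟨3079808452131990714296472515006348035161790769283974504209070603856904928290122288321202766135201502347551431099667202857308995795361680911813367012629866295821481740130485878616373970200996827924373198959729935164299875722122408688824955660641785507979789438263836307989209344699732450301249490806335661382880041513613225234073116313137204197538643977242690253382219993608383959063778010400787646517186096006456356990526871064626323462995562367892979952456792222076387939878928222115255268037950167669821606853399312638161771986332110024672155653932855440, by decide +kernel⟩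
  · exact ⟨5302098523848735569274040228151117635103813691196288835142379121583106054723024025395332734771090246856565066978205879389261751938454731809286340619870235018511872977706698331057266144860176924469517720977557133956588302311216066177719619374309149992031726935475212030587024, by decide +kernel⟩
  · exact ⟨58965154818109265961917613549234071874662341946869315847554862060822615448904094084088113346470900166737990776802882044680411975183376312844762085314947078427700744486111875902963989343413726735579429231556437500407772206643796781796281417944739272923564849764440544399921461014168884167276191527137897925214852323883900666690310282641907406418701395478848275102835856, by decide +kernel⟩

theorem exists_check_11_8 (l : ℕ) (hl : l < 4) : ∃ c, check 11 8 l c = true := by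
  interval_cases l
  · exact ⟨36309057521134873952399825026341852329215620061428956706040501963329664825559121388821652657811860754523758790397023216920582910897834115047575242239736695285416510449924673157434438976973072900796224444145084807864474833548165392651408, by decide +kernel⟩
  · exact ⟨43985384741447149292161725174332815025065267155765850411734576296549941003106556337130817851912715834522440080514391689315901438160294260020965192140343493350340602531150145154938631965963515679008052244990727856023079447063861492354035825503999193888065966784296551714150419825391599364564931115720598645466223034471900352455061611490412657657738153563754845305533320998263650572394095379942967351568596944976942820838347436269242919659873754207842219091751113775540751947669428348089584887648772025927982202489736427132961680404886058119510940996623575690286553383896409190351385120691229929974937150880086545695260201443060294379116682408675349192371951039814771638157691638300250085109904107002660124403749661828713879002979855240904586834110418428321144665484763908974657167437323647836062910665749517661829395546262118230917659989177358244641919496848, by decide +kernel⟩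
  · exact ⟨85944600844548449885929959852807547089415623525663861216311415512035546111152361368861120648859088150898111974491266372119938865799107228554791399037689910865917276752902940998152291014811833429026190596725157421754176339908759381008702030463035997434672872840814468354816230097060706488086925769068553586240642953693452341382970064235013451137998958893336005778535622251219239946827248616232641550203778149473132505950876171797744917302909124505268880, by decide +kernel⟩
  · exact ⟨29239247581560619824849027961733869782648064837555590139021062729630603192219088094266595570555578185778700471505545652902397928492925371684669696379672793240659759996093419340278633001678780987420222401762689385634995195290272317170958893149490588278009706781588838513976182265058598911671690731035203014773924394054858332163770440949359577615287732690230258582826084963237914095559586527799141091716910895022965471307046416316055121281952650061839095440, by decide +kernel⟩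

theorem exists_check_11_9 (l : ℕ) (hl : l < 5) : ∃ c, check 11 9 l c = true := by
  interval_cases l
  · exact ⟨1104499780476375067883462623080172765155346464685768134432102677098932534337078949262975010985286148923353917918920094214899112978120419598001135856521270345770223726974042412925064612432396183404859254402661436838729331180867764433367246455763205416368882346553635086429312917670417819980007437440188252426277420152169273692403653137700037722749381100904984237083892501558127484039585837954145841944673710500584901196355171978202587603453347352042276112709184568932631505464937329771317386695164369010384546089760753278797334808059590447497104, by decide +kernel⟩
  · exact ⟨647998982188380735926443296569356768185739856985414387817428841361171280909677789703781133085821657436604577377807415207996155915716130311397832715383883909305378605799018536025541841578493657901155924363927967959799681354263142644233184073214811992682779517615635442050233448849471391207939946731655321822893370915033055298774648791967919720927209840883655579980693144223744121678714013051747051939656042582128663946729352082249070498214515405803408461611941403652873780923029249081337541521692644408204047564266094616622669809567485216793825506214995314156270248629966146001338932154359324950695001528838105503911980969736893666321357685569817419243698876589706279872986803510326332131893545936372900292631432644299077129810126734288509612240844177242653960556146934465807817147851111717336582057140726214259912848, by decide +kernel⟩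
  · exact ⟨66822081648907651318023769539263671963295087677320456733048063579950427494368069780947461447584903094411135507176997729614461292325671100600662614737146780587289896607987262063197439029510433996670764637324235126226209333427089943615736402970540955200230673343051818612362219056266479788290980205163000469214713349808895021322469723945528672806758899540368, by decide +kernel⟩
  · exact ⟨1729384573306339939260071335827743503912152307406662283744276492741959909121788105061691241178451022648491514115491778472580555878349366057480641709137290709239450187443483054196623572677634177664477454048080551697824100129530347248194126061524509328, by decide +kernel⟩
  · exact ⟨11712442741653367399386188414144336703384159883886951752760738921449311215905367122801840031721079914403465566335711530653834315335708455309166580455703596116644134013642568625473891346908453842217984845631207617594577997943450135060241683319788986186140079780329852751286430801107368684889382479389958943564688, by decide +kernel⟩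

theorem exists_check_11_10 (l : ℕ) (hl : l < 5) : ∃ c, check 11 10 l c = true := by
  interval_cases l
  · exact ⟨258010741423637586601418382457131037756836519399293907147680106100914350514325088514639771190117882650863868737465306183337630776680776436325654439201615202684562739483064527074156105997897284741072712051332833912961585721149660402148206812713549950869695345225287076494649453861725735644788866025528991991590813305710802624908264192339232537993650445876805519553312724544087580917492120828834674743829590840039884406443354017678813778551689850691667951098591954968866460138923917314301523349890167774151531562632133304536015507061392, by decide +kernel⟩
  · exact ⟨949841490779300719674412644312585904476396465697827376353580787298899926293652894744137316202903321263389945633857174327859010735837161202167420532387638519581986914765517107344, by decide +kernel⟩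
  · exact ⟨9567505411836628374510301118756354911079507057718172711665095634183565188096673262130577915072905015555883900704270035010836025621685395889623949139974308773935009540547928211899026275917678273623450649018983209498403645731642707142117215125442229378803123269299705245072, by decide +kernel⟩
  · exact ⟨702544700214446259276266745317489636960659684185659895357370312715920, by decide +kernel⟩
  · exact ⟨1297689441038244644170736894419167305451628568282386461849988397856902692698714649787304439933678786158762296003776098396498615429266625304716007926164774550211524151996674456186768, by decide +kernel⟩

theorem exists_check_12_6 (l : ℕ) (hl : l < 3) : ∃ c, check 12 6 l c = true := by
  interval_cases l
  · exact ⟨1038031537996128666369269969040, by decide +kernel⟩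
  · exact ⟨1346933472815338698088761095090953943729577480241023833348422713916624692855553972021754790143560726146101782598152578707710991018916081962460345528542369355722489288508328960238863015825367656611150630683747908520824519245388904806807351514911658705439885062727190035716981998494912247356985689606671078359420120489397472603759170903287605735936059010142727947828456253149272277478837782428142785566528969910070851748430516721331234648732673473999819777624941013429390157355936977568717418468169625022351387548946021670086756470300497084835999411866081972294954386041349080499019919005640740890218936706115575076602804132591270339677104212932889733494717875599182065511673180594330959774915866665907527233493017872487811497562379207121882593237788855893402096267408, by decide +kernel⟩
  · exact ⟨30293655743616386285891673293740256823448687276628836516851737283996624551418408897790198475384571717993575666320470271427366164769868684749649523406417908204923157098425324847191326397101014179813412500887850386506172970630354415752427175500078218528096740512382173096109950092980368, by decide +kernel⟩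

theorem exists_check_12_7 (l : ℕ) (hl : l < 4) : ∃ c, check 12 7 l c = true := by
  interval_cases l
  · exact ⟨4877692913164593167884022731131372443583422193488738326168266705822196642925004853387911755612891881450746603145425612776075286016782153944497613275468388767355993020680754052669431580136010847356276076705691206317488760994325842746703405948423401755910696106087110852135224075666328155197996628952013767275254916854675812216232420922602352443861245042114862936809713700463996602768, by decide +kernel⟩
  · exact ⟨198985346192598300706852444830233645180771002491801203699932334370785700961426548401352895985021924682001784130771624445785300004551064639423167207352620577437896640395733345073798130146421502873006326996641847617313398163983736291543723113593776677567075270126311662671618474883622170547734656479542926604872432393834228552301152265076155008130790285652484088973736263270215907243191162529226396245947694411068529871652574277042363878213954928798655493853909120712640740089321354339911650641612502585082831791921590623301911848242933953011735927676157470363054519183691632503349847856881629293153222955329670073777355088030926018145563813157619027988085807360153770457871020676615483646362821619091268347510958851465196242951146831009200354835870173609147108182410246052845099206642815918943361090896975167633634485021979866301859784204739063924062553921203598237839706069165396909312515568151116779212068642814750980743424762447361349794141771057226450784838380212116516618188169558613942453189286146077049463074756691089638684431619212691062048666490482181836388003996743123163677641980243923195872883499998111833320561158678969288056222883229324094738844607546779076835700990630388747192058751072892239284093403312131800785478121015085179606810760840107782363317010223215890281138718736583997538374457674363408725110977055586036484890491200186879589409513406960427801334391412972393971942241193155037812814006391550977284999946472866462516493648094753989407280831928177795507756604345229422312522253503258722356141772221979414533704310957818040506150304865564906249813392,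 by decide +kernel⟩
  · exact ⟨86496820791062309572810674612391486979482441709365303960189791325373132127637452541010035442105522857321521253487214329552042922402959571389973701972215622237226351109848942853696975260923248208705944397649815126108013972586081474757071456927686559003550405398743977346422732360640244675995018310193971614135662179659203503394374343336729347031946666362691147606566103844281293405924817045337497892491474054248571320520101436100880360666977912336773520, by decide +kernel⟩
  · exact ⟨129261432019631795067913786362027010311400314567029758339550860119569071630905178643542007752104463776038732618930237426090865155337628676226382250361037411274619793628197126769681064133766783643087587478520324323446356953175819833810142047505100756645225538778031595177604776365352682166761759615366063629379908196045176922571431560517682297834820339884616779002789587658388280730351703037412857950306673721916515240646333719080191894888344752999485544528280186146768287227516960175100023221862985298820684677678769940985499678442506158341126442274188037579563269631389247561427733458463969111095697864036041867044110670284146191945045114492150159646555659011738198157401788354671264052661975480114601428206953868940294655634817755122983548640540615660446994059308245395431597894345734734275144113171932814851151065488, by decide +kernel⟩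

theorem exists_check_12_8 (l : ℕ) (hl : l < 4) : ∃ c, check 12 8 l c = true := by
  interval_cases l
  · exact ⟨53065747017080553470189985124201736576687559102612197604413804125949806918938245778037540380915467571717437138699662906142297268462487850345465646535046350652521085536267150556959014211412120078524279317789349328649766859473996323489608058561946473738375665079453864941450943251109008, by decide +kernel⟩
  · exact ⟨17123145479535797893615541619114516315416740700355832922438028527238725348525238692929568056502955186321359071840325781845953650134494158625303558883260681813892260394763747564234399329916846623937078435624759326351242351699407347759415866738426821948942412647423411056986215082349950109673175619533724348542745498905717731972672249205982117637571087245495913789602873737045482756789336720556294933631095007390483933219081129535760937321896769313326628323300882793238070233081142355648543255893305748149738407754554287904702379255106704091639450818842334912812309243459499422157939730547357708142736385867495951864581958132069005945276928551047711711728467507828383534210816184733434828133800700685326387661024366193649297083040527930961468774276510547924115563045806557518587909077608208614425134227268222656039440319031581421743402740863966258352789156717002245258031167274533829643184352066709151770603995470951840182065264670128475676436123534306626970053614676470682346562632016397521761395190444916633246892833323665478564308944238201210177447749930561471941005674329900626200687838905407752060909105306104439057949358512764827704442028665694656041755403408177973412090476492104115974684341254037313237187370926001909907736518772089370885081809505638687139085456010150806357504828628915562796483329084374381080868082752616517231383541557419976845984621844610991437379715008418354364872984007099774262913245912365412032682165450508846452083338802663955206614822880522307934492685630654998868700532311504241392418373132696736222356272752548763212760592178776650761069976577115708779434334500700879169241231549809669433795023503830861224160750644306987822871682794629964093515339942640344669747963663089337655210525791011861174514532072315124821524511442815925316044565917323667572216985699234302125513055581436425996601396481108642522753213040840153044718498108481527215902223510176432339675641553571087689533240434881581711990301322814417901365797949203261166449351581500472362850759085518882122055865416861124025399012115207006934345542538130593824319652775352143135949327996194191853953492027998175821907850753001668011504044132544656,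 by decide +kernel⟩
  · exact ⟨1652871623580518249604565610448699469307101744491696477581243840635696847585231580182563660632109497764705986733454675558141850999719605354041502829952178839822385098285126307089904699147777929697223199539672572276089797204831791874394325035502241810677756009334249169552511552185361809508901682837486401501995253557708107282668585627964666724193480243997306816876163148346860786222448290587305305153829951935240154970845806923829357567485335943210786515425557272998384901693461761447667969872638593868085925131986911715773866033246320349360140362186743450058320468930011839680832961620808229176955311389034803053409663768597392562584860677369153728315218805340366387532935056565837654091280145626759493619527102136747864750611360822796999554194587515647935202538332923006061853731258470655730934955288229066984816740341543000727678311180675989684970614670195317473829223744232906630008875339289707637607055123446673742343470416009043554862654460978061955619488665315936145836287065252309120734972745277199739375951716447375796989903398755574604436203732643636113864119220677045356418220795620906708148212987912567495380612696621616947297936, by decide +kernel⟩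
  · exact ⟨710317481049304916527758061652170382361500002327386806703660134876277971291203140125956197109871771027107303788760641129334688038495120883309854465248840322196678056775918907012865455827829571362533308615365992500380532689784966472573577101696686686201797713575491505614755040262128382532193472244354555922197511458635884740714716660638546616583360985840984224093265513833250777120899873827135646565088309259345506042004090133849271799635200817731380677994998000319733479720451416521414108474694906183883495523398161525749107027253786007473430624339314681592081721527228061270541987643431009118573018442574052265601265662932120433666145979632608367929943122286474899189343303395564736989516781105374789361910342747977002497720289534142682490721809594171650722211553929593873569736234723276204484507568092417668333913576220861957255030071027474821371980185113365967615587943496297085758281113287789176776553858801720996787952060375185845999252165056558756494955647419919814323688445865294256178249451902807577414768837606804373332055696, by decide +kernel⟩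

theorem exists_check_12_9 (l : ℕ) (hl : l < 5) : ∃ c, check 12 9 l c = true := by
  interval_cases l
  · exact ⟨109040966660346353078616503781749304253420269787850305022283280859627915067046867683716004775092553965358689247053582649469940651815164564437426092692514779336703466739688743946530825852056956244051758983678311457123326889661730840585045059631774886839656212227143831626536602492617331752008780957362715851570069670744962275623810273353843789485231943138758556871650781179235004781801010794033527044917990453684653376950968804151773715179816821307515527580000133564732778697377859269276736133902782390497155999078914793999815486005248175476371059369131204601617411671126361749008582482188922215615942586747133125817652110849813725711186634131043034363726212105128805526370080815172364798892959051212638617661586676716521919080413664071119306608940435360094814988605239897241255556805159475960048822359564283480996823786431747923553183979307011658425269613248349919235999027794110682799640944061035652063851015963298577012216089719047565141539390312729800857201728376161778218298968142884557131878785333913737325088783379240137272981159004460253698523772370125063354891693403497049059362239433400478867930753347339228564096983879128864006372040587752490336684131564358181845408206284600763283736496922975494736515000745087042604114141328, by decide +kernel⟩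
  · exact ⟨788046967337442473922015293093100866458195128089840754186142481281715005648133181584620743173028026718629323353661294570812914396178398692051925532881264852986336131666661124322751950681049954078046865496230890917200078778779303946907040214185236423248096535162850503798160353307901465447840834760958947886211870613867342143023874472516576108595086773547432873836451894896025032671529711119649074985146385521962643598586783042045823619019325808109454062807530397683721231689889960054195188489095529585823378369087398836562040841399858870668089680479229782107136185906594146720717638645173088283013338024287116384955065225616049008070739361125383858469858449429944616551757263940911936847015082578677758933015092405164047349805597115530757915922474591636062030606139151968586347772855457357294003714714350675920983839909584138524738360064462595665862083927483956379793945251271680963365789749673028998453897091128305451957477976550878248481513308183709733905478015770292450767474822083492402982433906282630707186386770344047629708771486582278119229606997705761257363254584610792662766750852216781148213707405725625004585334275365955676988796483649903259045819804487640132620666461255315146302356735675207281278603382367347530164290596388366217073705840988922221639704535829908833064565478990100576934069915426454258196584952755675835709133763686407429013807174355401628447317910464591468553192856045838605008358836116503747388987307583261206132271806514517034223621635821387788953505557012162366483884178148066272896965112925992354261571745761676188664892059028678724640212133789198140597841217470090543037706251460829759624997353244661150567274705708259070113259463886857611713066324788378880824095080982616424055325969951355718489803798807996335423158959025074161792207031723323387433915365564334408218651330711593861470476349501463837940375776268930141557183721499866623211449165713111346373760443165522461839825670205762865098686619760735250554271397058942646802912432913152495159156380098399930214559335805039041786493813033784723659538565572195638017851520434167835950558418428892010237576400263548303940667803849822326862128735379581870161845230715744907152489362259741210606036622112909602536336383934691196650357157954582710352639245130233512260395932465263432523559326343298584776766855406511468692809446776258055825478052172502172965927912859243599768567463660150781925226290855350655648060511919395734767981824991780118668646010936882134928,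 by decide +kernel⟩
  · exact ⟨15224122394123688224640119297940526135999602798284625423414103037976722322519756339120086746627810983029846775724820674234737559228477371958488183281056566205406134534405065059568212084185448393162974341428132696420291620360514230668221122430492263969043717402497471322620596724333793927651574014084937568566399390858227090139520083779741933829348432514938647600528065191766086578563260143546236643447294777723267033206754863436897609791441128668696319020474731722408985550897792011795658905398225754145581680949524651940815429534258583477129163421259534681719220449490636782547207399764997276520005903563375948201076405326698932370666130769211432377535910867709194880942889533439560811896996848514198048973512506527574535986091652970346578658386799784283169012267982989488634157171664545682789401428530473400586408458334374589193672747062123777286841356079284959520181657818440602705016736093455225867621984586339511255465986001663215623066742394964172888976558692723038475126103568203260095217647220093654432957039821551960136056480764363989452109219264805969364134293038267778637290618384467048272856963962268164694448649720218009327977765894402758392008838515316596317201653248439558638048700034871138826484211258689093196963351240271237736813295902578050028369511607787007014067484505095213239059660049611503491957504275477739373285156895833132748270824971796122634919577790796329562468214736084083860882153480107822504482103886893014817602039530822671596482359101396820856072890315814502288, by decide +kernel⟩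
  · exact ⟨3574867647812368437785643374061498525312801446570749920725307757241996971002801279991163435104201788922746132380906323443956961654756260688136373003308546461845177422094734330112566484839511330311786780085331885164745280006371337253739382479164943053506726472347580736679330303390699846432359912781103108181265482437220677106874473129225517497884536596049035501455823663674099544816478534149377143508251701615694337065153768607660373486898818458346050510328850867045550419604430413765085690351353644615917614188260024138047765163339648404771556155217320627764834822198087211856963251683708367091282587004901928858985184761384694509572048335289513927727296763827541108172627494271072134501654318076266235068995648717470385970016597100820438935246629114136109925245658066144846832129314213077058164319905915213212745844449066137444380859167866587464160471495039683496558137126766138400077146340984601726409606285941412877278950864129281145345077790272061822762896, by decide +kernel⟩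
  · exact ⟨187760811991300762995927819936500488182874271877663336842714158213963493504597949539679339509562544818630209976140046102241364292782610193436865455382108221558520308947425541135648826640509400499361436629759138034826586711837384305380613618061183117440945799854606888890954522218653472673097565939931287494373958078443590587425044882748770129000045411622182727021474425980047416235693739033278000725809615713564612777230375313325275919986531984226574180115437422110367384635712244521392966625090150188169812494469131275214136621382154493411198715440468866017252296138522546325625648728097979149860624014818295148325288385667719203044707256771666402831659290029551086493598372454956302022686227988733553273303582179332752977442972853118850664427405826128486431585131461079285650805449733049934402489229930125783234007565245337268113075349659670873212792004834351797726947777329141580077539333582628086672, by decide +kernel⟩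

theorem exists_check_12_10 (l : ℕ) (hl : l < 5) : ∃ c, check 12 10 l c = true := by
  interval_cases l
  · exact ⟨247163990440843673693725882706213232480881922662003627445779909719989204613329823101760316629129472986742175354692880035223734445811463031759550502733019636511217405796536225973445855478429659069966935677666431695869249068458593021917070713710528731501698810569294773671298159741011199439623717677386966122483062426129045508673352596659551583031646253708359117952162429421219400764918449091047616918635076883731624618322284650791502623469427597906109267008953122784349658188275609835563315218897823092475444214271552336015908249084308418747242275724890674852526572937510321515220789887431604904404038471705547080054109192863794964944450829839441142039534137150695666467844301254569398093550511009172978125857080525098750303413876935109201805470065778653070824112451383670725960708042544298013472592856738430171948874931505836280938923958211446391898622082281964499495861035918310879140531225697667234493351799466251561530186037601760621714817134250715031828610640937238476145323351644680048770502171258833111084349732081934641962435527080952694412345519107797314918533230395679679462956002528382073538736653771125126923676188672745597031167561397750264799012163262833122774486805251324461058365592752925222915349949793579790535824, by decide +kernel⟩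
  · exact ⟨219389545254420564997806050949553800326002237430666070749524548733934797822735629101121290565784829169771085551176312503049819928825603870021853880281954938153111121372047535044530084038120931674787048649663683658311048074025302180124022197799558772215123303824292262306983761715727550671213901749972340060818188188541487352747745163029498521403036441071323009565564738352885537626422108202094854869689225029434237211182587096168684084733838348918335574520970493346387560147238067899099440095364383963510441662027457891351153409658780812558777756716324802999772469583077643742648457336550753770828569382971684204609817868079189019802374236707246032399860598387691766367066774392514967732106061562122382652052411502299987608088526120858022449705492407285540642686242027420069032954263381197515121039347291445630550503605886412213986678004209730985295689402359583313944170208469905869581417142247305308934567939133078307733668834326287412828601092847599117555718007566094759727317264241277581914803817195692106239129479598969322440474851723693282775240022045419747769755902502102544444742735087273577468023700195236160380485446088711426921584097467467659118894819249006644821398471856213411958986194251867113751603643109783257723630801283950095183653524800520565734738606016987262201616834584059457952050285684554420103319241343049883758553679382220462940859922246031029218451130392979990316524464444509296438721726520190490053566047128589806598914456325471765468166362192153651281670050764882206358018865733645332199490831545299735217512544560948084226791659561142686985042653072040790230298291195802296538405243593420744847931652429411587784680595221477482938690893265567370029082731338913389731422143144485540885137884653561968966481195907199354511452242591226636502798551742314445983857388258048022753327034203214621430495761145247470570240536107517806041415276619755674320759793097354575464981999326183341037689239430028580777605174526898965459352318685706049353865365751879228516494705088211591375896152663375866747477529065771374642695979380795073390214950894907582095288002847152917004927735332493504689497927685568508902128092270486850319154127769873977069516980509671560052142966312610092669330940456504285183877740754903818741654730007429216099984255855934829116836756775753741451893523405097780505668708687418840598435874532887891406374696409645803181078495451404972391071231474544112236148328304221042447457240291682839684160974286009823110580270345610609875080188688278904648943425030998385159668200649234782537812309936572584399827295367246109996804640824817950737199049014355768265301111021978227351001004688,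 by decide +kernel⟩
  · exact ⟨97660330429303607751574686852612194879551200068047013221935098808801348765127810455895109679537881278503427241883363362563242483058738729253363352833514025297546005141119400446972762197841231630312461118659693370723826904308476767370838716869437334251885078833376236525104561434006076865055936225529477736440560397540893999350243339297390946609376356862042836040352279797889118460287044124792979990077278820048359562206763868561544915445631014732501459712570361657714774902589822839541012186409483604332052856539083833853740427324466500392195689269037905393450216542204856343081164836944875180484973180333454006120527266616665752471002039088966143826558477424504407722470291046557756371981696085480800925614301458463572251593477306697765067488090224101080634387815191277338412809120660505206580539672746460913754592308461693788564703557413740722183304270838573822591307076058619479882955561363399369917145708780685224907857199956199382722526740219287829525520555243963814988978799207697670033911488542201991141115659414691906410536572100020812898774733219600020692110090434039919083023920333145020236107978014834276472148517114023553596934410833012024347485321971127574166472912757875576778169174290870267691594593614072879241470275946608142186890839651000362266300945466423504381340884624403424317686471686785865166261401450957949827564691445146358831163148353738175579415070412826395967298886675260840515190219226076606329011344, by decide +kernel⟩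
  · exact ⟨20649296259032445317443116123891070424608091901369005484065128723871338151938245060629665270887616025505094618372956404399825961764559947737214637970525177523710386560866096101604850597371309379438761198352831419436843831190567714465601113989276334563520507639608637746590008041318717436568291446485452694406349161908455790306951489962820176391808696032323384090937300247671682355840966925774115153390732011678222952252275131606237083051433777455231337708503317750223278851305885795186832207910454722550144916110052407503539528683588044369447552315065617729507297659547642433079892898417397950038333021156087300598826300782289971284505529648248544931371758016227081014246032, by decide +kernel⟩
  · exact ⟨1816854095770304172487594001601235751746050020309108789901952329195338628860759469242482810510087011786975169446870388498795140043486508208034988080099974271789274967755445621365471760789640267281599327887899357702806569582130541969909083135892387629121173195686550643394397373161389488088971135424520959906917263906440831143357818722990419829117468402972624160121888015299127957642103863628599700660588464705966576633363597384784293564809030197262993203796910837362070398365830180771698990747441169113540024460794191564052924425385993945735486503781245721571780316142710257055176164952251762570315264623855993311028729372588788325412400227827376422953408211259350123175326467539884415426268250251541433687331047349125286452637658104113550405414954808154767693491519181172066308733091362421768643945864968058233056386727022030636605753415498932252020446287543057408341852635817345635167379997871454964431792096957861783960464, by decide +kernel⟩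

theorem exists_check_12_11 (l : ℕ) (hl : l < 6) : ∃ c, check 12 11 l c = true := by
  interval_cases l
  · exact ⟨562663724313116447542295772645225461310774260038851404679784892914871305055721128916940431252447688034546429348979813164849323753484183772387518726583561786516776162793912185233970424349279530740638773349279412947622862548955556729494635380379321990604671408241143633880733382722000885274418007081956683804044077970702824910719075737512443757057776270548851805251876839739845018885046428249804495961654680725925041522856083047892165545632281424877817763698109300972440332256518699053513816528201445328678757209010023868109674651988026862714875133746916915610306218713806378656501688604562055387201506196313551377643727835977940457355898360269788308638936522875985173534236882647589552731531864802935075755520228084794755292064546143615305027596693841850171432168968826279033105410247523347567518931293739536737332741076131019890624069737018670065557187739742393667045968779546381363509608570884531455130728313003343724887707091989858042390681513251153699916303898432896439202611836704881029221779986198448187504435186969034376866114442850102680021570804165064579711449765403176769921071077434838230701849312263626714903309718260366513994122602687290452650835926118071021716027400123107572808736462124846556653947945073402175547238170371649370231503763882559209416606092254187644831021703564471353814306052831865485156306598203005930196777368364892057687740792049459445932746165328427715439321079123009782239197754220738021618267443853639573691742076645464659582410139679661508730629009194914140739202052032144, by decide +kernel⟩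
  · exact ⟨140050538195910657811501438793338034766632388805280763729375675440291320613447698598485651745903379991569025217456680347224318660023855971761010911068012926866425563626961444449063386774374797794088974194238604402623843983363788499137994950265024011510375185247385415117105987486446285165971512998339779602609116128789502026495869850234233019639062391389676527366593792607051325341671299329308842392522508558743392910408279457189555549824000024236935742201881711425575170173628719337118079662340395041178300769977305148792216940990742325700782565967509629720380148387728837223620872912058712324673562331165307127006349715739362365765180290595805878388430262631856474201707323443735795291931533683590402922581283162742617255463655706012970676425886959694795110734347769419466874720585563218968398842849243921379990364673336011897450682737043578295854466257142479523575215835827758918560493152621569539485347355311850351532054375925013178838982358248522431455836408028049895993249421602960, by decide +kernel⟩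
  · exact ⟨848139222464084698036707467320306698009938296614718123484866134978398816586617245005707350153704506950087212094552413046849493151895303016645180045811695729462337576210861314747963950878294427683949448614825597699904752055245402170679727616630885003169514462729466941039899755495337755149848304350557670933764794249610093101143020925554671447316926807949502744012305910327613040558461116064058539638724060579040138321476164155753925089850736347116803149237063705242835302585855032889951370974806647000371067719550235513639569575661866939771900242229895626769373896423571509034785528642599445059239022519985402910484152711057525039896686211678015685705203754238580746813811539730249227190568099362184848087028231511005261701910926645221496974759157000936417777363984439739484268543925373477157741867170578864127626526068052442007034107874208831845749403126864230002746415148837479964042316419829306317593575144129288380446657721497146850910919367497033584623490515584975678413050584545574381722463882724894229772747311264938870844447846940942890246109479045841692851264231737682005125547757514147069840352096700070972079645211502220724680973985957517544899808756570858694930661098207640679218539275314338570716291659902916635891091894221754340811718761776963856758460216217858528034489968082465595437796220800367049688710811006475001690065051299978705296, by decide +kernel⟩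
  · exact ⟨991998020259210878905155926833309113949517813066987603822877955139717351065518285153582455956622040648248162275338331505920161619457031227053841977969909628099497996819362023406266248879340086578996521343766565066466805347384038129974777971003362657640826490835964516764985172186243299984, by decide +kernel⟩
  · exact ⟨45990206190366128579917735663542619111281896969963179627073358038757815766560622237867988263371056084778532719575413348694180019565109338100403314006379424780851894613213688605979618204229947889368497873050709589653817374113579195249382653077004267633046147353562665201940738749679215048196922453690745187505297660157069668319276295812264059176819440940903144251469345679346211359055828352431619015171590327618402215702687706550250604634052327920502594393686186032486116069102339740799183209719575190224781137310184156704289967405771732200702452280850354975247721451988092024714370563528303132331328317339277504363109549788588715330852508846538618484304603449168292305612784742396086088072186485906524883876779346676434088317657934637244341151935074782895601126633317736766780982591948106140175072305737098938343367559828348939621147261760226328952294198285591119786508557233377123183698512589866335434621324618604370692186877623318042843544199091005338430979453364020863757824310722800393234844692834489275123010312880234836873543864759142723543897329895677490209102582556274453844856524124628165624767751191781025266855872754299107267125752667900703762360090357410452000118339209223194851243968955355931838266951098827744820346072860133616566078385826725623719725986839325493183804090484750859013402332602069764558549046564762224895395860449588050383349353202865296, by decide +kernel⟩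
  · exact ⟨535104093327619087448823259408686132819380715125153740917301035612845203798383749228364671539142043624290640093924218039433712374907743555562757385272072324299918437552951309768402908792819813806627874598748295455407873047691558149249218312586794632564880646699386279038204163514158445309777918972686623382208553458102311331670517982815798526090146203191155843943883488843090737096892272775012293042701069218147673336268471080751098763071608387666455402414490323519590772899514544449445329480506834334066116738542936766328982857566657920563219198981395096402650863457546414172284244253278821728265370426956687571033630665138535568, by decide +kernel⟩

theorem exists_check {n t l : ℕ} (hn : n ≤ 12) (ht : 6 ≤ t) (htn : t < n) (hl : 2 * l < t) :
    ∃ c, check n t l c = true := by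
  have h : t = 6 ∨ t = 7 ∨ t = 8 ∨ t = 9 ∨ t = 10 ∨ t = 11 := by omega
  rcases h with rfl | rfl | rfl | rfl | rfl | rfl <;> interval_cases n
  · exact exists_check_7_6 l (by omega)
  · exact exists_check_8_6 l (by omega)
  · exact exists_check_9_6 l (by omega)
  · exact exists_check_10_6 l (by omega)
  · exact exists_check_11_6 l (by omega)
  · exact exists_check_12_6 l (by omega)
  · exact exists_check_8_7 l (by omega)
  · exact exists_check_9_7 l (by omega)
  · exact exists_check_10_7 l (by omega)
  · exact exists_check_11_7 l (by omega)
  · exact exists_check_12_7 l (by omega)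
  · exact exists_check_9_8 l (by omega)
  · exact exists_check_10_8 l (by omega)
  · exact exists_check_11_8 l (by omega)
  · exact exists_check_12_8 l (by omega)
  · exact exists_check_10_9 l (by omega)
  · exact exists_check_11_9 l (by omega)
  · exact exists_check_12_9 l (by omega)
  · exact exists_check_11_10 l (by omega)
  · exact exists_check_12_10 l (by omega)
  · exact exists_check_12_11 l (by omega)

end Certificates

end DetourSat

namespace DetourSat

open Finset

/-! ### Detour order, longest paths and linked pairs -/

section Paths

variable {V : Type u} {G : SimpleGraph V}

/-- The list of the vertices of a path, or the empty list. -/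
def IsPathList (G : SimpleGraph V) (L : List V) : Prop := L.Nodup ∧ L.IsChain G.Adj

theorem IsPathList.reverse {L : List V} (h : IsPathList G L) : IsPathList G L.reverse :=
  ⟨List.nodup_reverse.2 h.1, List.isChain_reverse.2 (h.2.imp fun _ _ h => h.symm)⟩

theorem IsPathList.cons {x y : V} {L : List V} (h : IsPathList G (y :: L)) (hx : x ∉ y :: L)
    (hxy : G.Adj x y) : IsPathList G (x :: y :: L) :=
  ⟨List.nodup_cons.2 ⟨hx, h.1⟩, List.isChain_cons_cons.2 ⟨hxy, h.2⟩⟩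

theorem exists_not_rel_of_not_isChain {α : Type*} {R : α → α → Prop} {L : List α}
    (h : ¬ L.IsChain R) : ∃ L₁ x y L₂, L = L₁ ++ x :: y :: L₂ ∧ ¬ R x y := by
  induction L with
  | nil => simp at h
  | cons x L ih =>
    cases L with
    | nil => simp at h
    | cons y L =>
      by_cases hxy : R x y
      · rw [List.isChain_cons_cons, not_and] at h
        obtain ⟨L₁, a, b, L₂, hL, hab⟩ := ih (h hxy)
        exact ⟨x :: L₁, a, b, L₂, by rw [hL]; rfl, hab⟩
      · exact ⟨[], x, y, L, rfl, hxy⟩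

variable [Finite V]

theorem IsPathList.length_le_card {L : List V} (h : IsPathList G L) : L.length ≤ Nat.card V := by
  have := Fintype.ofFinite V
  rw [Nat.card_eq_fintype_card]
  exact h.1.length_le_card

theorem IsPathList.length_le {L : List V} (h : IsPathList G L) : L.length ≤ detourOrder G := by
  rcases eq_or_ne L [] with rfl | hL
  · simp
  · refine le_csSup ⟨Nat.card V, ?_⟩ ⟨_, _, SimpleGraph.Walk.ofSupport L hL h.2, ?_, ?_⟩
    · rintro _ ⟨a, b, p, hp, rfl⟩
      exact IsPathList.length_le_card ⟨hp.support_nodup, p.isChain_adj_support⟩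
    · rw [SimpleGraph.Walk.isPath_def, SimpleGraph.Walk.support_ofSupport]
      exact h.1
    · rw [SimpleGraph.Walk.support_ofSupport]

theorem exists_isPathList (G : SimpleGraph V) :
    ∃ L, IsPathList G L ∧ L.length = detourOrder G := by
  rcases isEmpty_or_nonempty V with hV | ⟨⟨v⟩⟩
  · refine ⟨[], ⟨by simp, by simp⟩, ?_⟩
    have : {n : ℕ | ∃ (a b : V) (p : G.Walk a b), p.IsPath ∧ p.support.length = n} = ∅ := by
      ext n
      simp
    rw [detourOrder, this]
    simp
  · have h : detourOrder G ∈
        {n : ℕ | ∃ (a b : V) (p : G.Walk a b), p.IsPath ∧ p.support.length = n} := by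
      refine Nat.sSup_mem ⟨_, v, v, .nil, .nil, rfl⟩ ⟨Nat.card V, ?_⟩
      rintro _ ⟨a, b, p, hp, rfl⟩
      exact IsPathList.length_le_card ⟨hp.support_nodup, p.isChain_adj_support⟩
    obtain ⟨a, b, p, hp, h⟩ := h
    exact ⟨p.support, ⟨hp.support_nodup, p.isChain_adj_support⟩, h⟩

/-- A longest path of G + ab is too long for G, so it uses the new edge, and only once. Its two
pieces are disjoint paths of G ending in a and b. -/
theorem DetourSaturated.linked (h : DetourSaturated G) {a b : V} (hab : a ≠ b)
    (hadj : ¬ G.Adj a b) : Linked G (detourOrder G + 1) a b := by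
  obtain ⟨L, hL, hlen⟩ := exists_isPathList (G ⊔ SimpleGraph.edge a b)
  have hlt := h a b ((SimpleGraph.compl_adj _ _ _).2 ⟨hab, hadj⟩)
  have hnot : ¬ L.IsChain G.Adj := fun hc => by
    have := IsPathList.length_le (G := G) ⟨hL.1, hc⟩
    omega
  obtain ⟨L₁, x, y, L₂, rfl, hxy⟩ := exists_not_rel_of_not_isChain hnot
  have hc := hL.2
  rw [List.isChain_append_cons_cons] at hc
  have hedge : ∀ u v, (G ⊔ SimpleGraph.edge a b).Adj u v → ¬ (u = x ∧ v = y) →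
      ¬ (u = y ∧ v = x) → G.Adj u v := by
    intro u v huv h1 h2
    rw [SimpleGraph.sup_adj, SimpleGraph.edge_adj] at huv hc
    grind
  have hxy' : (x = a ∧ y = b) ∨ (x = b ∧ y = a) := by
    have := hc.2.1
    rw [SimpleGraph.sup_adj, SimpleGraph.edge_adj] at this
    grind
  have hn := hL.1
  have hsub : ∀ M : List V, M.IsChain (G ⊔ SimpleGraph.edge a b).Adj → (x ∉ M ∨ y ∉ M) →
      M.IsChain G.Adj := by
    intro M hM hxM
    induction M with
    | nil => simp
    | cons u M ih =>
      cases M with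
      | nil => simp
      | cons v M =>
        rw [List.isChain_cons_cons] at hM ⊢
        refine ⟨hedge u v hM.1 ?_ ?_, ih hM.2 ?_⟩ <;> grind
  have h1 : IsPathList G (L₁ ++ [x]) := ⟨by grind, hsub _ hc.1 (by grind)⟩
  have h2 : IsPathList G (y :: L₂) := ⟨by grind, hsub _ hc.2.2 (by grind)⟩
  have key : Linked G (detourOrder G + 1) x y := by
    have h3 := h1.length_le
    simp only [List.length_append, List.length_cons, List.length_nil] at h3 hlen
    -- The pieces together may have more than t + 1 vertices, where t is the detour order. The first
    -- is a path of G and has at most t, so the second can be cut to the required length and still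
    -- contains its end y.
    refine ⟨L₁.reverse, L₂.take (detourOrder G - (L₁.length + 1)), ?_, ?_, ?_, ?_⟩
    · have := h1.reverse.2
      simpa using this
    · have := h2.2.take (detourOrder G - (L₁.length + 1) + 1)
      simpa using this
    · have h4 : (L₁.reverse ++ x :: y :: L₂).Nodup :=
        ((List.reverse_perm L₁).append_right _).nodup_iff.2 hn
      have h5 : (x :: L₁.reverse ++ y :: L₂.take (detourOrder G - (L₁.length + 1))).Sublist
          (x :: L₁.reverse ++ y :: L₂) := by
        refine List.Sublist.append (List.Sublist.refl _) ?_
        exact List.Sublist.cons_cons _ (List.take_sublist _ _)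
      refine h5.nodup (List.Perm.nodup_iff ?_ |>.1 h4)
      exact List.perm_middle
    · simp only [List.length_cons, List.length_reverse, List.length_take]
      omega
  rcases hxy' with ⟨rfl, rfl⟩ | ⟨rfl, rfl⟩
  · exact key
  · exact key.symm

/-- The converse criterion: the new edge joins the linking paths to a path with t + 1 vertices,
whereas t bounds the detour order of G. -/
theorem detourSaturated_of_linked {t : ℕ} (ht : ∀ L, IsPathList G L → L.length ≤ t)
    (h : ∀ a b, a ≠ b → ¬ G.Adj a b → Linked G (t + 1) a b) : DetourSaturated G := by
  intro a b hab
  rw [SimpleGraph.compl_adj] at hab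
  obtain ⟨L, M, hL, hM, hn, hc⟩ := h a b hab.1 hab.2
  have hle : ∀ x y, G.Adj x y → (G ⊔ SimpleGraph.edge a b).Adj x y := fun x y h => Or.inl h
  have hl : Linked (G ⊔ SimpleGraph.edge a b) (t + 1) a b := ⟨L, M, hL.imp hle, hM.imp hle, hn, hc⟩
  obtain ⟨N, h1, h2, h3⟩ := hl.exists_path (by
    rw [SimpleGraph.sup_adj, SimpleGraph.edge_adj]
    exact Or.inr ⟨by simp, hab.1⟩)
  have h4 := IsPathList.length_le ⟨h1, h2⟩
  obtain ⟨K, h5, h6⟩ := exists_isPathList G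
  have := ht K h5
  omega

end Paths

end DetourSat

namespace DetourSat

open Finset

/-! ### Degrees, detour order and leaves of a triangle-free detour-saturated graph -/

section Structure

variable {V : Type u} {G : SimpleGraph V}

theorem cliqueFree_three_iff :
    G.CliqueFree 3 ↔ ∀ u v w, G.Adj u v → G.Adj v w → ¬ G.Adj u w := by
  classical
  constructor
  · intro h u v w huv hvw huw
    exact h {u, v, w} (SimpleGraph.is3Clique_triple_iff.2 ⟨huv, huw, hvw⟩)
  · intro h s hs
    obtain ⟨a, b, c, hab, hac, hbc, -⟩ := SimpleGraph.is3Clique_iff.1 hs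
    exact h a b c hab hbc hac

/-- A path from `a` through a vertex all of whose neighbours are `a` or off the path has two
vertices. -/
theorem eq_singleton_of_mem_path {a b c : V} {L : List V} (hL : IsPathList G (a :: L))
    (hb : b ∉ L) (hc : c ∈ L) (h : ∀ x, G.Adj c x → x = a ∨ x = b) : L = [c] := by
  obtain ⟨s, r, rfl⟩ := List.append_of_mem hc
  have ha := (List.nodup_cons.1 hL.1).1
  rcases List.eq_nil_or_concat s with rfl | ⟨s, d, rfl⟩
  · cases r with
    | nil => rfl
    | cons e r =>
      have h1 := hL.2
      simp only [List.nil_append, List.isChain_cons_cons] at h1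
      rcases h e h1.2.1 with rfl | rfl <;> simp at ha hb
  · have h1 : (a :: s ++ d :: c :: r).IsChain G.Adj := by simpa using hL.2
    rw [List.isChain_append_cons_cons] at h1
    rcases h d h1.2.1.symm with rfl | rfl <;> simp at ha hb

variable [Finite V]

/-- Suppose that a and b are the only neighbours of c. They are not adjacent, as there are no
triangles, so they are linked. The vertex c can be used to join the linking paths, whether it lies
on them or not, and the result is longer than a longest path. -/
theorem exists_third_neighbor (hT : ∀ u v w, G.Adj u v → G.Adj v w → ¬ G.Adj u w)
    (hS : DetourSaturated G) {a b c : V} (hab : a ≠ b) (ha : G.Adj c a) (hb : G.Adj c b) :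
    ∃ d, d ≠ a ∧ d ≠ b ∧ G.Adj c d := by
  by_contra hcon
  have hN : ∀ x, G.Adj c x → x = a ∨ x = b := fun x hx => by
    by_contra h
    rw [not_or] at h
    exact hcon ⟨x, h.1, h.2, hx⟩
  have key : ∀ a b : V, G.Adj c a → G.Adj c b → (∀ x, G.Adj c x → x = a ∨ x = b) →
      ∀ L M, IsPathList G (a :: L) → IsPathList G (b :: M) → ((a :: L) ++ (b :: M)).Nodup →
      (a :: L).length + (b :: M).length = detourOrder G + 1 → c ∉ L := by
    intro a b ha hb hN L M hL hM hn hlen hcL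
    have hbL : b ∉ L := fun h => by
      rw [List.nodup_append'] at hn
      exact hn.2.2 (List.mem_cons_of_mem _ h) (by simp)
    -- If c lies on the path from a, that path is just a, c. As c is adjacent to b, it continues to
    -- the other path, with t + 1 vertices in total.
    obtain rfl := eq_singleton_of_mem_path hL hbL hcL hN
    have hn' : (a :: c :: b :: M).Nodup := hn
    have h1 : IsPathList G (a :: c :: b :: M) :=
      ⟨hn', List.isChain_cons_cons.2 ⟨ha.symm, List.isChain_cons_cons.2 ⟨hb, hM.2⟩⟩⟩
    have h2 := h1.length_le
    simp at hlen h2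
    omega
  obtain ⟨L, M, hL, hM, hn, hlen⟩ := hS.linked hab (hT a c b ha.symm hb)
  have hn' := List.nodup_append'.1 hn
  have h1 : c ∉ L := key a b ha hb hN L M ⟨hn'.1, hL⟩ ⟨hn'.2.1, hM⟩ hn hlen
  have h2 : c ∉ M := key b a hb ha (fun x hx => (hN x hx).symm) M L ⟨hn'.2.1, hM⟩ ⟨hn'.1, hL⟩
    (List.perm_append_comm.nodup_iff.1 hn) (by omega)
  have hca := ha.ne
  have hcb := hb.ne
  have h3 : (c :: ((a :: L) ++ (b :: M))).Nodup := by
    rw [List.nodup_cons]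
    refine ⟨?_, hn⟩
    simp [hca, hcb, h1, h2]
  -- Now c is on neither path, and inserting it between a and b gives t + 2 vertices.
  have h4 : IsPathList G ((a :: L).reverse ++ c :: b :: M) := by
    constructor
    · refine (List.Perm.nodup_iff ?_).1 h3
      exact (List.perm_middle.symm.trans ((List.reverse_perm (a :: L)).symm.append_right _))
    · rw [List.isChain_append]
      refine ⟨(IsPathList.reverse ⟨hn'.1, hL⟩).2, List.isChain_cons_cons.2 ⟨hb, hM⟩, ?_⟩
      intro x hx y hy
      simp at hx hy
      subst hx; subst hy
      exact ha.symm
  have h5 := h4.length_le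
  simp at hlen h5
  omega

/-- A cycle of length at least six contains such a path. On a 5-cycle one vertex has a neighbour off
the cycle, since a chord would create a triangle. On a 4-cycle two consecutive vertices have
neighbours off the cycle, and these are distinct for the same reason. Each of these extends the
opened cycle to six vertices. -/
theorem six_le_detourOrder (hT : ∀ u v w, G.Adj u v → G.Adj v w → ¬ G.Adj u w)
    (hS : DetourSaturated G) (hC : ¬ G.IsAcyclic) : 6 ≤ detourOrder G := by
  rw [SimpleGraph.IsAcyclic] at hC
  push Not at hC
  obtain ⟨v, c, hc⟩ := hC
  have h3 := hc.three_le_length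
  have hn := hc.support_nodup
  have hch := c.isChain_adj_support
  have hlen : c.support.tail.length = c.length := by simp
  have hlast : c.support.getLast (by simp) = v := c.getLast_support
  have hsup : c.support = v :: c.support.tail := c.cons_tail_support.symm
  generalize c.support.tail = L at hn hlen hsup
  by_contra hlt
  rw [hsup] at hch
  simp only [hsup] at hlast
  have hL : IsPathList G L := ⟨hn, hch.of_cons⟩
  have := hL.length_le
  match L, hlen with
  | [], h | [_], h | [_, _], h => simp at h; omega
  | [p, q, r], _ =>
    simp at hlast hch
    subst hlast
    exact hT _ _ _ hch.1 hch.2.1 hch.2.2.symm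
  | [p, q, r, s], _ =>
    simp at hlast hch hn
    subst hlast
    obtain ⟨h1, h2, h3, h4⟩ := hch
    obtain ⟨a, ha1, ha2, ha⟩ := exists_third_neighbor hT hS (a := p) (b := r) (c := s)
      (by grind) h1 h4.symm
    obtain ⟨b, hb1, hb2, hb⟩ := exists_third_neighbor hT hS (a := s) (b := q) (c := p)
      (by grind) h1.symm h2
    have e1 : a ≠ q := by rintro rfl; exact hT _ _ _ h1 h2 ha
    have e2 : b ≠ r := by rintro rfl; exact hT _ _ _ h1 hb h4.symm
    have e3 : a ≠ b := by rintro rfl; exact hT _ _ _ h1 hb ha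
    have h5 : IsPathList G [a, s, r, q, p, b] := by
      refine ⟨?_, ?_⟩
      · have := ha.ne; have := hb.ne; grind
      · simp [ha.symm, h4.symm, h3.symm, h2.symm, hb]
    have := h5.length_le
    simp at this
    omega
  | [p, q, r, s, w], _ =>
    simp at hlast hch hn
    subst hlast
    obtain ⟨h1, h2, h3, h4, h5⟩ := hch
    obtain ⟨a, ha1, ha2, ha⟩ := exists_third_neighbor hT hS (a := p) (b := s) (c := w)
      (by grind) h1 h5.symm
    have e1 : a ≠ q := by rintro rfl; exact hT _ _ _ h1 h2 ha
    have e2 : a ≠ r := by rintro rfl; exact hT _ _ _ ha h4 h5.symm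
    have h6 : IsPathList G [a, w, p, q, r, s] := by
      refine ⟨?_, ?_⟩
      · have := ha.ne; grind
      · simp [ha.symm, h1, h2, h3, h4]
    have := h6.length_le
    simp at this
    omega
  | _ :: _ :: _ :: _ :: _ :: _ :: _, _ => simp at this; omega

/-- If a longest path contained all vertices, no pair could be linked by one vertex more, so the
graph would be complete and contain a triangle. -/
theorem detourOrder_lt_card (hT : ∀ u v w, G.Adj u v → G.Adj v w → ¬ G.Adj u w)
    (hS : DetourSaturated G) (h6 : 6 ≤ detourOrder G) : detourOrder G < Nat.card V := by
  obtain ⟨L, hL, hlen⟩ := exists_isPathList G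
  refine lt_of_le_of_ne (hlen ▸ hL.length_le_card) fun heq => ?_
  have hadj : ∀ a b, a ≠ b → G.Adj a b := fun a b hab => by
    by_contra hadj
    obtain ⟨M, N, -, -, hn, hc⟩ := hS.linked hab hadj
    have := Fintype.ofFinite V
    have h1 := hn.length_le_card
    rw [Nat.card_eq_fintype_card] at heq
    rw [List.length_append] at h1
    omega
  have hn := hL.1
  match L, hlen with
  | [], h | [_], h | [_, _], h => simp at h; omega
  | p :: q :: r :: L, _ =>
    simp at hn
    exact hT p q r (hadj p q (by grind)) (hadj q r (by grind)) (hadj p r (by grind))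

theorem IsPathList.mem_of_adj_head {x y : V} {L : List V} (h : IsPathList G (y :: L))
    (hlen : (y :: L).length = detourOrder G) (hxy : G.Adj x y) : x ∈ y :: L := by
  by_contra hx
  have := (h.cons hx hxy).length_le
  simp only [List.length_cons] at hlen this
  omega

/-- If `x` is a leaf at `u` and `u` has other neighbours, then some longest path contains `u` and
not `x`. -/
theorem exists_path_of_leaf (hS : DetourSaturated G) {x u w : V} (hx : ∀ v, G.Adj x v → v = u)
    (hxu : G.Adj x u) (hwx : w ≠ x) (huw : G.Adj u w) :
    ∃ L, IsPathList G L ∧ L.length = detourOrder G ∧ x ∉ L ∧ u ∈ L := by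
  have hxw : ¬ G.Adj x w := fun h => huw.ne (hx w h).symm
  obtain ⟨L, M, hL, hM, hn, hlen⟩ := hS.linked hwx.symm hxw
  have hn' := List.nodup_append'.1 hn
  have hxM : x ∉ w :: M := fun h => hn'.2.2 (by simp) h
  cases L with
  | nil =>
    have h1 : IsPathList G (w :: M) := ⟨hn'.2.1, hM⟩
    have h2 : (w :: M).length = detourOrder G := by simp at hlen ⊢; omega
    -- Here x alone is one of the linking paths, so the other is a longest path ending in w. All
    -- neighbours of w lie on it, among them u.
    exact ⟨w :: M, h1, h2, hxM, h1.mem_of_adj_head h2 huw⟩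
  | cons v L =>
    rw [List.isChain_cons_cons] at hL
    obtain rfl := hx v hL.1
    -- The path from x continues with its only neighbour, here called v. Dropping x and using the
    -- edge to w leaves t vertices.
    refine ⟨(v :: L).reverse ++ w :: M, ⟨?_, ?_⟩, ?_, ?_, by simp⟩
    · refine ((List.reverse_perm (v :: L)).append_right _).nodup_iff.2 ?_
      exact (List.nodup_cons.1 hn).2
    · rw [List.isChain_append]
      refine ⟨List.isChain_reverse.2 (hL.2.imp fun _ _ h => h.symm), hM, ?_⟩
      intro a ha b hb
      simp at ha hb
      subst ha; subst hb
      exact huw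
    · simp at hlen ⊢
      omega
    · have := (List.nodup_cons.1 hn).1
      simp at this ⊢
      tauto

end Structure

end DetourSat

namespace DetourSat

open Finset

/-! ### The normal form -/

section Labelling

variable {V : Type u} {G : SimpleGraph V}

/-- The graph on `{0, …, n - 1}` obtained from `G` by the labelling `g`. -/
def relabel (G : SimpleGraph V) (n : ℕ) (g : ℕ → V) : SimpleGraph ℕ where
  Adj i j := i < n ∧ j < n ∧ G.Adj (g i) (g j)
  symm := ⟨fun _ _ h => ⟨h.2.1, h.1, h.2.2.symm⟩⟩
  loopless := ⟨fun _ h => h.2.2.ne rfl⟩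

theorem relabel_adj {n : ℕ} {g : ℕ → V} {i j : ℕ} :
    (relabel G n g).Adj i j ↔ i < n ∧ j < n ∧ G.Adj (g i) (g j) := Iff.rfl

open Classical in
/-- The neighbours of `v` among the first `t` vertices, as a number. -/
noncomputable def mask (G : SimpleGraph V) (t : ℕ) (g : ℕ → V) (v : V) : ℕ :=
  code ((range t).filter fun i => G.Adj v (g i))

theorem lt_of_isChain_relabel {n : ℕ} {g : ℕ → V} {L : List ℕ}
    (hL : L.IsChain (relabel G n g).Adj) (h2 : 2 ≤ L.length) : ∀ i ∈ L, i < n := by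
  induction L with
  | nil => simp
  | cons i L ih =>
    cases L with
    | nil => simp at h2
    | cons j L =>
      rw [List.isChain_cons_cons] at hL
      intro k hk
      rcases List.mem_cons.1 hk with rfl | hk
      · exact hL.1.1
      · cases L with
        | nil =>
          rw [List.mem_singleton.1 hk]
          exact hL.1.2.1
        | cons m L => exact ih hL.2 (by simp) k hk

/-- `x` is a leaf at the vertex with the number `q` on the longest path `L`, and not on `L`. -/
structure LeafAt (G : SimpleGraph V) (L : List V) (x : V) (q : ℕ) : Prop where
  path : IsPathList G L
  length : L.length = detourOrder G
  notMem : x ∉ L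
  adj : ∃ u, L[q]? = some u ∧ ∀ v, G.Adj x v ↔ v = u

theorem LeafAt.lt {L : List V} {x : V} {q : ℕ} (h : LeafAt G L x q) : q < detourOrder G := by
  obtain ⟨u, hu, -⟩ := h.adj
  rw [← h.length]
  exact (List.getElem?_eq_some_iff.1 hu).1

theorem LeafAt.reverse {L : List V} {x : V} {q : ℕ} (h : LeafAt G L x q) :
    LeafAt G L.reverse x (detourOrder G - 1 - q) := by
  have hq := h.lt
  refine ⟨h.path.reverse, by rw [List.length_reverse, h.length], by simpa using h.notMem, ?_⟩
  obtain ⟨u, hu, hv⟩ := h.adj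
  refine ⟨u, ?_, hv⟩
  rw [List.getElem?_reverse (by rw [h.length]; omega), h.length, ← hu]
  congr 1
  omega

variable [Finite V]

theorem labelled_relabel {n l : ℕ} {f : V → ℕ} {g : ℕ → V} (hgf : ∀ v, g (f v) = v)
    (hf : ∀ v, f v < n) (hfg : ∀ i < n, f (g i) = i)
    (hT : ∀ u v w, G.Adj u v → G.Adj v w → ¬ G.Adj u w) (hS : DetourSaturated G)
    (h1 : 1 ≤ detourOrder G) (hn : detourOrder G ≤ n)
    (hpath : ∀ i, i + 1 < detourOrder G → G.Adj (g i) (g (i + 1)))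
    (hsort : ∀ w, detourOrder G ≤ w → w + (if l = 0 then 2 else 3) ≤ n →
      mask G (detourOrder G) g (g w) ≤ mask G (detourOrder G) g (g (w + 1)))
    (hthick : l = 0 → ∀ v i, i < detourOrder G → G.Adj v (g i) → ∃ u, u ≠ g i ∧ G.Adj v u)
    (hleaf : 0 < l → l < detourOrder G ∧ ∀ u, G.Adj (g (n - 1)) u ↔ u = g l)
    (hfar : 0 < l → ∀ w q, detourOrder G ≤ w → w + 2 ≤ n → q < detourOrder G →
      G.Adj (g w) (g q) → (∀ u, G.Adj (g w) u → u = g q) → l ≤ q ∧ q + l < detourOrder G) :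
    Labelled n (detourOrder G) l (relabel G n g) := by
  classical
  have hadj : ∀ u v, (relabel G n g).Adj (f u) (f v) ↔ G.Adj u v := fun u v => by
    rw [relabel_adj, hgf, hgf]
    exact ⟨fun h => h.2.2, fun h => ⟨hf u, hf v, h⟩⟩
  have hfinj : Function.Injective f := fun u v h => by rw [← hgf u, h, hgf]
  have hadj' : ∀ i u, i < n → G.Adj (g i) u → (relabel G n g).Adj i (f u) := fun i u hi h =>
    ⟨hi, hf u, by rwa [hgf]⟩
  refine ⟨fun u v h => h.1, fun u v w h1 h2 h3 => hT _ _ _ h1.2.2 h2.2.2 h3.2.2, ?_, ?_, ?_, ?_,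
    ?_, ?_, ?_, ?_⟩
  · intro v a b hab ha hb
    obtain ⟨c, hc1, hc2, hc⟩ := exists_third_neighbor hT hS (a := g a) (b := g b) (c := g v)
      (fun h => hab (by rw [← hfg a ha.2.1, h, hfg b hb.2.1])) ha.2.2 hb.2.2
    refine ⟨f c, ?_, ?_, hadj' v c ha.1 hc⟩
    · rintro rfl; exact hc1 (hgf c).symm
    · rintro rfl; exact hc2 (hgf c).symm
  · intro L hL hc
    by_cases h2 : 2 ≤ L.length
    · have hlt := lt_of_isChain_relabel hc h2
      have : IsPathList G (L.map g) := by
        refine ⟨?_, ?_⟩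
        · refine (List.nodup_map_iff_inj_on hL).2 fun i hi j hj hij => ?_
          rw [← hfg i (hlt i hi), hij, hfg j (hlt j hj)]
        · rw [List.isChain_map]
          exact hc.imp fun i j h => h.2.2
      simpa using this.length_le
    · omega
  · intro a b ha hb hab hnot
    obtain ⟨L, M, hL, hM, hn, hc⟩ := hS.linked (a := g a) (b := g b)
      (fun h => hab (by rw [← hfg a ha, h, hfg b hb])) fun h => hnot ⟨ha, hb, h⟩
    refine ⟨L.map f, M.map f, ?_, ?_, ?_, ?_⟩
    · rw [← hfg a ha, ← List.map_cons, List.isChain_map]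
      exact hL.imp fun i j h => (hadj i j).2 h
    · rw [← hfg b hb, ← List.map_cons, List.isChain_map]
      exact hM.imp fun i j h => (hadj i j).2 h
    · have := hn.map hfinj
      rwa [List.map_append, List.map_cons, List.map_cons, hfg a ha, hfg b hb] at this
    · simpa using hc
  · exact fun i hi => ⟨by omega, by omega, hpath i hi⟩
  · refine ⟨fun w => if w < n then mask G (detourOrder G) g (g w) else 0, fun w i => ?_, ?_⟩
    · beta_reduce
      split_ifs with hw
      · rw [mask, testBit_code, mem_filter, mem_range, relabel_adj]
        refine and_congr_right fun hi => ⟨fun h => ⟨hw, by omega, h⟩, fun h => h.2.2⟩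
      · simp only [Nat.zero_testBit, Bool.false_eq_true, false_iff, not_and]
        exact fun _ h => hw h.1
    · intro w h2 h3
      have : w + 1 < n := by split_ifs at h3 <;> omega
      simp only [this, if_true, show w < n by omega]
      exact hsort w h2 h3
  · intro h0 v i hi hvi
    obtain ⟨u, hu, hvu⟩ := hthick h0 (g v) i hi hvi.2.2
    refine ⟨f u, ?_, hadj' v u hvi.1 hvu⟩
    rintro rfl
    exact hu (hgf u).symm
  · intro h0 u
    obtain ⟨hl, hu⟩ := hleaf h0
    rw [relabel_adj, hu]
    constructor
    · rintro ⟨-, h2, h3⟩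
      rw [← hfg u h2, h3, hfg l (by omega)]
    · rintro rfl
      exact ⟨by omega, by omega, rfl⟩
  · intro h0 w q h2 h3 h4 h5 h6
    refine hfar h0 w q h2 h3 h4 h5.2.2 fun u hu => ?_
    rw [← h6 (f u) (hadj' w u h5.1 hu), hgf]

/-- A leaf at the end of a longest path would prolong it. Hence position 0 never occurs, and l = 0
is free to mean that there is no such leaf. -/
theorem LeafAt.pos {L : List V} {x : V} {q : ℕ} (h : LeafAt G L x q) : 0 < q := by
  rcases Nat.eq_zero_or_pos q with rfl | hq
  · obtain ⟨u, hu, hv⟩ := h.adj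
    cases L with
    | nil => simp at hu
    | cons y L =>
      simp at hu
      exact (h.notMem (h.path.mem_of_adj_head h.length ((hv y).2 hu))).elim
  · exact hq

/-- A list of all vertices gives a labelling. -/
theorem exists_labelling {W : List V} (hW : W.Nodup) (hmem : ∀ v, v ∈ W) [Nonempty V] :
    ∃ (f : V → ℕ) (g : ℕ → V), (∀ v, g (f v) = v) ∧ (∀ v, f v < Nat.card V) ∧
      (∀ i < Nat.card V, f (g i) = i) ∧ W.length = Nat.card V ∧
      ∀ i (h : i < W.length), g i = W[i] := by
  classical
  have := Fintype.ofFinite V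
  have hlen : W.length = Nat.card V := by
    rw [Nat.card_eq_fintype_card, ← List.toFinset_card_of_nodup hW, ← card_univ]
    congr 1
    ext v
    simp [hmem v]
  refine ⟨fun v => W.idxOf v, fun i => W[i]?.getD (Classical.arbitrary V), ?_, ?_, ?_, hlen, ?_⟩
  · intro v
    simp [List.getElem?_eq_getElem (List.idxOf_lt_length_of_mem (hmem v))]
  · intro v
    rw [← hlen]
    exact List.idxOf_lt_length_of_mem (hmem v)
  · intro i hi
    rw [← hlen] at hi
    simp [List.getElem?_eq_getElem hi, hW.idxOf_getElem]
  · intro i hi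
    simp [List.getElem?_eq_getElem hi]

theorem exists_ordering {L E : List V} (hn : (L ++ E).Nodup) (κ : V → ℕ) :
    ∃ O : List V, (L ++ O ++ E).Nodup ∧ (∀ v, v ∈ L ++ O ++ E) ∧ O.Pairwise fun x y => κ x ≤ κ y := by
  classical
  have := Fintype.ofFinite V
  let r : V → V → Prop := fun x y => κ x ≤ κ y
  have : Std.Total r := ⟨fun x y => le_total (κ x) (κ y)⟩
  have : IsTrans V r := ⟨fun x y z h h' => le_trans (α := ℕ) h h'⟩
  let K : List V := (univ : Finset V).toList.filter fun v => v ∉ L ++ E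
  have hK : ∀ v, v ∈ K.insertionSort r ↔ v ∉ L ∧ v ∉ E := fun v => by
    rw [List.mem_insertionSort]
    simp [K]
  refine ⟨K.insertionSort r, ?_, fun v => ?_, List.pairwise_insertionSort r K⟩
  · have h1 : (K.insertionSort r).Nodup :=
      (List.perm_insertionSort r K).nodup_iff.2 ((nodup_toList univ).filter _)
    rw [List.nodup_append'] at hn
    rw [List.nodup_append', List.nodup_append']
    refine ⟨⟨hn.1, h1, fun v hv hv' => ((hK v).1 hv').1 hv⟩, hn.2.1, fun v hv hv' => ?_⟩
    rcases List.mem_append.1 hv with hv | hv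
    · exact hn.2.2 hv hv'
    · exact ((hK v).1 hv).2 hv'
  · rw [List.mem_append, List.mem_append, hK]
    tauto

/-- A labelling that starts with `L` and ends with `E`, and is sorted in between. -/
theorem exists_sorted_labelling [Nonempty V] {L E : List V} (hn : (L ++ E).Nodup) :
    ∃ (f : V → ℕ) (g : ℕ → V), (∀ v, g (f v) = v) ∧ (∀ v, f v < Nat.card V) ∧
      (∀ i < Nat.card V, f (g i) = i) ∧ (∀ i (h : i < L.length), g i = L[i]) ∧
      (∀ w, L.length ≤ w → w + 1 + E.length < Nat.card V →
        mask G L.length g (g w) ≤ mask G L.length g (g (w + 1))) ∧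
      ∀ i (h : i < E.length), g (Nat.card V - E.length + i) = E[i] := by
  classical
  -- The sorting key has to be given before the labelling exists. It involves only the vertices of
  -- L, whose labels are known in advance; the default value is never used.
  obtain ⟨O, hO, hmem, hs⟩ := exists_ordering hn
    (mask G L.length fun i => L[i]?.getD (Classical.arbitrary V))
  obtain ⟨f, g, hgf, hf, hfg, hlen, hg⟩ := exists_labelling hO hmem
  have hgL : ∀ i (h : i < L.length), g i = L[i] := fun i h => by
    rw [hg i (by simp; omega)]
    simp [List.getElem_append_left, h]
  have hlen' : L.length + O.length + E.length = Nat.card V := by simpa [add_assoc] using hlen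
  have hgO : ∀ i (h : i < O.length), g (L.length + i) = O[i] := fun i h => by
    rw [hg _ (by simp; omega), List.getElem_append_left (by simp; omega),
      List.getElem_append_right (by omega)]
    simp
  refine ⟨f, g, hgf, hf, hfg, hgL, ?_, ?_⟩
  · have hmask : ∀ v, mask G L.length g v =
        mask G L.length (fun i => L[i]?.getD (Classical.arbitrary V)) v := fun v => by
      rw [mask, mask]
      congr 1
      refine filter_congr fun i hi => ?_
      rw [mem_range] at hi
      rw [hgL i hi]
      simp [hi]
    intro w hw hwn
    obtain ⟨k, rfl⟩ := Nat.exists_eq_add_of_le hw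
    rw [hmask, hmask, add_assoc, hgO k (by omega), hgO (k + 1) (by omega)]
    exact List.pairwise_iff_getElem.1 hs k (k + 1) _ _ (by omega)
  · intro i hi
    rw [hg _ (by simp; omega), List.getElem_append_right (by simp; omega)]
    congr 1
    simp
    omega

/-- The position l is the least one over all longest paths and all leaves off them. As a path may be
reversed, minimality also bounds the distance from the other end; this gives both 2 * l < t and the
condition on further leaves. -/
theorem exists_labelled (hT : ∀ u v w, G.Adj u v → G.Adj v w → ¬ G.Adj u w)
    (hS : DetourSaturated G) (h6 : 6 ≤ detourOrder G) (hlt : detourOrder G < Nat.card V) :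
    ∃ (l : ℕ) (f : V → ℕ) (g : ℕ → V), 2 * l < detourOrder G ∧ (∀ v, g (f v) = v) ∧
      (∀ v, f v < Nat.card V) ∧ (∀ i < Nat.card V, f (g i) = i) ∧
      Labelled (Nat.card V) (detourOrder G) l (relabel G (Nat.card V) g) := by
  classical
  have : Nonempty V := (Nat.card_pos_iff.1 (by omega)).1
  have hpath : ∀ {L : List V} {g : ℕ → V}, IsPathList G L → L.length = detourOrder G →
      (∀ i (h : i < L.length), g i = L[i]) →
      ∀ i, i + 1 < detourOrder G → G.Adj (g i) (g (i + 1)) := by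
    intro L g hL hlen hg i hi
    rw [hg i (by omega), hg (i + 1) (by omega)]
    exact List.isChain_iff_getElem.1 hL.2 i (by omega)
  by_cases hleaf : ∃ q, ∃ L x, LeafAt G L x q
  · obtain ⟨L, x, hx⟩ := Nat.find_spec hleaf
    have hmin : ∀ {L x q}, LeafAt G L x q → Nat.find hleaf ≤ q := fun h =>
      Nat.find_min' hleaf ⟨_, _, h⟩
    generalize Nat.find hleaf = l at hx hmin
    have hl := hx.pos
    have hl2 := hmin hx.reverse
    have hl3 := hx.lt
    obtain ⟨f, g, hgf, hf, hfg, hgL, hs, hgE⟩ := exists_sorted_labelling (G := G) (L := L)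
      (E := [x]) (by
        rw [List.nodup_append']
        refine ⟨hx.path.1, by simp, fun v hv hv' => ?_⟩
        rw [List.mem_singleton.1 hv'] at hv
        exact hx.notMem hv)
    rw [hx.length] at hs
    refine ⟨l, f, g, by omega, hgf, hf, hfg, labelled_relabel hgf hf hfg hT hS (by omega) hlt.le
      (hpath hx.path hx.length hgL) (fun w h1 h2 => hs w h1 ?_) (by omega)
      (fun _ => ⟨by omega, ?_⟩) (fun _ w q h1 h2 h3 h4 h5 => ?_)⟩
    · rw [if_neg hl.ne'] at h2
      simp
      omega
    · obtain ⟨u, hu, hv⟩ := hx.adj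
      have h1 := hgE 0 (by simp)
      simp at h1
      rw [h1, hgL l (by rw [hx.length]; omega), (List.getElem?_eq_some_iff.1 hu).2]
      exact hv
    · have hq : LeafAt G L (g w) q := by
        refine ⟨hx.path, hx.length, fun hm => ?_, g q, ?_, fun v => ⟨h5 v, fun h => h ▸ h4⟩⟩
        · obtain ⟨i, hi, hiw⟩ := List.getElem_of_mem hm
          have := hx.length
          rw [← hgL i hi] at hiw
          have h7 := hfg i (by omega)
          rw [hiw, hfg w (by omega)] at h7
          omega
        · rw [hgL q (by rw [hx.length]; omega)]
          simp
      have h7 := hmin hq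
      have h8 := hmin hq.reverse
      omega
  · obtain ⟨L, hL, hlen⟩ := exists_isPathList G
    obtain ⟨f, g, hgf, hf, hfg, hgL, hs, -⟩ := exists_sorted_labelling (G := G) (L := L)
      (E := []) (by simpa using hL.1)
    rw [hlen] at hs
    refine ⟨0, f, g, by omega, hgf, hf, hfg, labelled_relabel hgf hf hfg hT hS (by omega) hlt.le
      (hpath hL hlen hgL) (fun w h1 h2 => hs w h1 ?_) (fun _ v i hi hvi => ?_)
      (fun h => absurd h (by simp)) (fun h => absurd h (by simp))⟩
    · simp at h2 ⊢
      omega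
    · by_contra hcon
      have hv : ∀ u, G.Adj v u → u = g i := fun u hu => by
        by_contra h
        exact hcon ⟨u, h, hu⟩
      have hinj : ∀ i j, i < Nat.card V → j < Nat.card V → g i = g j → i = j := fun i j hi hj h => by
        rw [← hfg i hi, h, hfg j hj]
      have hp := hpath hL hlen hgL
      -- Otherwise v and its neighbour form a component by themselves, but the neighbour lies on a
      -- path with at least six vertices.
      have hw : ∃ w, w ≠ v ∧ G.Adj (g i) w := by
        by_contra hw
        have hw : ∀ w, G.Adj (g i) w → w = v := fun w h => by
          by_contra h'
          exact hw ⟨w, h', h⟩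
        have hpair : ∀ j k, j < detourOrder G → k < detourOrder G → G.Adj (g i) (g j) →
            G.Adj (g j) (g k) → k = i := by
          intro j k hj hk h1 h2
          rw [hw _ h1] at h2
          exact hinj k i (by omega) (by omega) (hv _ h2)
        rcases Nat.lt_or_ge (i + 2) (detourOrder G) with h1 | h1
        · have := hpair (i + 1) (i + 2) (by omega) (by omega) (hp i (by omega))
            (hp (i + 1) (by omega))
          omega
        · obtain ⟨k, rfl⟩ : ∃ k, i = k + 2 := ⟨i - 2, by omega⟩
          have := hpair (k + 1) k (by omega) (by omega) (hp (k + 1) (by omega)).symm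
            (hp k (by omega)).symm
          omega
      obtain ⟨w, hwv, hw⟩ := hw
      -- The leaf v may lie on the chosen path, as an end of it. Another longest path avoids v and
      -- passes through its neighbour, against the assumption that no leaf hangs off a longest path.
      obtain ⟨M, hM, hMlen, hvM, hiM⟩ := exists_path_of_leaf hS hv hvi hwv hw
      obtain ⟨q, hq, hqi⟩ := List.getElem_of_mem hiM
      refine hleaf ⟨q, M, v, hM, hMlen, hvM, g i, ?_, fun u => ⟨hv u, fun h => h ▸ hvi⟩⟩
      rw [← hqi]
      simp

end Labelling

end DetourSat

namespace DetourSat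

open Finset

/-! ### The two graphs and the classification -/

section Graphs

theorem memPairs_eq_true {E : List (ℕ × ℕ)} {a b : ℕ} :
    memPairs E a b = true ↔ (a, b) ∈ E ∨ (b, a) ∈ E := by
  induction E with
  | nil => simp [memPairs]
  | cons p E ih =>
    have h : memPairs (p :: E) a b = orElse (orElse (andThen (Nat.beq p.1 a) (Nat.beq p.2 b))
      (andThen (Nat.beq p.1 b) (Nat.beq p.2 a))) (memPairs E a b) := rfl
    rw [h]
    simp only [orElse_eq, andThen_eq, Bool.or_eq_true, Bool.and_eq_true, Nat.beq_eq, ih,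
      List.mem_cons]
    grind

theorem graphOfEdges_adj {n : ℕ} {E : List (ℕ × ℕ)} {a b : Fin n} :
    (graphOfEdges n E).Adj a b ↔ a ≠ b ∧ memPairs E a b = true := by
  rw [memPairs_eq_true]
  exact SimpleGraph.fromRel_adj _ a b

instance decidableAdjGraphOfEdges (n : ℕ) (E : List (ℕ × ℕ)) :
    DecidableRel (graphOfEdges n E).Adj :=
  fun a b => inferInstanceAs (Decidable (a ≠ b ∧ ((a.val, b.val) ∈ E ∨ (b.val, a.val) ∈ E)))

instance decidableAdjPetersen : DecidableRel petersen.Adj :=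
  decidableAdjGraphOfEdges 10 petersenEdges

/-- The Petersen graph with the vertex `0` split, on `{0, …, 11}`. -/
def splitPetersen : SimpleGraph (Fin 12) := graphOfEdges 12 splitPetersenEdges

instance decidableAdjSplitPetersen : DecidableRel splitPetersen.Adj :=
  decidableAdjGraphOfEdges 12 splitPetersenEdges

instance decidableAdjPetersenTwoLeaves : DecidableRel petersenTwoLeaves.Adj :=
  decidableAdjGraphOfEdges 12 (petersenEdges ++ [(0, 10), (1, 11)])

variable {V : Type u} {G : SimpleGraph V}

theorem nonempty_iso_of_isTarget {f : V → ℕ} {g : ℕ → V} (hgf : ∀ v, g (f v) = v)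
    (hf : ∀ v, f v < 12) (hfg : ∀ i < 12, f (g i) = i) {t : ℕ}
    (h : IsTarget t (relabel G 12 g)) : Nonempty (G ≃g graphOfEdges 12 (targetEdges t)) := by
  obtain ⟨π, hπ, hsurj, hadj⟩ := h
  have hs : Function.Surjective fun i : Fin 12 => (⟨π i, hπ i i.2⟩ : Fin 12) := fun j => by
    obtain ⟨i, hi, hij⟩ := hsurj j j.2
    exact ⟨⟨i, hi⟩, Fin.ext hij⟩
  have hinj := Finite.injective_iff_surjective.2 hs
  have hbij : Function.Bijective fun i : Fin 12 => g (π i) := by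
    constructor
    · intro i j hij
      refine hinj (Fin.ext ?_)
      have := congrArg f hij
      simpa only [hfg _ (hπ i i.2), hfg _ (hπ j j.2)] using this
    · intro v
      obtain ⟨i, hi⟩ := hs ⟨f v, hf v⟩
      refine ⟨i, ?_⟩
      have := congrArg Fin.val hi
      simp only at this
      simp only [this, hgf]
  refine ⟨RelIso.symm ⟨Equiv.ofBijective _ hbij, ?_⟩⟩
  intro i j
  rw [graphOfEdges_adj, ← hadj i i.2 j j.2, relabel_adj]
  change G.Adj (g (π i)) (g (π j)) ↔ _
  refine ⟨fun h => ⟨?_, hπ i i.2, hπ j j.2, h⟩, fun h => h.2.2.2⟩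
  rintro rfl
  exact h.ne rfl

variable [Finite V]

/-- The classification: the normal form meets the checked search trees. The detour order decides
between the two targets. -/
theorem TriangleFreeDetourSaturated.nonempty_iso (h : TriangleFreeDetourSaturated G)
    (hV : Nat.card V ≤ 12) : Nat.card V = 12 ∧
      (Nonempty (G ≃g splitPetersen) ∨ Nonempty (G ≃g petersenTwoLeaves)) := by
  have hT := cliqueFree_three_iff.1 h.triangleFree
  have h6 := six_le_detourOrder hT h.saturated h.finiteGirth
  have hlt := detourOrder_lt_card hT h.saturated h6
  obtain ⟨l, f, g, hl, hgf, hf, hfg, hL⟩ := exists_labelled hT h.saturated h6 hlt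
  obtain ⟨c, hc⟩ := exists_check hV h6 hlt hl
  obtain ⟨h12, ht⟩ := check_sound hV hlt (by omega) hc hL
  refine ⟨h12, ?_⟩
  rw [h12] at hf hfg ht
  obtain ⟨e⟩ := nonempty_iso_of_isTarget hgf hf hfg ht
  rw [targetEdges, select_eq] at e
  split_ifs at e
  · exact Or.inr ⟨e⟩
  · exact Or.inl ⟨e⟩

theorem Linked.map {V : Type*} {W : Type*} {G : SimpleGraph V} {H : SimpleGraph W} {m : ℕ}
    {a b : V} (h : Linked G m a b) {f : V → W} (hf : ∀ x y, G.Adj x y → H.Adj (f x) (f y))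
    (hinj : Function.Injective f) : Linked H m (f a) (f b) := by
  obtain ⟨L, M, hL, hM, hn, hc⟩ := h
  refine ⟨L.map f, M.map f, ?_, ?_, ?_, by simpa using hc⟩
  · rw [← List.map_cons, List.isChain_map]
    exact hL.imp hf
  · rw [← List.map_cons, List.isChain_map]
    exact hM.imp hf
  · rw [← List.map_cons, ← List.map_cons, ← List.map_append]
    exact hn.map hinj

theorem DetourSaturated.of_iso {W : Type*} [Finite W] {H : SimpleGraph W} (h : DetourSaturated H)
    (e : G ≃g H) : DetourSaturated G := by
  refine detourSaturated_of_linked (t := detourOrder H) (fun L hL => ?_) fun a b hab hadj => ?_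
  · have : IsPathList H (L.map e) := by
      refine ⟨hL.1.map e.injective, ?_⟩
      rw [List.isChain_map]
      exact hL.2.imp fun x y h => e.map_adj_iff.2 h
    simpa using this.length_le
  · have h1 := (h.linked (e.injective.ne hab) fun h => hadj (e.map_adj_iff.1 h)).map
      (H := G) (f := e.symm) (fun x y h => e.symm.map_adj_iff.2 h) e.symm.injective
    simpa using h1

theorem TriangleFreeDetourSaturated.of_iso {W : Type*} [Finite W] {H : SimpleGraph W}
    (h : TriangleFreeDetourSaturated H) (e : G ≃g H) : TriangleFreeDetourSaturated G := by
  refine ⟨?_, fun hG => h.finiteGirth (e.isAcyclic_iff.1 hG), h.saturated.of_iso e⟩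
  have := cliqueFree_three_iff.1 h.triangleFree
  exact cliqueFree_three_iff.2 fun u v w huv hvw huw =>
    this _ _ _ (e.map_adj_iff.2 huv) (e.map_adj_iff.2 hvw) (e.map_adj_iff.2 huw)

/-- The code of the graph with the edges `E`. -/
noncomputable def edgesCode (E : List (ℕ × ℕ)) : ℕ :=
  tabulate fun u v => select (Nat.beq u v) false (memPairs E u v)

noncomputable def nonEdgesCode (E : List (ℕ × ℕ)) : ℕ :=
  tabulate fun u v => select (Nat.beq u v) false (select (memPairs E u v) false true)

/-- The pairs that are linked by `t + 1` vertices are the pairs that are not adjacent. -/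
noncomputable def isSaturated (t : ℕ) (E : List (ℕ × ℕ)) : Bool :=
  withValue (edgesCode E) fun P => saturate P (fun X =>
    Nat.beq (linked (dual (Nat.sub 11 t) X) X) (nonEdgesCode E)) 16 (hashed (wide 4095))

/-- One computed equality gives both halves. No edge is linked, so there is no path with t + 1
vertices, by completeness of the closed family; all other pairs are linked, by its soundness. -/
theorem detourSaturated_of_isSaturated {t : ℕ} {E : List (ℕ × ℕ)} (ht : t ≤ 11) (ht1 : 1 ≤ t)
    (h : isSaturated t E = true) : DetourSaturated (graphOfEdges 12 E) := by
  rw [isSaturated, withValue_eq] at h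
  obtain ⟨X, hX, heq, hI⟩ := exists_closed_of_saturate
    (fun v hv => fam_hashed.2 ((fam_start hv (empty_subset _)).2 rfl)) h
  have heq := Nat.eq_of_beq_eq_true heq
  set A : SimpleGraph ℕ := (graphOfEdges 12 E).map Fin.valEmbedding with hA
  have hadj : ∀ i j : Fin 12, A.Adj i j ↔ (graphOfEdges 12 E).Adj i j := fun i j =>
    SimpleGraph.map_adj_apply
  have hlt : ∀ u v, A.Adj u v → u < 12 ∧ v < 12 := fun u v huv => by
    rw [hA, SimpleGraph.map_adj] at huv
    obtain ⟨i, j, -, rfl, rfl⟩ := huv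
    exact ⟨i.2, j.2⟩
  have hbit : ∀ u < 12, ∀ v < 12, (edgesCode E).testBit (16 * u + v) = true ↔ A.Adj u v := by
    intro u hu v hv
    rw [edgesCode, testBit_tabulate _ hu hv, hadj ⟨u, hu⟩ ⟨v, hv⟩, graphOfEdges_adj, select_eq]
    split_ifs with h1
    · simpa using fun h2 => (h2 (Nat.eq_of_beq_eq_true h1)).elim
    · have : u ≠ v := fun h2 => h1 (by rw [h2]; exact Nat.beq_refl v)
      simp [this]
  have hbit' : ∀ u < 12, ∀ v < 12, (nonEdgesCode E).testBit (16 * u + v) = true ↔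
      u ≠ v ∧ ¬ A.Adj u v := by
    intro u hu v hv
    rw [nonEdgesCode, testBit_tabulate _ hu hv, hadj ⟨u, hu⟩ ⟨v, hv⟩, graphOfEdges_adj, select_eq,
      select_eq]
    split_ifs with h1 h2
    · simpa using fun h2 => (h2 (Nat.eq_of_beq_eq_true h1)).elim
    · simp [h2]
    · have : u ≠ v := fun h2 => h1 (by rw [h2]; exact Nat.beq_refl v)
      simp [this, h2]
  have hupper : ∀ u v, A.Adj u v → u < 12 ∧ v < 12 ∧
      (edgesCode E).testBit (16 * u + v) = true := fun u v huv =>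
    ⟨(hlt u v huv).1, (hlt u v huv).2, (hbit u (hlt u v huv).1 v (hlt u v huv).2).2 huv⟩
  have hsound : Sound A X := hI (Sound A)
    (fun X hX => (hX.sweep fun u hu v hv huv => (hbit u hu v hv).1 huv).hashed)
    (sound_start A).hashed
  refine detourSaturated_of_linked (t := t) (fun L hL => ?_) fun a b hab hnot => ?_
  · by_contra hlen
    have hL' : IsPathList (graphOfEdges 12 E) (L.take (t + 1)) :=
      ⟨(List.take_sublist _ _).nodup hL.1, hL.2.take _⟩
    have hlen' : (L.take (t + 1)).length = t + 1 := by
      rw [List.length_take]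
      omega
    match L.take (t + 1), hL', hlen' with
    | [], _, h1 => simp at h1
    | [_], _, h1 => simp at h1; omega
    | a :: b :: M, hL, h1 =>
      have hab := (List.isChain_cons_cons.1 hL.2).1
      -- A path with t + 1 vertices links its first two vertices, which are adjacent: the first one
      -- alone, and the rest.
      have hlink : Linked (graphOfEdges 12 E) (t + 1) a b :=
        ⟨[], M, by simp, (List.isChain_cons_cons.1 hL.2).2, hL.1, by simp at h1 ⊢; omega⟩
      have hlink' : Linked A (t + 1) (a : ℕ) (b : ℕ) :=
        hlink.map (fun x y h => (hadj x y).2 h) Fin.val_injective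
      have hm : (linked (dual (Nat.sub 11 t) X) X).testBit (16 * a + b) = true := by
        rw [testBit_linked b.2]
        rcases lt_trichotomy (a : ℕ) b with h2 | h2 | h2
        · exact ⟨b, b.2, a, h2, hX.meet_ne_zero hupper b.2 a.2 ht hlink'.symm, Or.inr ⟨rfl, rfl⟩⟩
        · exact (hab.ne (Fin.ext h2)).elim
        · exact ⟨a, a.2, b, h2, hX.meet_ne_zero hupper a.2 b.2 ht hlink', Or.inl ⟨rfl, rfl⟩⟩
      rw [heq, hbit' a a.2 b b.2] at hm
      exact hm.2 ((hadj a b).2 hab)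
  · have hm : (linked (dual (Nat.sub 11 t) X) X).testBit (16 * a + b) = true := by
      rw [heq, hbit' a a.2 b b.2]
      exact ⟨fun h => hab (Fin.ext h), fun h => hnot ((hadj a b).1 h)⟩
    obtain ⟨L, M, hL, hM, hn, hc⟩ := hsound.linked_of_testBit b.2 ht hm
    have hpull : ∀ (L : List ℕ) (a : Fin 12), ((a : ℕ) :: L).IsChain A.Adj →
        ∃ L' : List (Fin 12), L'.map Fin.val = L ∧ (a :: L').IsChain (graphOfEdges 12 E).Adj := by
      intro L
      induction L with
      | nil => exact fun a _ => ⟨[], rfl, by simp⟩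
      | cons v L ih =>
        intro a h1
        rw [List.isChain_cons_cons] at h1
        obtain ⟨L', rfl, h2⟩ := ih ⟨v, (hlt _ _ h1.1).2⟩ h1.2
        exact ⟨⟨v, (hlt _ _ h1.1).2⟩ :: L', rfl,
          List.isChain_cons_cons.2 ⟨(hadj a ⟨v, (hlt _ _ h1.1).2⟩).1 h1.1, h2⟩⟩
    obtain ⟨L', rfl, hL'⟩ := hpull L a hL
    obtain ⟨M', rfl, hM'⟩ := hpull M b hM
    refine ⟨L', M', hL', hM', ?_, by simpa using hc⟩
    rw [← List.map_cons, ← List.map_cons, ← List.map_append] at hn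
    exact hn.of_map

/-- A 5-cycle bounds the girth from above; the hypotheses exclude cycles of length three and four.
-/
theorem girth_eq_five {W : Type*} {H : SimpleGraph W}
    (hT : ∀ u v w, H.Adj u v → H.Adj v w → ¬ H.Adj u w)
    (hQ : ∀ a b, H.Adj a b → ∀ c, H.Adj b c → a ≠ c → ∀ d, H.Adj c d → b ≠ d → ¬ H.Adj d a)
    {a b c d e : W} (hn : [a, b, c, d, e].Nodup) (h1 : H.Adj a b) (h2 : H.Adj b c)
    (h3 : H.Adj c d) (h4 : H.Adj d e) (h5 : H.Adj e a) : H.girth = 5 := by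
  have hcyc : (SimpleGraph.Walk.cons h1 (.cons h2 (.cons h3 (.cons h4 (.cons h5 .nil))))).IsCycle := by
    rw [SimpleGraph.Walk.cons_isCycle_iff]
    simp at hn ⊢
    grind
  have hle : H.girth ≤ 5 := SimpleGraph.girth_le_length hcyc
  obtain ⟨v, w, hw, hlen⟩ := SimpleGraph.exists_girth_eq_length.2 fun h => h _ hcyc
  refine le_antisymm hle ?_
  by_contra hlt
  have h3 := hw.three_le_length
  have hn := hw.support_nodup
  have hch := w.isChain_adj_support
  have hlen' : w.support.tail.length = w.length := by simp
  have hlast : w.support.getLast (by simp) = v := w.getLast_support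
  have hsup : w.support = v :: w.support.tail := w.cons_tail_support.symm
  generalize w.support.tail = L at hn hlen' hsup
  rw [hsup] at hch
  simp only [hsup] at hlast
  match L, hlen' with
  | [], h | [_], h | [_, _], h => simp at h; omega
  | [p, q, r], _ =>
    simp at hlast hch
    subst hlast
    exact hT _ _ _ hch.1 hch.2.1 hch.2.2.symm
  | [p, q, r, s], _ =>
    simp at hlast hch hn
    subst hlast
    exact hQ _ _ hch.1 _ hch.2.1 (by grind) _ hch.2.2.1 (by grind) hch.2.2.2
  | _ :: _ :: _ :: _ :: _ :: _, h => simp at h; omega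

theorem splitPetersen_girth : splitPetersen.girth = 5 :=
  girth_eq_five (a := 1) (b := 2) (c := 7) (d := 9) (e := 6) (by decide +kernel) (by decide +kernel)
    (by decide) (by decide) (by decide) (by decide) (by decide) (by decide)

theorem petersenTwoLeaves_girth : petersenTwoLeaves.girth = 5 :=
  girth_eq_five (a := 0) (b := 1) (c := 2) (d := 3) (e := 4) (by decide +kernel) (by decide +kernel)
    (by decide) (by decide) (by decide) (by decide) (by decide) (by decide)

theorem splitPetersen_triangleFreeDetourSaturated : TriangleFreeDetourSaturated splitPetersen := by
  refine ⟨cliqueFree_three_iff.2 (by decide +kernel), fun h => ?_,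
    detourSaturated_of_isSaturated (t := 10) (by norm_num) (by norm_num) (by decide +kernel)⟩
  have := SimpleGraph.girth_eq_zero.2 h
  rw [splitPetersen_girth] at this
  omega

theorem petersenTwoLeaves_triangleFreeDetourSaturated :
    TriangleFreeDetourSaturated petersenTwoLeaves := by
  refine ⟨cliqueFree_three_iff.2 (by decide +kernel), fun h => ?_,
    detourSaturated_of_isSaturated (t := 11) (by norm_num) (by norm_num) (by decide +kernel)⟩
  have := SimpleGraph.girth_eq_zero.2 h
  rw [petersenTwoLeaves_girth] at this
  omega

theorem splitPetersen_ncard_edgeSet : splitPetersen.edgeSet.ncard = 15 := by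
  rw [← SimpleGraph.coe_edgeFinset, Set.ncard_coe_finset]
  decide +kernel

theorem petersenTwoLeaves_ncard_edgeSet : petersenTwoLeaves.edgeSet.ncard = 17 := by
  rw [← SimpleGraph.coe_edgeFinset, Set.ncard_coe_finset]
  decide +kernel

theorem ncard_edgeSet_congr {V W : Type*} {G : SimpleGraph V} {H : SimpleGraph W} (e : G ≃g H) :
    G.edgeSet.ncard = H.edgeSet.ncard := by
  rw [← Nat.card_coe_set_eq, ← Nat.card_coe_set_eq]
  exact Nat.card_congr e.mapEdgeSet

/-- An automorphism of the Petersen graph that maps `x` to `0`. -/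
def petersenShift (x v : Fin 10) : ℕ :=
  -- Modulo 5, v + 4 * x is v - x, a rotation of both pentagons. If x is an inner vertex, the
  -- pentagons are exchanged, and the factor 2 turns steps of length 1 into steps of length 2 and
  -- conversely; x goes to 5 * x, which is 0 modulo 5.
  if (x : ℕ) < 5 then
    if (v : ℕ) < 5 then (v + 4 * x) % 5 else 5 + (v + 4 * x) % 5
  else
    if (v : ℕ) < 5 then 5 + (2 * v + 3 * x) % 5 else (2 * v + 3 * x) % 5

theorem petersenShift_lt (x v : Fin 10) : petersenShift x v < 12 := by
  unfold petersenShift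
  split_ifs <;> omega

/-- The vertex of `splitPetersen` that corresponds to the leaf at `y`. -/
def splitLeaf (x y : Fin 10) : Fin 12 :=
  if petersenShift x y = 1 then 0 else if petersenShift x y = 4 then 10 else 11

def splitMap (x : Fin 10) : {v : Fin 10 // v ≠ x} ⊕ petersen.neighborSet x → Fin 12
  | .inl v => ⟨petersenShift x v, petersenShift_lt x v⟩
  | .inr y => splitLeaf x y

theorem splitMap_bijective (x : Fin 10) : Function.Bijective (splitMap x) := by
  have h1 : ∀ x v w : Fin 10, petersenShift x v = petersenShift x w → v = w := by decide +kernel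
  have h2 : ∀ x v y : Fin 10, v ≠ x → petersen.Adj x y →
      (⟨petersenShift x v, petersenShift_lt x v⟩ : Fin 12) ≠ splitLeaf x y := by decide +kernel
  have h3 : ∀ x y z : Fin 10, petersen.Adj x y → petersen.Adj x z → splitLeaf x y = splitLeaf x z →
      y = z := by decide +kernel
  -- The vertices 1, 4, 5 are the neighbours of 0 in the Petersen graph; their leaves in
  -- `splitPetersen` are 0, 10, 11.
  have h4 : ∀ (x : Fin 10) (j : Fin 12),
      (∃ v, v ≠ x ∧ (⟨petersenShift x v, petersenShift_lt x v⟩ : Fin 12) = j) ∨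
        ∃ y, petersen.Adj x y ∧ splitLeaf x y = j := by decide +kernel
  constructor
  · rintro (v | y) (w | z) h
    · exact congrArg _ (Subtype.ext (h1 x v w (congrArg Fin.val h)))
    · exact (h2 x v z v.2 z.2 h).elim
    · exact (h2 x w y w.2 y.2 h.symm).elim
    · exact congrArg _ (Subtype.ext (h3 x y z y.2 z.2 h))
  · intro j
    rcases h4 x j with ⟨v, hv, h⟩ | ⟨y, hy, h⟩
    · exact ⟨.inl ⟨v, hv⟩, h⟩
    · exact ⟨.inr ⟨y, hy⟩, h⟩

theorem nonempty_iso_splitPetersen (x : Fin 10) : Nonempty (Pr x ≃g splitPetersen) := by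
  have h1 : ∀ x v w : Fin 10, v ≠ x → w ≠ x → (splitPetersen.Adj
      ⟨petersenShift x v, petersenShift_lt x v⟩ ⟨petersenShift x w, petersenShift_lt x w⟩ ↔
      petersen.Adj v w) := by decide +kernel
  have h2 : ∀ x v y : Fin 10, v ≠ x → petersen.Adj x y → (splitPetersen.Adj
      ⟨petersenShift x v, petersenShift_lt x v⟩ (splitLeaf x y) ↔ v = y) := by decide +kernel
  have h3 : ∀ x y z : Fin 10, ¬ splitPetersen.Adj (splitLeaf x y) (splitLeaf x z) := by
    decide +kernel
  refine ⟨⟨Equiv.ofBijective _ (splitMap_bijective x), ?_⟩⟩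
  rintro (v | y) (w | z)
  · exact h1 x v w v.2 w.2
  · exact h2 x v z v.2 z.2
  · exact (SimpleGraph.adj_comm _ _ _).trans (h2 x w y w.2 y.2)
  · exact ⟨fun h => (h3 x y z h).elim, fun h => h.elim⟩

end Graphs

end DetourSat

/-! ### The theorem, assembled from the classification and the sizes -/

theorem theorem2 (x : Fin 10) :
    -- `Pr` is the (unique) smallest triangle-free detour-saturated graph:
    -- of minimum order, and of minimum size among those of that order
    (DetourSat.TriangleFreeDetourSaturated (DetourSat.Pr x) ∧
      ∀ (V : Type u) [Finite V] (G : SimpleGraph V),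
        DetourSat.TriangleFreeDetourSaturated G →
          Nat.card ({v : Fin 10 // v ≠ x} ⊕ DetourSat.petersen.neighborSet x) ≤ Nat.card V ∧
          (Nat.card V = Nat.card ({v : Fin 10 // v ≠ x} ⊕ DetourSat.petersen.neighborSet x) →
            (DetourSat.Pr x).edgeSet.ncard ≤ G.edgeSet.ncard ∧
            (G.edgeSet.ncard = (DetourSat.Pr x).edgeSet.ncard →
              Nonempty (G ≃g DetourSat.Pr x)))) ∧
    -- up to isomorphism there are exactly two such graphs of order at most 12
    (¬ Nonempty (DetourSat.Pr x ≃g DetourSat.petersenTwoLeaves) ∧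
      ∀ (V : Type u) [Finite V] (G : SimpleGraph V), Nat.card V ≤ 12 →
        (DetourSat.TriangleFreeDetourSaturated G ↔
          Nonempty (G ≃g DetourSat.Pr x) ∨ Nonempty (G ≃g DetourSat.petersenTwoLeaves))) ∧
    -- their orders, girths and sizes
    (Nat.card ({v : Fin 10 // v ≠ x} ⊕ DetourSat.petersen.neighborSet x) = 12 ∧
      (DetourSat.Pr x).girth = 5 ∧ (DetourSat.Pr x).edgeSet.ncard = 15) ∧
    (Nat.card (Fin 12) = 12 ∧
      DetourSat.petersenTwoLeaves.girth = 5 ∧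
      DetourSat.petersenTwoLeaves.edgeSet.ncard = 17) := by
  open DetourSat in
  obtain ⟨e⟩ := nonempty_iso_splitPetersen x
  have hcard : Nat.card ({v : Fin 10 // v ≠ x} ⊕ petersen.neighborSet x) = 12 := by
    rw [Nat.card_congr e.toEquiv, Nat.card_fin]
  have hsize : (Pr x).edgeSet.ncard = 15 :=
    (ncard_edgeSet_congr e).trans splitPetersen_ncard_edgeSet
  refine ⟨⟨splitPetersen_triangleFreeDetourSaturated.of_iso e, fun V _ G hG => ?_⟩,
    ⟨?_, fun V _ G hV => ⟨fun hG => ?_, ?_⟩⟩, ⟨hcard, ?_, hsize⟩,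
    Nat.card_fin 12, petersenTwoLeaves_girth, petersenTwoLeaves_ncard_edgeSet⟩
  · rw [hcard, hsize]
    refine ⟨?_, fun hV => ?_⟩
    · by_contra hV
      have := (hG.nonempty_iso (by omega)).1
      omega
    · rcases (hG.nonempty_iso hV.le).2 with ⟨⟨e'⟩⟩ | ⟨⟨e'⟩⟩
      · rw [ncard_edgeSet_congr e', splitPetersen_ncard_edgeSet]
        exact ⟨le_rfl, fun _ => ⟨e'.trans e.symm⟩⟩
      · rw [ncard_edgeSet_congr e', petersenTwoLeaves_ncard_edgeSet]
        exact ⟨by omega, fun h => by omega⟩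
  · rintro ⟨e'⟩
    have := ncard_edgeSet_congr e'
    rw [hsize, petersenTwoLeaves_ncard_edgeSet] at this
    omega
  · exact (hG.nonempty_iso hV).2.imp_left fun ⟨e'⟩ => ⟨e'.trans e.symm⟩
  · rintro (⟨⟨e'⟩⟩ | ⟨⟨e'⟩⟩)
    · exact splitPetersen_triangleFreeDetourSaturated.of_iso (e'.trans e)
    · exact petersenTwoLeaves_triangleFreeDetourSaturated.of_iso e'
  · exact e.girth_eq.trans splitPetersen_girth
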